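/- Let $n,m\ge 0$, let $E$ be a smooth (i.e. $C^\infty$) Hausdorff $\sigma$-compact manifold of dimension $n+m$, and let $\Gamma$ be a smooth torsion-free linear connection on $TE\to E$. Let $J^1(E,n)$ be the Grassmann bundle of $n$-dimensional subspaces of tangent spaces of $E$, with projection $\pi_{1,0}\colon J^1(E,n)\to E$. A divided chart on $E$ is a chart whose coordinates $u^A$ are split as $(u^\lambda,u^i)$, $1\le\lambda\le n$, $1\le i\le m$. It induces coordinates $(u^\lambda,u^i,u^i_\lambda)$ on the open set of those $\theta\in J^1(E,n)$ on which the $du^\lambda$ are linearly independent, where $\theta$ is spanned by the vectors $\partial_{u^\lambda}+u^i_\lambda\,\partial_{u^i}$; these are the smooth charts of $J^1(E,n)$. (Repeated indices are summed.) Consider the following vector bundles on $J^1(E,n)$: $T^{1,0}=\pi_{1,0}^*(TE)$; the tautological subbundle $H^{1,0}\subset T^{1,0}$, whose fibre at $\theta$ is $\theta$; and $V^{1,0}=T^{1,0}/H^{1,0}$. Let $D^1$ be the inclusion $H^{1,0}\to T^{1,0}$, regarded as a section of $H^{1,0*}\otimes T^{1,0}$, and let $\omega^1\colon T^{1,0}\to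 V^{1,0}$ be the quotient map. Identify $\ker T\pi_{1,0}$ with $H^{1,0*}\otimes V^{1,0}$ by sending the velocity $\gamma'(0)$ of a curve $\gamma$ in a fibre of $\pi_{1,0}$ to the class modulo $H^{1,0}$ of the derivative of $D^1(\gamma(t))$ at $t=0$; in coordinates $\partial_{u^k_\xi}\mapsto du^\xi\otimes[\partial_{u^k}]$. A connection on $\pi_{1,0}$ is given by its vertical-valued form $\upsilon$, a smooth projection of $TJ^1(E,n)$ onto $\ker T\pi_{1,0}$. For a linear connection $\Xi$ on $H^{1,0*}$ let $\Omega=\Xi\otimes\pi_{1,0}^*(\Gamma)$ be the tensor product connection on $H^{1,0*}\otimes T^{1,0}$, let $\upsilon_\Omega$ be its vertical-valued form, and let $\nabla[\Omega]$ be its covariant derivative, so that $\upsilon_\Omega\circ TD^1\circ X=\nabla[\Omega]_X D^1$. **Theorem.** With $\Gamma$ there is naturally associated a connection $\dot\Gamma$ on $\pi_{1,0}\colon J^1(E,n)\to E$. More precisely: 1. Smooth linear connections $\Xi$ on $H^{1,0*}$ exist, and there is a connection $\dot\Gamma$ on $\pi_{1,0}$ such that, for every such $\Xi$, $\dot\Gamma$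 is the unique connection on $\pi_{1,0}$ with $$\upsilon_{\dot\Gamma}=(\mathrm{id}\otimes\omega^1)\circ\upsilon_\Omega\circ TD^1,\qquad \Omega=\Xi\otimes\pi_{1,0}^*(\Gamma).$$ In particular $\dot\Gamma$ does not depend on the choice of $\Xi$. 2. In every divided chart, with Christoffel symbols defined by $\nabla[\Gamma]_{\partial_{u^A}}\partial_{u^B}=\Gamma_A{}^C{}_B\,\partial_{u^C}$ and $\upsilon_{\dot\Gamma}=(du^k_\xi+\dot\Gamma_A{}^k{}_\xi\,du^A)\otimes\partial_{u^k_\xi}$, $$\dot\Gamma_A{}^k{}_\xi=\Gamma_A{}^k{}_\xi+\Gamma_A{}^k{}_i\,u^i_\xi-u^k_\beta\bigl(\Gamma_A{}^\beta{}_\xi+\Gamma_A{}^\beta{}_i\,u^i_\xi\bigr).$$ 3. The construction is natural: if $E'$ is another such manifold with a smooth torsion-free linear connection $\Gamma'$, and $f\colon E\to E'$ is a local diffeomorphism that carries $\Gamma$ to $\Gamma'$, then the prolongation $J^1f\colon J^1(E,n)\to J^1(E',n)$, $\theta\mapsto Tf(\theta)$, carries $\dot\Gamma$ to $\dot\Gamma'$,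 that is, $T(J^1f)\circ\upsilon_{\dot\Gamma}=\upsilon_{\dot\Gamma'}\circ T(J^1f)$. -/

import Mathlib

open Bundle Set ContinuousLinearMap Function
open scoped Manifold ContDiff Topology

noncomputable section

/-- The space `ℝⁿ × ℝᵐ` in which divided charts take their values. -/
abbrev Coord (n m : ℕ) : Type := (Fin n → ℝ) × (Fin m → ℝ)

/-- The space of jet coordinates `(u^A, u^i_λ)`; the `u^i_λ` are the entries of a linear map
`ℝⁿ → ℝᵐ`. -/
abbrev JetCoord (n m : ℕ) : Type := Coord n m × ((Fin n → ℝ) →L[ℝ] (Fin m → ℝ))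

/-- The Grassmann bundle `J¹(E, n)`: a point is an `n`-dimensional subspace `plane` of the tangent
space of `E` at a point `pt`. -/
@[ext] structure Jet (n m : ℕ) (E : Type*) [TopologicalSpace E] [ChartedSpace (Coord n m) E] where
  pt : E
  plane : Submodule ℝ (TangentSpace 𝓘(ℝ, Coord n m) pt)
  finrank_plane : Module.finrank ℝ plane = n

namespace Jet

variable {n m : ℕ} {E : Type*} [TopologicalSpace E] [ChartedSpace (Coord n m) E]

/-- The differential of a chart of `E`, at a point of `E`. -/
abbrev dChart (φ : OpenPartialHomeomorph E (Coord n m)) (p : E) :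
    TangentSpace 𝓘(ℝ, Coord n m) p →L[ℝ] Coord n m :=
  mfderiv 𝓘(ℝ, Coord n m) 𝓘(ℝ, Coord n m) φ p

/-- The restriction of `(du^1, …, du^n)` to the plane `θ`. -/
def horMap (φ : OpenPartialHomeomorph E (Coord n m)) (θ : Jet n m E) :
    θ.plane →L[ℝ] (Fin n → ℝ) :=
  (ContinuousLinearMap.fst ℝ (Fin n → ℝ) (Fin m → ℝ)).comp
    ((dChart φ θ.pt).comp θ.plane.subtypeL)

/-- The linear map `(u^i_λ)` whose graph is the image of the plane `θ` in the chart `φ`. -/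
def slope (φ : OpenPartialHomeomorph E (Coord n m)) (θ : Jet n m E) :
    (Fin n → ℝ) →L[ℝ] (Fin m → ℝ) :=
  (ContinuousLinearMap.snd ℝ (Fin n → ℝ) (Fin m → ℝ)).comp
    (((dChart φ θ.pt).comp θ.plane.subtypeL).comp (horMap φ θ).inverse)

/-- The jets to which the divided chart `φ` is concordant. -/
def domain (φ : OpenPartialHomeomorph E (Coord n m)) : Set (Jet n m E) :=
  {θ | θ.pt ∈ φ.source ∧ (horMap φ θ).IsInvertible}

open Classical in
/-- The plane spanned by an injective linear map `g`, as a jet (a junk value if `g` is not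
injective). -/
def ofFrame (p : E) (g : (Fin n → ℝ) →L[ℝ] TangentSpace 𝓘(ℝ, Coord n m) p) : Jet n m E :=
  if hg : Injective g then
    ⟨p, g.toLinearMap.range, by
      rw [LinearMap.finrank_range_of_inj hg]; simp⟩
  else
    ⟨p, (show (Fin n → ℝ) →ₗ[ℝ] TangentSpace 𝓘(ℝ, Coord n m) p from
        LinearMap.inl ℝ (Fin n → ℝ) (Fin m → ℝ)).range, by
      rw [LinearMap.finrank_range_of_inj (f := show (Fin n → ℝ) →ₗ[ℝ] TangentSpace 𝓘(ℝ, Coord n m) p from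
        LinearMap.inl ℝ (Fin n → ℝ) (Fin m → ℝ)) LinearMap.inl_injective]; simp⟩

/-- The graph of `w`, as a linear map `v ↦ (v, w v)`. -/
def graphMap (w : (Fin n → ℝ) →L[ℝ] (Fin m → ℝ)) : (Fin n → ℝ) →L[ℝ] Coord n m :=
  (ContinuousLinearMap.id ℝ _).prod w

lemma graphMap_apply (w : (Fin n → ℝ) →L[ℝ] (Fin m → ℝ)) (v) : graphMap w v = (v, w v) := rfl

lemma graphMap_injective (w : (Fin n → ℝ) →L[ℝ] (Fin m → ℝ)) : Injective (graphMap w) :=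
  fun _ _ h => congrArg Prod.fst h

/-- Inverse of the jet chart: the plane at `φ⁻¹ x` whose image in the chart is the graph of `w`. -/
def ofCoord (φ : OpenPartialHomeomorph E (Coord n m)) (x : JetCoord n m) : Jet n m E :=
  ofFrame (φ.symm x.1) ((dChart φ (φ.symm x.1)).inverse.comp (graphMap x.2))

lemma isInvertible_dChart {φ : OpenPartialHomeomorph E (Coord n m)}
    (hφ : φ ∈ IsManifold.maximalAtlas 𝓘(ℝ, Coord n m) ∞ E) {p : E} (hp : p ∈ φ.source) :
    (dChart φ p).IsInvertible := by
  have h : φ.MDifferentiable 𝓘(ℝ, Coord n m) 𝓘(ℝ, Coord n m) :=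
    ⟨(contMDiffOn_of_mem_maximalAtlas hφ).mdifferentiableOn (by simp),
      (contMDiffOn_symm_of_mem_maximalAtlas hφ).mdifferentiableOn (by simp)⟩
  exact ⟨h.mfderiv hp, rfl⟩

lemma horMap_isInvertible_iff (φ : OpenPartialHomeomorph E (Coord n m)) (θ : Jet n m E) :
    (horMap φ θ).IsInvertible ↔ Injective (horMap φ θ) := by
  refine ⟨fun h => h.injective, fun h => ?_⟩
  have : FiniteDimensional ℝ (TangentSpace 𝓘(ℝ, Coord n m) θ.pt) :=
    inferInstanceAs (FiniteDimensional ℝ (Coord n m))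
  have : T2Space (TangentSpace 𝓘(ℝ, Coord n m) θ.pt) := inferInstanceAs (T2Space (Coord n m))
  have hd : Module.finrank ℝ θ.plane = Module.finrank ℝ (Fin n → ℝ) := by
    rw [θ.finrank_plane]; simp
  exact ⟨(LinearEquiv.ofInjectiveOfFinrankEq (horMap φ θ).toLinearMap h hd).toContinuousLinearEquiv,
    by ext; rfl⟩

/-- In coordinates, an element of the plane is `(v, slope v)`. -/
lemma dChart_eq_graphMap {φ : OpenPartialHomeomorph E (Coord n m)} {θ : Jet n m E}
    (hθ : θ ∈ domain φ) (h : θ.plane) :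
    dChart φ θ.pt h = graphMap (slope φ θ) (horMap φ θ h) := by
  rw [graphMap_apply]
  have : (horMap φ θ).inverse (horMap φ θ h) = h := hθ.2.inverse_apply_self h
  refine Prod.ext rfl ?_
  simp only [slope, ContinuousLinearMap.comp_apply, this]
  rfl

lemma ofFrame_of_injective {p : E} {g : (Fin n → ℝ) →L[ℝ] TangentSpace 𝓘(ℝ, Coord n m) p}
    (hg : Injective g) :
    ofFrame p g = ⟨p, g.toLinearMap.range, by rw [LinearMap.finrank_range_of_inj hg]; simp⟩ := by
  rw [ofFrame, dif_pos hg]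

lemma ofFrame_eq {θ : Jet n m E} {g : (Fin n → ℝ) →L[ℝ] TangentSpace 𝓘(ℝ, Coord n m) θ.pt}
    (hg : Injective g) (h : θ.plane = g.toLinearMap.range) : ofFrame θ.pt g = θ := by
  rw [ofFrame_of_injective hg]
  cases θ
  congr
  exact h.symm

/-- If the plane of `θ` is spanned by a frame whose image in the chart is `(v, w v)` then `θ` lies
in the domain of the jet chart and its slope is `w`. -/
lemma mem_domain_of_frame {φ : OpenPartialHomeomorph E (Coord n m)} {θ : Jet n m E}
    (hp : θ.pt ∈ φ.source) (g : (Fin n → ℝ) →L[ℝ] TangentSpace 𝓘(ℝ, Coord n m) θ.pt)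
    (hg : θ.plane = g.toLinearMap.range) {a : (Fin n → ℝ) →L[ℝ] (Fin n → ℝ)}
    {b : (Fin n → ℝ) →L[ℝ] (Fin m → ℝ)} (ha : a.IsInvertible)
    (h : ∀ v, dChart φ θ.pt (g v) = (a v, b v)) :
    θ ∈ domain φ ∧ slope φ θ = b.comp a.inverse := by
  have hmem : ∀ v, g v ∈ θ.plane := fun v => by rw [hg]; exact ⟨v, rfl⟩
  have hhor : ∀ v, horMap φ θ ⟨g v, hmem v⟩ = a v := fun v => congrArg Prod.fst (h v)
  have hdom : θ ∈ domain φ := by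
    refine ⟨hp, (horMap_isInvertible_iff φ θ).2 ?_⟩
    rw [injective_iff_map_eq_zero]
    rintro ⟨x, hx⟩ h0
    rw [hg] at hx
    obtain ⟨v, rfl⟩ := hx
    have := (hhor v).symm.trans h0
    have hv : v = 0 := ha.injective (by simpa using this)
    subst hv
    ext
    simp
  refine ⟨hdom, ?_⟩
  ext1 v
  obtain ⟨u, rfl⟩ := ha.surjective v
  have h1 := dChart_eq_graphMap hdom ⟨g u, hmem u⟩
  rw [hhor, graphMap_apply, h u] at h1
  have := congrArg Prod.snd h1
  simp only [ContinuousLinearMap.comp_apply, ha.inverse_apply_self]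
  exact this.symm

/-- A frame of the plane in the domain of a jet chart. -/
lemma range_inverse_graphMap {φ : OpenPartialHomeomorph E (Coord n m)}
    (hφ : φ ∈ IsManifold.maximalAtlas 𝓘(ℝ, Coord n m) ∞ E) {θ : Jet n m E} (hθ : θ ∈ domain φ) :
    θ.plane = ((dChart φ θ.pt).inverse.comp (graphMap (slope φ θ))).toLinearMap.range := by
  have hinv := isInvertible_dChart hφ hθ.1
  apply le_antisymm
  · intro x hx
    refine ⟨horMap φ θ ⟨x, hx⟩, ?_⟩
    have := dChart_eq_graphMap hθ ⟨x, hx⟩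
    simp only [ContinuousLinearMap.coe_coe, ContinuousLinearMap.comp_apply]
    rw [← this, hinv.inverse_apply_self]
  · rintro _ ⟨v, rfl⟩
    obtain ⟨u, rfl⟩ := hθ.2.surjective v
    have := dChart_eq_graphMap hθ u
    simp only [ContinuousLinearMap.coe_coe, ContinuousLinearMap.comp_apply]
    rw [← this, hinv.inverse_apply_self]
    exact u.2

lemma ofCoord_spec {φ : OpenPartialHomeomorph E (Coord n m)}
    (hφ : φ ∈ IsManifold.maximalAtlas 𝓘(ℝ, Coord n m) ∞ E) {x : JetCoord n m} (hx : x.1 ∈ φ.target) :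
    (ofCoord φ x).pt = φ.symm x.1 ∧ ofCoord φ x ∈ domain φ ∧ slope φ (ofCoord φ x) = x.2 := by
  have hp := φ.map_target hx
  have hinv := isInvertible_dChart hφ hp
  have hinj : Injective ((dChart φ (φ.symm x.1)).inverse.comp (graphMap x.2)) :=
    hinv.inverse.injective.comp (graphMap_injective x.2)
  have key : ofCoord φ x = ⟨_, _, _⟩ := ofFrame_of_injective hinj
  rw [key]
  refine ⟨rfl, ?_⟩
  have := mem_domain_of_frame (φ := φ) (θ := ⟨φ.symm x.1,
      ((dChart φ (φ.symm x.1)).inverse.comp (graphMap x.2)).toLinearMap.range,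
      by rw [LinearMap.finrank_range_of_inj hinj]; simp⟩) hp
    ((dChart φ (φ.symm x.1)).inverse.comp (graphMap x.2)) rfl (a := .id ℝ _) (b := x.2)
    ⟨.refl ℝ _, rfl⟩ (fun v => hinv.self_apply_inverse _)
  refine ⟨this.1, this.2.trans ?_⟩
  ext
  simp

/-- The jet chart `(u^A, u^i_λ)` induced by a divided chart `(u^A)` of `E`, as a partial
equivalence. -/
def chartEquiv (φ : OpenPartialHomeomorph E (Coord n m))
    (hφ : φ ∈ IsManifold.maximalAtlas 𝓘(ℝ, Coord n m) ∞ E) : PartialEquiv (Jet n m E) (JetCoord n m) where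
  toFun θ := (φ θ.pt, slope φ θ)
  invFun := ofCoord φ
  source := domain φ
  target := φ.target ×ˢ univ
  map_source' θ hθ := ⟨φ.map_source hθ.1, mem_univ _⟩
  map_target' x hx := (ofCoord_spec hφ hx.1).2.1
  left_inv' θ hθ := by
    have hinj : Injective ((dChart φ θ.pt).inverse.comp (graphMap (slope φ θ))) :=
      (isInvertible_dChart hφ hθ.1).inverse.injective.comp (graphMap_injective _)
    rw [ofCoord]
    simp only
    rw [φ.left_inv hθ.1]
    exact ofFrame_eq hinj (range_inverse_graphMap hφ hθ)
  right_inv' x hx := by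
    obtain ⟨h1, h2, h3⟩ := ofCoord_spec hφ hx.1
    ext1
    · simp only [h1]; exact φ.right_inv hx.1
    · exact h3

/-- The derivative of the change of charts from `φ` to `ψ`, applied to the frame `(v, w v)`. -/
def transFrame (φ ψ : OpenPartialHomeomorph E (Coord n m)) (x : JetCoord n m) :
    (Fin n → ℝ) →L[ℝ] Coord n m :=
  (fderiv ℝ (ψ ∘ φ.symm) x.1).comp (graphMap x.2)

def transHor (φ ψ : OpenPartialHomeomorph E (Coord n m)) (x : JetCoord n m) :
    (Fin n → ℝ) →L[ℝ] (Fin n → ℝ) :=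
  (ContinuousLinearMap.fst ℝ (Fin n → ℝ) (Fin m → ℝ)).comp (transFrame φ ψ x)

def transVer (φ ψ : OpenPartialHomeomorph E (Coord n m)) (x : JetCoord n m) :
    (Fin n → ℝ) →L[ℝ] (Fin m → ℝ) :=
  (ContinuousLinearMap.snd ℝ (Fin n → ℝ) (Fin m → ℝ)).comp (transFrame φ ψ x)

lemma dChart_trans {φ ψ : OpenPartialHomeomorph E (Coord n m)}
    (hφ : φ ∈ IsManifold.maximalAtlas 𝓘(ℝ, Coord n m) ∞ E)
    (hψ : ψ ∈ IsManifold.maximalAtlas 𝓘(ℝ, Coord n m) ∞ E) {p : E}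
    (hp : p ∈ φ.source) (hp' : p ∈ ψ.source) :
    dChart ψ p = (fderiv ℝ (ψ ∘ φ.symm) (φ p)).comp (dChart φ p) := by
  have h1 : MDifferentiableAt 𝓘(ℝ, Coord n m) 𝓘(ℝ, Coord n m) φ p :=
    (contMDiffAt_of_mem_maximalAtlas hφ hp).mdifferentiableAt (by simp)
  have h2 : MDifferentiableAt 𝓘(ℝ, Coord n m) 𝓘(ℝ, Coord n m) φ.symm (φ p) :=
    (contMDiffAt_symm_of_mem_maximalAtlas hφ (φ.map_source hp)).mdifferentiableAt (by simp)
  have h3 : MDifferentiableAt 𝓘(ℝ, Coord n m) 𝓘(ℝ, Coord n m) ψ (φ.symm (φ p)) := by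
    rw [φ.left_inv hp]
    exact (contMDiffAt_of_mem_maximalAtlas hψ hp').mdifferentiableAt (by simp)
  have h4 : MDifferentiableAt 𝓘(ℝ, Coord n m) 𝓘(ℝ, Coord n m) (ψ ∘ φ.symm) (φ p) := h3.comp _ h2
  have h5 : ψ =ᶠ[𝓝 p] (ψ ∘ φ.symm) ∘ φ := by
    filter_upwards [φ.open_source.mem_nhds hp] with q hq
    simp [φ.left_inv hq]
  rw [← mfderiv_eq_fderiv]
  exact h5.mfderiv_eq.trans (mfderiv_comp p h4 h1)

lemma dChart_trans_apply {φ ψ : OpenPartialHomeomorph E (Coord n m)}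
    (hφ : φ ∈ IsManifold.maximalAtlas 𝓘(ℝ, Coord n m) ∞ E)
    (hψ : ψ ∈ IsManifold.maximalAtlas 𝓘(ℝ, Coord n m) ∞ E) {θ : Jet n m E}
    (hθ : θ ∈ domain φ) (hp' : θ.pt ∈ ψ.source) (h : θ.plane) :
    dChart ψ θ.pt h = transFrame φ ψ (chartEquiv φ hφ θ) (horMap φ θ h) := by
  rw [dChart_trans hφ hψ hθ.1 hp']
  simp only [ContinuousLinearMap.comp_apply, transFrame]
  rw [dChart_eq_graphMap hθ]
  rfl

lemma horMap_trans_apply {φ ψ : OpenPartialHomeomorph E (Coord n m)}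
    (hφ : φ ∈ IsManifold.maximalAtlas 𝓘(ℝ, Coord n m) ∞ E)
    (hψ : ψ ∈ IsManifold.maximalAtlas 𝓘(ℝ, Coord n m) ∞ E) {θ : Jet n m E}
    (hθ : θ ∈ domain φ) (hp' : θ.pt ∈ ψ.source) (h : θ.plane) :
    horMap ψ θ h = transHor φ ψ (chartEquiv φ hφ θ) (horMap φ θ h) :=
  congrArg Prod.fst (dChart_trans_apply hφ hψ hθ hp' h)

lemma horMap_trans {φ ψ : OpenPartialHomeomorph E (Coord n m)}
    (hφ : φ ∈ IsManifold.maximalAtlas 𝓘(ℝ, Coord n m) ∞ E)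
    (hψ : ψ ∈ IsManifold.maximalAtlas 𝓘(ℝ, Coord n m) ∞ E) {θ : Jet n m E}
    (hθ : θ ∈ domain φ) (hp' : θ.pt ∈ ψ.source) :
    horMap ψ θ = (transHor φ ψ (chartEquiv φ hφ θ)).comp (horMap φ θ) :=
  ContinuousLinearMap.ext fun h => horMap_trans_apply hφ hψ hθ hp' h

lemma mem_domain_iff {φ ψ : OpenPartialHomeomorph E (Coord n m)}
    (hφ : φ ∈ IsManifold.maximalAtlas 𝓘(ℝ, Coord n m) ∞ E)
    (hψ : ψ ∈ IsManifold.maximalAtlas 𝓘(ℝ, Coord n m) ∞ E) {θ : Jet n m E}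
    (hθ : θ ∈ domain φ) (hp' : θ.pt ∈ ψ.source) :
    θ ∈ domain ψ ↔ (transHor φ ψ (chartEquiv φ hφ θ)).IsInvertible := by
  have h := horMap_trans hφ hψ hθ hp'
  constructor
  · intro h'
    have : transHor φ ψ (chartEquiv φ hφ θ) = (horMap ψ θ).comp (horMap φ θ).inverse := by
      rw [h, ContinuousLinearMap.comp_assoc, hθ.2.self_comp_inverse]; rfl
    rw [this]
    exact h'.2.comp hθ.2.inverse
  · intro h'
    exact ⟨hp', by rw [h]; exact h'.comp hθ.2⟩

lemma slope_trans {φ ψ : OpenPartialHomeomorph E (Coord n m)}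
    (hφ : φ ∈ IsManifold.maximalAtlas 𝓘(ℝ, Coord n m) ∞ E)
    (hψ : ψ ∈ IsManifold.maximalAtlas 𝓘(ℝ, Coord n m) ∞ E) {θ : Jet n m E}
    (hθ : θ ∈ domain φ) (hθ' : θ ∈ domain ψ) :
    slope ψ θ = (transVer φ ψ (chartEquiv φ hφ θ)).comp
      (transHor φ ψ (chartEquiv φ hφ θ)).inverse := by
  have hA := (mem_domain_iff hφ hψ hθ hθ'.1).1 hθ'
  ext1 v
  obtain ⟨u, rfl⟩ := hA.surjective v
  obtain ⟨h, rfl⟩ := hθ.2.surjective u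
  simp only [ContinuousLinearMap.comp_apply, hA.inverse_apply_self]
  rw [← horMap_trans_apply hφ hψ hθ hθ'.1]
  have h1 := dChart_eq_graphMap hθ' h
  rw [dChart_trans_apply hφ hψ hθ hθ'.1] at h1
  exact (congrArg Prod.snd h1).symm

lemma contDiffOn_transFrame {φ ψ : OpenPartialHomeomorph E (Coord n m)}
    (hφ : φ ∈ IsManifold.maximalAtlas 𝓘(ℝ, Coord n m) ∞ E)
    (hψ : ψ ∈ IsManifold.maximalAtlas 𝓘(ℝ, Coord n m) ∞ E) :
    ContDiffOn ℝ ∞ (transFrame φ ψ) ((φ.symm.trans ψ).source ×ˢ univ) := by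
  have h1 : ContDiffOn ℝ ∞ (ψ ∘ φ.symm) (φ.symm.trans ψ).source := by
    rw [← contMDiffOn_iff_contDiffOn]
    refine (contMDiffOn_of_mem_maximalAtlas hψ).comp
      ((contMDiffOn_symm_of_mem_maximalAtlas hφ).mono ?_) ?_
    · intro x hx; exact hx.1
    · intro x hx; exact hx.2
  have h2 := h1.fderiv_of_isOpen (m := ∞) (φ.symm.trans ψ).open_source (by simp)
  have h3 : ContDiff ℝ ∞ (fun x : JetCoord n m => graphMap x.2) := by
    have : (fun x : JetCoord n m => graphMap x.2) = fun x : JetCoord n m =>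
        ContinuousLinearMap.inl ℝ (Fin n → ℝ) (Fin m → ℝ) +
        (ContinuousLinearMap.inr ℝ (Fin n → ℝ) (Fin m → ℝ)).comp x.2 := by
      funext x; ext v <;> simp [graphMap]
    rw [this]
    exact contDiff_const.add (contDiff_const.clm_comp contDiff_snd)
  exact (h2.comp contDiff_fst.contDiffOn (fun x hx => hx.1)).clm_comp h3.contDiffOn

lemma contDiffOn_transHor {φ ψ : OpenPartialHomeomorph E (Coord n m)}
    (hφ : φ ∈ IsManifold.maximalAtlas 𝓘(ℝ, Coord n m) ∞ E)
    (hψ : ψ ∈ IsManifold.maximalAtlas 𝓘(ℝ, Coord n m) ∞ E) :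
    ContDiffOn ℝ ∞ (transHor φ ψ) ((φ.symm.trans ψ).source ×ˢ univ) :=
  contDiffOn_const.clm_comp (contDiffOn_transFrame hφ hψ)

lemma trans_source {φ ψ : OpenPartialHomeomorph E (Coord n m)}
    (hφ : φ ∈ IsManifold.maximalAtlas 𝓘(ℝ, Coord n m) ∞ E)
    (hψ : ψ ∈ IsManifold.maximalAtlas 𝓘(ℝ, Coord n m) ∞ E) :
    ((chartEquiv φ hφ).symm.trans (chartEquiv ψ hψ)).source =
      ((φ.symm.trans ψ).source ×ˢ univ) ∩
        transHor φ ψ ⁻¹' (range ((↑) : ((Fin n → ℝ) ≃L[ℝ] (Fin n → ℝ)) → _)) := by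
  ext x
  simp only [PartialEquiv.trans_source, PartialEquiv.symm_source, mem_inter_iff, mem_preimage,
    mem_prod, mem_univ, and_true, OpenPartialHomeomorph.trans_source,
    OpenPartialHomeomorph.symm_source]
  have hs : ∀ θ : Jet n m E, θ ∈ (chartEquiv ψ hψ).source ↔ θ ∈ domain ψ := fun _ => Iff.rfl
  have ht : x ∈ (chartEquiv φ hφ).target ↔ x.1 ∈ φ.target := by simp [chartEquiv]
  rw [hs, ht]
  have key : x.1 ∈ φ.target → (φ.symm x.1 ∈ ψ.source →
      ((chartEquiv φ hφ).symm x ∈ domain ψ ↔ (transHor φ ψ x).IsInvertible)) ∧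
      ((chartEquiv φ hφ).symm x).pt = φ.symm x.1 := by
    intro hx
    obtain ⟨h1, h2, h3⟩ := ofCoord_spec hφ hx
    refine ⟨fun hx' => ?_, h1⟩
    have := mem_domain_iff hφ hψ h2 (by rw [h1]; exact hx')
    rwa [show chartEquiv φ hφ (ofCoord φ x) = x from
      (chartEquiv φ hφ).right_inv ⟨hx, mem_univ _⟩] at this
  constructor
  · rintro ⟨hx, h⟩
    have hx' : φ.symm x.1 ∈ ψ.source := by rw [← (key hx).2]; exact h.1
    exact ⟨⟨hx, hx'⟩, ((key hx).1 hx').1 h⟩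
  · rintro ⟨⟨hx, hx'⟩, h⟩
    exact ⟨hx, ((key hx).1 hx').2 h⟩

lemma isOpen_trans_source {φ ψ : OpenPartialHomeomorph E (Coord n m)}
    (hφ : φ ∈ IsManifold.maximalAtlas 𝓘(ℝ, Coord n m) ∞ E)
    (hψ : ψ ∈ IsManifold.maximalAtlas 𝓘(ℝ, Coord n m) ∞ E) :
    IsOpen ((chartEquiv φ hφ).symm.trans (chartEquiv ψ hψ)).source := by
  rw [trans_source]
  exact (contDiffOn_transHor hφ hψ).continuousOn.isOpen_inter_preimage
    ((φ.symm.trans ψ).open_source.prod isOpen_univ) ContinuousLinearEquiv.isOpen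

lemma contDiffOn_trans {φ ψ : OpenPartialHomeomorph E (Coord n m)}
    (hφ : φ ∈ IsManifold.maximalAtlas 𝓘(ℝ, Coord n m) ∞ E)
    (hψ : ψ ∈ IsManifold.maximalAtlas 𝓘(ℝ, Coord n m) ∞ E) :
    ContDiffOn ℝ ∞ ((chartEquiv φ hφ).symm.trans (chartEquiv ψ hψ))
      ((chartEquiv φ hφ).symm.trans (chartEquiv ψ hψ)).source := by
  have hform : ∀ x ∈ ((chartEquiv φ hφ).symm.trans (chartEquiv ψ hψ)).source,
      (chartEquiv φ hφ).symm.trans (chartEquiv ψ hψ) x =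
        ((ψ ∘ φ.symm) x.1, (transVer φ ψ x).comp (transHor φ ψ x).inverse) := by
    intro x hx
    have hx1 : x.1 ∈ φ.target := hx.1.1
    obtain ⟨h1, h2, h3⟩ := ofCoord_spec hφ hx1
    have h4 := slope_trans hφ hψ h2 hx.2
    rw [show chartEquiv φ hφ (ofCoord φ x) = x from
      (chartEquiv φ hφ).right_inv ⟨hx1, mem_univ _⟩] at h4
    refine Prod.ext ?_ h4
    change ψ (ofCoord φ x).pt = ψ (φ.symm x.1)
    rw [h1]
  refine ContDiffOn.congr ?_ hform
  rw [trans_source]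
  have h1 : ContDiffOn ℝ ∞ (ψ ∘ φ.symm) (φ.symm.trans ψ).source := by
    rw [← contMDiffOn_iff_contDiffOn]
    refine (contMDiffOn_of_mem_maximalAtlas hψ).comp
      ((contMDiffOn_symm_of_mem_maximalAtlas hφ).mono ?_) ?_
    · intro x hx; exact hx.1
    · intro x hx; exact hx.2
  refine ContDiffOn.prodMk (h1.comp contDiff_fst.contDiffOn (fun x hx => hx.1.1)) ?_
  refine ContDiffOn.clm_comp ?_ ?_
  · exact contDiffOn_const.clm_comp ((contDiffOn_transFrame hφ hψ).mono inter_subset_left)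
  · intro x hx
    have hinv : (transHor φ ψ x).IsInvertible := hx.2
    exact (hinv.contDiffAt_map_inverse (n := ∞)).comp_contDiffWithinAt x
      (((contDiffOn_transHor hφ hψ) x hx.1).mono inter_subset_left)

variable [IsManifold 𝓘(ℝ, Coord n m) ∞ E]

/-- Every jet lies in the domain of the jet chart of some divided chart. -/
lemma exists_mem_domain (θ : Jet n m E) :
    ∃ φ ∈ IsManifold.maximalAtlas 𝓘(ℝ, Coord n m) ∞ E, θ ∈ domain φ := by
  set c := chartAt (Coord n m) θ.pt
  have hc : c ∈ IsManifold.maximalAtlas 𝓘(ℝ, Coord n m) ∞ E :=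
    IsManifold.chart_mem_maximalAtlas θ.pt
  have hcp : θ.pt ∈ c.source := mem_chart_source _ _
  have hinv := isInvertible_dChart hc hcp
  let W : Submodule ℝ (Coord n m) := θ.plane.map (dChart c θ.pt).toLinearMap
  have hW : Module.finrank ℝ W = n :=
    (Submodule.equivMapOfInjective (dChart c θ.pt).toLinearMap hinv.injective
      θ.plane).finrank_eq.symm.trans θ.finrank_plane
  obtain ⟨q, hq⟩ := W.exists_isCompl
  have hq' : Module.finrank ℝ q = m := by
    have := Submodule.finrank_add_eq_of_isCompl hq
    rw [hW] at this
    simpa using this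
  let eW : W ≃ₗ[ℝ] (Fin n → ℝ) := LinearEquiv.ofFinrankEq _ _ (by simpa using hW)
  let eq : q ≃ₗ[ℝ] (Fin m → ℝ) := LinearEquiv.ofFinrankEq _ _ (by simpa using hq')
  let L : Coord n m ≃L[ℝ] Coord n m :=
    ((Submodule.prodEquivOfIsCompl W q hq).symm.trans
      (eW.prodCongr eq)).toContinuousLinearEquiv
  have hL : ∀ w : W, (L w).1 = eW w := by
    intro w
    change ((eW.prodCongr eq) ((Submodule.prodEquivOfIsCompl W q hq).symm w)).1 = _
    rw [Submodule.prodEquivOfIsCompl_symm_apply_left]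
    rfl
  let φ : OpenPartialHomeomorph E (Coord n m) := c.transHomeomorph L.toHomeomorph
  have hφc : ∀ p, φ p = L (c p) := fun _ => rfl
  have hφ : φ ∈ IsManifold.maximalAtlas 𝓘(ℝ, Coord n m) ∞ E := by
    apply OpenPartialHomeomorph.mem_maximalAtlas_of_contMDiffOn
    · exact L.contDiff.contMDiff.comp_contMDiffOn (contMDiffOn_of_mem_maximalAtlas hc)
    · exact (contMDiffOn_symm_of_mem_maximalAtlas hc).comp
        L.symm.contDiff.contMDiff.contMDiffOn (fun x hx => hx)
  have hd : ∀ v, dChart φ θ.pt v = L (dChart c θ.pt v) := by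
    intro v
    have h1 : MDifferentiableAt 𝓘(ℝ, Coord n m) 𝓘(ℝ, Coord n m) c θ.pt :=
      (contMDiffAt_of_mem_maximalAtlas hc hcp).mdifferentiableAt (by simp)
    have h2 : HasMFDerivAt 𝓘(ℝ, Coord n m) 𝓘(ℝ, Coord n m) L (c θ.pt)
        (L : Coord n m →L[ℝ] Coord n m) := L.hasFDerivAt.hasMFDerivAt
    have := (h2.comp θ.pt h1.hasMFDerivAt).mfderiv
    exact congrArg (fun f => f v) this
  refine ⟨φ, hφ, hcp, (horMap_isInvertible_iff φ θ).2 ?_⟩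
  intro x y hxy
  have key : ∀ z : θ.plane, horMap φ θ z = eW ⟨dChart c θ.pt z, z, z.2, rfl⟩ := by
    intro z
    rw [← hL]
    exact congrArg Prod.fst (hd z)
  rw [key, key] at hxy
  have := congrArg Subtype.val (eW.injective hxy)
  exact Subtype.ext (hinv.injective this)

/-- The jet charts make the Grassmann bundle a charted space. -/
def chartedSpaceCore : ChartedSpaceCore (JetCoord n m) (Jet n m E) where
  atlas := {e | ∃ (φ : _) (hφ : φ ∈ IsManifold.maximalAtlas 𝓘(ℝ, Coord n m) ∞ E),
    e = chartEquiv φ hφ}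
  chartAt θ := chartEquiv (exists_mem_domain θ).choose (exists_mem_domain θ).choose_spec.1
  mem_chart_source θ := (exists_mem_domain θ).choose_spec.2
  chart_mem_atlas _ := ⟨_, _, rfl⟩
  open_source := by
    rintro _ _ ⟨φ, hφ, rfl⟩ ⟨ψ, hψ, rfl⟩
    exact isOpen_trans_source hφ hψ
  continuousOn_toFun := by
    rintro _ _ ⟨φ, hφ, rfl⟩ ⟨ψ, hψ, rfl⟩
    exact (contDiffOn_trans hφ hψ).continuousOn

instance : TopologicalSpace (Jet n m E) := chartedSpaceCore.toTopologicalSpace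

instance : ChartedSpace (JetCoord n m) (Jet n m E) := chartedSpaceCore.toChartedSpace

/-- The jet chart `(u^A, u^i_λ)` induced by a divided chart `(u^A)` of `E`. -/
def jetChart (φ : OpenPartialHomeomorph E (Coord n m))
    (hφ : φ ∈ IsManifold.maximalAtlas 𝓘(ℝ, Coord n m) ∞ E) :
    OpenPartialHomeomorph (Jet n m E) (JetCoord n m) :=
  chartedSpaceCore.openPartialHomeomorph (chartEquiv φ hφ) ⟨φ, hφ, rfl⟩

lemma jetChart_mem_atlas {φ : OpenPartialHomeomorph E (Coord n m)}
    (hφ : φ ∈ IsManifold.maximalAtlas 𝓘(ℝ, Coord n m) ∞ E) :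
    jetChart φ hφ ∈ atlas (JetCoord n m) (Jet n m E) :=
  mem_iUnion₂.2 ⟨chartEquiv φ hφ, ⟨φ, hφ, rfl⟩, rfl⟩

lemma exists_of_mem_atlas {e : OpenPartialHomeomorph (Jet n m E) (JetCoord n m)}
    (he : e ∈ atlas (JetCoord n m) (Jet n m E)) :
    ∃ (φ : _) (hφ : φ ∈ IsManifold.maximalAtlas 𝓘(ℝ, Coord n m) ∞ E), e = jetChart φ hφ := by
  obtain ⟨_, ⟨φ, hφ, rfl⟩, h⟩ := mem_iUnion₂.1 he
  exact ⟨φ, hφ, h⟩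

instance : IsManifold 𝓘(ℝ, JetCoord n m) ∞ (Jet n m E) := by
  apply isManifold_of_contDiffOn
  intro e e' he he'
  obtain ⟨φ, hφ, rfl⟩ := exists_of_mem_atlas he
  obtain ⟨ψ, hψ, rfl⟩ := exists_of_mem_atlas he'
  simp only [modelWithCornersSelf_coe, modelWithCornersSelf_coe_symm, Function.id_comp,
    Function.comp_id, preimage_id, range_id, inter_univ]
  exact contDiffOn_trans hφ hψ

lemma contMDiffOn_jetChart {φ : OpenPartialHomeomorph E (Coord n m)}
    (hφ : φ ∈ IsManifold.maximalAtlas 𝓘(ℝ, Coord n m) ∞ E) :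
    ContMDiffOn 𝓘(ℝ, JetCoord n m) 𝓘(ℝ, JetCoord n m) ∞ (jetChart φ hφ) (domain φ) :=
  contMDiffOn_of_mem_maximalAtlas (IsManifold.subset_maximalAtlas (jetChart_mem_atlas hφ))

lemma isOpen_domain {φ : OpenPartialHomeomorph E (Coord n m)}
    (hφ : φ ∈ IsManifold.maximalAtlas 𝓘(ℝ, Coord n m) ∞ E) :
    IsOpen (domain φ : Set (Jet n m E)) :=
  (jetChart φ hφ).open_source

lemma contMDiff_pt :
    ContMDiff 𝓘(ℝ, JetCoord n m) 𝓘(ℝ, Coord n m) ∞ (pt : Jet n m E → E) := by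
  intro θ
  obtain ⟨φ, hφ, hθ⟩ := exists_mem_domain θ
  have h1 : ContMDiffAt 𝓘(ℝ, JetCoord n m) 𝓘(ℝ, Coord n m) ∞
      (fun θ' : Jet n m E => φ.symm (jetChart φ hφ θ').1) θ := by
    have h2 := (contMDiffOn_jetChart hφ).contMDiffAt ((isOpen_domain hφ).mem_nhds hθ)
    have h3 : ContMDiffAt 𝓘(ℝ, Coord n m) 𝓘(ℝ, Coord n m) ∞ φ.symm (jetChart φ hφ θ).1 :=
      contMDiffAt_symm_of_mem_maximalAtlas hφ (φ.map_source hθ.1)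
    exact h3.comp θ (contDiff_fst.contMDiff.contMDiffAt.comp θ h2)
  refine h1.congr_of_eventuallyEq ?_
  filter_upwards [(isOpen_domain hφ).mem_nhds hθ] with θ' hθ'
  exact (φ.left_inv hθ'.1).symm

/-- The bundle projection `π₁₀ : J¹(E, n) → E`. -/
def proj : ContMDiffMap 𝓘(ℝ, JetCoord n m) 𝓘(ℝ, Coord n m) (Jet n m E) E ∞ :=
  ⟨pt, contMDiff_pt⟩

/-! ### The pseudo-horizontal bundle -/

variable (n m E) in
/-- The fibre at `θ` of the pseudo-horizontal bundle `H^{1,0}` is the plane `θ` itself. -/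
def Hor (θ : Jet n m E) : Type _ := θ.plane

instance (θ : Jet n m E) : AddCommGroup (Hor n m E θ) := inferInstanceAs (AddCommGroup θ.plane)
instance (θ : Jet n m E) : Module ℝ (Hor n m E θ) := inferInstanceAs (Module ℝ θ.plane)
instance (θ : Jet n m E) : TopologicalSpace (Hor n m E θ) :=
  inferInstanceAs (TopologicalSpace θ.plane)
instance (θ : Jet n m E) : IsTopologicalAddGroup (Hor n m E θ) :=
  inferInstanceAs (IsTopologicalAddGroup θ.plane)
instance (θ : Jet n m E) : ContinuousSMul ℝ (Hor n m E θ) :=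
  inferInstanceAs (ContinuousSMul ℝ θ.plane)

/-- The trivialisation of `H^{1,0}` by the forms `du^λ` of a divided chart. -/
def horTriv (φ : OpenPartialHomeomorph E (Coord n m))
    (hφ : φ ∈ IsManifold.maximalAtlas 𝓘(ℝ, Coord n m) ∞ E) :
    Pretrivialization (Fin n → ℝ) (Bundle.TotalSpace.proj :
      Bundle.TotalSpace (Fin n → ℝ) (Hor n m E) → Jet n m E) where
  toFun z := (z.1, horMap φ z.1 z.2)
  invFun y := ⟨y.1, (horMap φ y.1).inverse y.2⟩
  source := Bundle.TotalSpace.proj ⁻¹' domain φ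
  target := domain φ ×ˢ univ
  baseSet := domain φ
  map_source' z hz := ⟨hz, mem_univ _⟩
  map_target' y hy := hy.1
  left_inv' := by
    rintro ⟨θ, h⟩ hz
    have : (horMap φ θ).inverse (horMap φ θ h) = h := hz.2.inverse_apply_self h
    exact congrArg (Bundle.TotalSpace.mk θ) this
  right_inv' := by
    rintro ⟨θ, v⟩ hy
    exact Prod.ext rfl (hy.1.2.self_apply_inverse v)
  open_target := (isOpen_domain hφ).prod isOpen_univ
  open_baseSet := isOpen_domain hφ
  source_eq := rfl
  target_eq := rfl
  proj_toFun _ _ := rfl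

lemma horTriv_change {φ ψ : OpenPartialHomeomorph E (Coord n m)}
    (hφ : φ ∈ IsManifold.maximalAtlas 𝓘(ℝ, Coord n m) ∞ E)
    (hψ : ψ ∈ IsManifold.maximalAtlas 𝓘(ℝ, Coord n m) ∞ E) {θ : Jet n m E}
    (hθ : θ ∈ domain φ ∩ domain ψ) (v : Fin n → ℝ) :
    transHor φ ψ (jetChart φ hφ θ) v = (horTriv ψ hψ ⟨θ, (horTriv φ hφ).symm θ v⟩).2 := by
  have h1 : (horTriv φ hφ).symm θ v = (horMap φ θ).inverse v :=
    (horTriv φ hφ).symm_apply hθ.1 v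
  rw [h1]
  change _ = horMap ψ θ ((horMap φ θ).inverse v)
  rw [horMap_trans_apply hφ hψ hθ.1 hθ.2.1, hθ.1.2.self_apply_inverse]
  rfl

lemma contMDiffOn_horTriv_change {φ ψ : OpenPartialHomeomorph E (Coord n m)}
    (hφ : φ ∈ IsManifold.maximalAtlas 𝓘(ℝ, Coord n m) ∞ E)
    (hψ : ψ ∈ IsManifold.maximalAtlas 𝓘(ℝ, Coord n m) ∞ E) :
    ContMDiffOn 𝓘(ℝ, JetCoord n m) 𝓘(ℝ, (Fin n → ℝ) →L[ℝ] (Fin n → ℝ)) ∞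
      (fun θ : Jet n m E => transHor φ ψ (jetChart φ hφ θ)) (domain φ ∩ domain ψ) := by
  refine (contDiffOn_transHor hφ hψ).contMDiffOn.comp
    ((contMDiffOn_jetChart hφ).mono inter_subset_left) ?_
  intro θ hθ
  refine ⟨⟨φ.map_source hθ.1.1, ?_⟩, mem_univ _⟩
  change φ.symm (φ θ.pt) ∈ ψ.source
  rw [φ.left_inv hθ.1.1]
  exact hθ.2.1

variable (n m E) in
/-- The trivialisations of `H^{1,0}` by divided charts make it a smooth vector bundle. -/
def horPrebundle : VectorPrebundle ℝ (Fin n → ℝ) (Hor n m E) where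
  pretrivializationAtlas := {e | ∃ (φ : _)
    (hφ : φ ∈ IsManifold.maximalAtlas 𝓘(ℝ, Coord n m) ∞ E), e = horTriv φ hφ}
  pretrivialization_linear' := by
    rintro _ ⟨φ, hφ, rfl⟩
    exact ⟨fun θ _ => ⟨fun x y => map_add (horMap φ θ) x y, fun c x => map_smul (horMap φ θ) c x⟩⟩
  pretrivializationAt θ :=
    horTriv (exists_mem_domain θ).choose (exists_mem_domain θ).choose_spec.1
  mem_base_pretrivializationAt θ := (exists_mem_domain θ).choose_spec.2
  pretrivialization_mem_atlas _ := ⟨_, _, rfl⟩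
  exists_coordChange := by
    rintro _ ⟨φ, hφ, rfl⟩ _ ⟨ψ, hψ, rfl⟩
    exact ⟨fun θ => transHor φ ψ (jetChart φ hφ θ), (contMDiffOn_horTriv_change hφ hψ).continuousOn,
      fun θ hθ v => horTriv_change hφ hψ hθ v⟩
  totalSpaceMk_isInducing θ := by
    have h := (exists_mem_domain θ).choose_spec.2
    obtain ⟨e, he⟩ := h.2
    have h1 : Topology.IsInducing (fun h : θ.plane =>
        horMap (exists_mem_domain θ).choose θ h) := by
      rw [← he]
      exact e.toHomeomorph.isInducing
    exact (Topology.isInducing_const_prod (x := θ)).2 h1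

instance : TopologicalSpace (Bundle.TotalSpace (Fin n → ℝ) (Hor n m E)) :=
  (horPrebundle n m E).totalSpaceTopology

instance : FiberBundle (Fin n → ℝ) (Hor n m E) := (horPrebundle n m E).toFiberBundle

instance : VectorBundle ℝ (Fin n → ℝ) (Hor n m E) := (horPrebundle n m E).toVectorBundle

instance : (horPrebundle n m E).IsContMDiff 𝓘(ℝ, JetCoord n m) ∞ where
  exists_contMDiffCoordChange := by
    rintro _ ⟨φ, hφ, rfl⟩ _ ⟨ψ, hψ, rfl⟩
    exact ⟨fun θ => transHor φ ψ (jetChart φ hφ θ), contMDiffOn_horTriv_change hφ hψ,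
      fun θ hθ v => horTriv_change hφ hψ hθ v⟩

instance : ContMDiffVectorBundle ∞ (Fin n → ℝ) (Hor n m E) 𝓘(ℝ, JetCoord n m) :=
  (horPrebundle n m E).contMDiffVectorBundle 𝓘(ℝ, JetCoord n m)

end Jet

set_option linter.unusedSectionVars false

/-! ### Linear connections: pull-back and tensor product -/

section Connections

variable {EB : Type*} [NormedAddCommGroup EB] [NormedSpace ℝ EB]
  {HB : Type*} [TopologicalSpace HB] {I : ModelWithCorners ℝ EB HB}
  {B : Type*} [TopologicalSpace B] [ChartedSpace HB B]
  {F : Type*} [NormedAddCommGroup F] [NormedSpace ℝ F]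
  {V : B → Type*} [TopologicalSpace (TotalSpace F V)]
  [∀ x, AddCommGroup (V x)] [∀ x, Module ℝ (V x)] [∀ x, TopologicalSpace (V x)]
  [∀ x, IsTopologicalAddGroup (V x)] [∀ x, ContinuousSMul ℝ (V x)]
  [FiberBundle F V] [VectorBundle ℝ F V]

variable (I F) in
/-- The derivative at `x` of a section, read in the preferred trivialisation of the bundle
at `x`. -/
def flatDeriv (s : Π x, V x) (x : B) : TangentSpace I x →L[ℝ] V x :=
  ((trivializationAt F V x).symmL ℝ x).comp
    (mvfderiv I (fun y => (trivializationAt F V x ⟨y, s y⟩).2) x)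

lemma mvfderiv_congr {f g : B → F} {x : B} (h : f =ᶠ[𝓝 x] g) :
    mvfderiv I f x = mvfderiv I g x := by
  ext v
  simp only [mvfderiv, ContinuousLinearMap.comp_apply]
  rw [h.mfderiv_eq]
  rfl

lemma flatDeriv_add {s t : Π x, V x} {x : B}
    (hs : MDifferentiableAt I (I.prod 𝓘(ℝ, F)) (fun y => TotalSpace.mk' F y (s y)) x)
    (ht : MDifferentiableAt I (I.prod 𝓘(ℝ, F)) (fun y => TotalSpace.mk' F y (t y)) x) :
    flatDeriv I F (s + t) x = flatDeriv I F s x + flatDeriv I F t x := by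
  rw [mdifferentiableAt_section] at hs ht
  have h : (fun y => (trivializationAt F V x ⟨y, (s + t) y⟩).2) =ᶠ[𝓝 x]
      (fun y => (trivializationAt F V x ⟨y, s y⟩).2) +
        fun y => (trivializationAt F V x ⟨y, t y⟩).2 := by
    filter_upwards [(trivializationAt F V x).open_baseSet.mem_nhds
      (FiberBundle.mem_baseSet_trivializationAt' x)] with y hy
    exact ((trivializationAt F V x).linear ℝ hy).map_add _ _
  simp only [flatDeriv, mvfderiv_congr h, mvfderiv_add hs ht, ContinuousLinearMap.comp_add]

lemma flatDeriv_smul {g : B → ℝ} {s : Π x, V x} {x : B}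
    (hs : MDifferentiableAt I (I.prod 𝓘(ℝ, F)) (fun y => TotalSpace.mk' F y (s y)) x)
    (hg : MDifferentiableAt I 𝓘(ℝ, ℝ) g x) :
    flatDeriv I F (g • s) x = g x • flatDeriv I F s x + (mvfderiv I g x).smulRight (s x) := by
  rw [mdifferentiableAt_section] at hs
  have hx := FiberBundle.mem_baseSet_trivializationAt' (F := F) (E := V) x
  have h : (fun y => (trivializationAt F V x ⟨y, (g • s) y⟩).2) =ᶠ[𝓝 x]
      g • (fun y => (trivializationAt F V x ⟨y, s y⟩).2) := by
    filter_upwards [(trivializationAt F V x).open_baseSet.mem_nhds hx] with y hy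
    exact ((trivializationAt F V x).linear ℝ hy).map_smul _ _
  have h3 : (trivializationAt F V x).symmL ℝ x ((trivializationAt F V x) ⟨x, s x⟩).2 = s x := by
    rw [Trivialization.symmL_apply _ hx]
    exact (trivializationAt F V x).symm_apply_apply_mk hx _
  ext v
  simp only [flatDeriv, mvfderiv_congr h, mvfderiv_smul hg hs, ContinuousLinearMap.comp_apply,
    _root_.add_apply, _root_.smul_apply, map_add, map_smul,
    ContinuousLinearMap.smulRight_apply, h3]

lemma extend_add {x : B} (v w : V x) : ∀ᶠ y in 𝓝 x,
    FiberBundle.extend F (v + w) y = (FiberBundle.extend F v + FiberBundle.extend F w) y := by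
  have hx := FiberBundle.mem_baseSet_trivializationAt' (F := F) (E := V) x
  filter_upwards [(trivializationAt F V x).open_baseSet.mem_nhds hx] with y hy
  simp only [Pi.add_apply, FiberBundle.extend]
  rw [← Trivialization.symmL_apply (R := ℝ) _ hy, ← Trivialization.symmL_apply (R := ℝ) _ hy,
    ← Trivialization.symmL_apply (R := ℝ) _ hy, ← map_add]
  congr 1
  exact ((trivializationAt F V x).linear ℝ hx).map_add _ _

lemma extend_smul {x : B} (c : ℝ) (v : V x) : ∀ᶠ y in 𝓝 x,
    FiberBundle.extend F (c • v) y = (c • FiberBundle.extend F v) y := by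
  have hx := FiberBundle.mem_baseSet_trivializationAt' (F := F) (E := V) x
  filter_upwards [(trivializationAt F V x).open_baseSet.mem_nhds hx] with y hy
  simp only [Pi.smul_apply, FiberBundle.extend]
  rw [← Trivialization.symmL_apply (R := ℝ) _ hy, ← Trivialization.symmL_apply (R := ℝ) _ hy,
    ← map_smul]
  congr 1
  exact ((trivializationAt F V x).linear ℝ hx).map_smul _ _

lemma CovariantDerivative.extend_add [ContMDiffVectorBundle 1 F V I]
    (cov : CovariantDerivative I F V) {x : B} (v w : V x) :
    cov (FiberBundle.extend F (v + w)) x =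
      cov (FiberBundle.extend F v) x + cov (FiberBundle.extend F w) x := by
  rw [← cov.isCovariantDerivativeOnUniv.add (FiberBundle.mdifferentiableAt_extend ..)
    (FiberBundle.mdifferentiableAt_extend ..)]
  exact cov.isCovariantDerivativeOnUniv.congr_of_eventuallyEq (FiberBundle.mdifferentiableAt_extend ..)
    (mdifferentiableAt_add_section (FiberBundle.mdifferentiableAt_extend ..) (FiberBundle.mdifferentiableAt_extend ..))
    Filter.univ_mem (_root_.extend_add v w)

lemma CovariantDerivative.extend_smul [ContMDiffVectorBundle 1 F V I]
    (cov : CovariantDerivative I F V) {x : B} (c : ℝ) (v : V x) :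
    cov (FiberBundle.extend F (c • v)) x = c • cov (FiberBundle.extend F v) x := by
  rw [← cov.isCovariantDerivativeOnUniv.smul_const _ (FiberBundle.mdifferentiableAt_extend ..)]
  exact cov.isCovariantDerivativeOnUniv.congr_of_eventuallyEq (FiberBundle.mdifferentiableAt_extend ..)
    (mdifferentiableAt_const.smul_section (FiberBundle.mdifferentiableAt_extend ..))
    Filter.univ_mem (_root_.extend_smul c v)

variable {EP : Type*} [NormedAddCommGroup EP] [NormedSpace ℝ EP]
  {HP : Type*} [TopologicalSpace HP] {IP : ModelWithCorners ℝ EP HP}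
  {P : Type*} [TopologicalSpace P] [ChartedSpace HP P]


instance (f : P → B) (y : P) : AddCommGroup ((f *ᵖ V) y) := inferInstanceAs (AddCommGroup (V (f y)))

instance (f : P → B) (y : P) : IsTopologicalAddGroup ((f *ᵖ V) y) :=
  inferInstanceAs (IsTopologicalAddGroup (V (f y)))

instance (f : P → B) (y : P) : ContinuousSMul ℝ ((f *ᵖ V) y) :=
  inferInstanceAs (ContinuousSMul ℝ (V (f y)))

/-- The part `∇_{Tf X} e_a` of a pull-back connection, as a linear map in `X`: the vector `v` of the
fibre at `f y` is extended to a section that is constant in the preferred trivialisation. -/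
def pullbackTerm (cov : CovariantDerivative I F V) (f : P → B) (y : P) (v : (f *ᵖ V) y) :
    TangentSpace IP y →L[ℝ] (f *ᵖ V) y :=
  (cov (FiberBundle.extend F (E := V) (x := f y) v) (f y)).comp (mfderiv IP I f y)

/-- The pull-back `f^*(∇)` of a linear connection. In a local frame `(e_a)` of `V`, a section of the
pull-back bundle is `s = s^a (e_a ∘ f)`, and `∇_X s = X(s^a) (e_a ∘ f) + s^a ∇_{Tf X} e_a`. The
formula is written here in the frame given by the preferred trivialisation at the point. -/
def CovariantDerivative.pullback [ContMDiffVectorBundle 1 F V I]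
    (cov : CovariantDerivative I F V) {k : ℕ∞ω} (f : ContMDiffMap IP I P B k) :
    CovariantDerivative IP F ((f : P → B) *ᵖ V) where
  toFun s y := flatDeriv IP F s y + pullbackTerm cov f y (s y)
  isCovariantDerivativeOnUniv := by
    constructor
    · intro s t y hs ht _
      have h : pullbackTerm (IP := IP) cov f y ((s + t) y) =
          pullbackTerm cov f y (s y) + pullbackTerm cov f y (t y) := by
        refine (congrArg (fun A => ContinuousLinearMap.comp A (mfderiv IP I f y))
          (cov.extend_add (x := f y) (s y) (t y))).trans ?_
        rw [ContinuousLinearMap.add_comp]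
        rfl
      rw [flatDeriv_add hs ht, h]
      abel
    · intro s g y hs hg _
      have h : pullbackTerm (IP := IP) cov f y ((g • s) y) =
          g y • pullbackTerm cov f y (s y) := by
        refine (congrArg (fun A => ContinuousLinearMap.comp A (mfderiv IP I f y))
          (cov.extend_smul (x := f y) (g y) (s y))).trans ?_
        rw [ContinuousLinearMap.smul_comp]
        rfl
      rw [flatDeriv_smul hs hg, h, smul_add]
      abel

end Connections

section Tensor

variable {EB : Type*} [NormedAddCommGroup EB] [NormedSpace ℝ EB] [FiniteDimensional ℝ EB]
  {HB : Type*} [TopologicalSpace HB] {I : ModelWithCorners ℝ EB HB}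
  {B : Type*} [TopologicalSpace B] [ChartedSpace HB B]
  {n : ℕ} {V : B → Type*} [TopologicalSpace (TotalSpace (Fin n → ℝ) V)]
  [∀ x, AddCommGroup (V x)] [∀ x, Module ℝ (V x)] [∀ x, TopologicalSpace (V x)]
  [∀ x, IsTopologicalAddGroup (V x)] [∀ x, ContinuousSMul ℝ (V x)]
  [FiberBundle (Fin n → ℝ) V] [VectorBundle ℝ (Fin n → ℝ) V]
  {F : Type*} [NormedAddCommGroup F] [NormedSpace ℝ F]
  {W : B → Type*} [TopologicalSpace (TotalSpace F W)]
  [∀ x, AddCommGroup (W x)] [∀ x, Module ℝ (W x)] [∀ x, TopologicalSpace (W x)]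
  [∀ x, IsTopologicalAddGroup (W x)] [∀ x, ContinuousSMul ℝ (W x)]
  [FiberBundle F W] [VectorBundle ℝ F W]

variable (V) in
/-- The fibres of the dual bundle `V*`. -/
abbrev DualFib (x : B) : Type _ := V x →L[ℝ] Bundle.Trivial B ℝ x

/-- The `i`-th section of the local frame of `V` given by the preferred trivialisation at `x`. -/
def frame (V : B → Type*) [TopologicalSpace (TotalSpace (Fin n → ℝ) V)]
    [∀ x, AddCommGroup (V x)] [∀ x, Module ℝ (V x)] [∀ x, TopologicalSpace (V x)]
    [FiberBundle (Fin n → ℝ) V] [VectorBundle ℝ (Fin n → ℝ) V] (x : B) (i : Fin n) (y : B) : V y :=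
  (trivializationAt (Fin n → ℝ) V x).symmL ℝ y (Pi.single i 1)

/-- The `i`-th section of the dual local frame of `V*`. -/
def coframe (V : B → Type*) [TopologicalSpace (TotalSpace (Fin n → ℝ) V)]
    [∀ x, AddCommGroup (V x)] [∀ x, Module ℝ (V x)] [∀ x, TopologicalSpace (V x)]
    [FiberBundle (Fin n → ℝ) V] [VectorBundle ℝ (Fin n → ℝ) V] (x : B) (i : Fin n) (y : B) :
    DualFib V y :=
  (ContinuousLinearMap.proj i).comp ((trivializationAt (Fin n → ℝ) V x).continuousLinearMapAt ℝ y)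

variable (V W) in
/-- The element `α ⊗ w` of `V* ⊗ W`, seen as the linear map `h ↦ α(h) w`. -/
def dyad {x : B} (α : DualFib V x) (w : W x) : V x →L[ℝ] W x :=
  ContinuousLinearMap.smulRight (M₁ := V x) (S := ℝ) α w

lemma frame_mdiff [ContMDiffVectorBundle 1 (Fin n → ℝ) V I] (x : B) (i : Fin n) :
    MDifferentiableAt I (I.prod 𝓘(ℝ, Fin n → ℝ))
      (fun y => TotalSpace.mk' (Fin n → ℝ) y (frame V x i y)) x := by
  have hx := FiberBundle.mem_baseSet_trivializationAt' (F := Fin n → ℝ) (E := V) x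
  rw [mdifferentiableAt_section]
  have : (fun y => (trivializationAt (Fin n → ℝ) V x ⟨y, frame V x i y⟩).2) =ᶠ[𝓝 x]
      fun _ => Pi.single i 1 := by
    filter_upwards [(trivializationAt (Fin n → ℝ) V x).open_baseSet.mem_nhds hx] with y hy
    rw [frame, Trivialization.symmL_apply _ hy, Trivialization.apply_mk_symm _ hy]
  exact mdifferentiableAt_const.congr_of_eventuallyEq this

lemma sum_dyad_frame (x : B) (A : V x →L[ℝ] W x) :
    ∑ i : Fin n, dyad V W (coframe V x i x) (A (frame V x i x)) = A := by
  have hx := FiberBundle.mem_baseSet_trivializationAt' (F := Fin n → ℝ) (E := V) x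
  ext h
  have key : h = ∑ i : Fin n, (trivializationAt (Fin n → ℝ) V x).continuousLinearMapAt ℝ x h i •
      frame V x i x := by
    simp only [frame, ← map_smul, ← map_sum]
    conv_lhs => rw [← (trivializationAt (Fin n → ℝ) V x).symmL_continuousLinearMapAt (R := ℝ) hx h]
    congr 1
    exact pi_eq_sum_univ' _
  conv_rhs => rw [key, map_sum]
  simp only [map_smul]
  simp [dyad, coframe]

/-- The tensor product `∇₁ ⊗ ∇₂` of linear connections on `V*` and `W`, as a connection on
`V* ⊗ W = Hom(V, W)`. If `(e_i)` is a local frame of `V` with dual frame `(e^i)`, then a section `Φ`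
of `Hom(V, W)` is `Σ e^i ⊗ Φ(e_i)`, and `∇_X Φ = Σ (∇₁_X e^i ⊗ Φ(e_i) + e^i ⊗ ∇₂_X (Φ(e_i)))`. The
formula is written here in the frame given by the preferred trivialisation at the point. -/
def CovariantDerivative.tensor [ContMDiffVectorBundle 1 (Fin n → ℝ) V I]
    [ContMDiffVectorBundle 1 F W I]
    (cov₁ : CovariantDerivative I ((Fin n → ℝ) →L[ℝ] ℝ) (DualFib V))
    (cov₂ : CovariantDerivative I F W) :
    CovariantDerivative I ((Fin n → ℝ) →L[ℝ] F) (fun x => V x →L[ℝ] W x) where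
  toFun Φ x :=
    letI : FiniteDimensional ℝ (TangentSpace I x) := inferInstanceAs (FiniteDimensional ℝ EB)
    letI : T2Space (TangentSpace I x) := inferInstanceAs (T2Space EB)
    LinearMap.toContinuousLinearMap
      { toFun X := ∑ i : Fin n, (dyad V W (cov₁ (coframe V x i) x X) (Φ x (frame V x i x)) +
          dyad V W (coframe V x i x) (cov₂ (fun y => Φ y (frame V x i y)) x X))
        map_add' X Y := by
          rw [← Finset.sum_add_distrib]
          refine Finset.sum_congr rfl fun i _ => ?_
          ext h
          simp [dyad]
          module
        map_smul' c X := by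
          rw [RingHom.id_apply, Finset.smul_sum]
          refine Finset.sum_congr rfl fun i _ => ?_
          ext h
          simp [dyad]
          module }
  isCovariantDerivativeOnUniv := by
    have hm : ∀ {Φ : Π x, V x →L[ℝ] W x} {x : B}, MDifferentiableAt I
        (I.prod 𝓘(ℝ, (Fin n → ℝ) →L[ℝ] F))
        (fun y => TotalSpace.mk' ((Fin n → ℝ) →L[ℝ] F)
          (E := fun x => V x →L[ℝ] W x) y (Φ y)) x → ∀ i : Fin n,
        MDifferentiableAt I (I.prod 𝓘(ℝ, F))
          (fun y => TotalSpace.mk' F y (Φ y (frame V x i y))) x :=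
      fun hΦ i => MDifferentiableAt.clm_bundle_apply hΦ (frame_mdiff _ i)
    constructor
    · intro Φ Ψ x hΦ hΨ _
      ext X : 1
      simp only [LinearMap.coe_toContinuousLinearMap', LinearMap.coe_mk, AddHom.coe_mk,
        _root_.add_apply]
      rw [← Finset.sum_add_distrib]
      refine Finset.sum_congr rfl fun i _ => ?_
      have h : cov₂ (fun y => (Φ + Ψ) y (frame V x i y)) x =
          cov₂ (fun y => Φ y (frame V x i y)) x + cov₂ (fun y => Ψ y (frame V x i y)) x :=
        cov₂.isCovariantDerivativeOnUniv.add (hm hΦ i) (hm hΨ i)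
      rw [h]
      ext v
      simp [dyad]
      module
    · intro Φ g x hΦ hg _
      ext X : 1
      simp only [LinearMap.coe_toContinuousLinearMap', LinearMap.coe_mk, AddHom.coe_mk,
        _root_.add_apply, _root_.smul_apply, ContinuousLinearMap.smulRight_apply]
      have h : ∀ i : Fin n, cov₂ (fun y => (g • Φ) y (frame V x i y)) x =
          g x • cov₂ (fun y => Φ y (frame V x i y)) x +
            (mvfderiv I g x).smulRight (Φ x (frame V x i x)) :=
        fun i => cov₂.isCovariantDerivativeOnUniv.leibniz (hm hΦ i) hg
      have e : (mvfderiv I g x X) • Φ x = ∑ i : Fin n, (mvfderiv I g x X) •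
          dyad V W (coframe V x i x) (Φ x (frame V x i x)) := by
        rw [← Finset.smul_sum, sum_dyad_frame]
      rw [e, Finset.smul_sum, ← Finset.sum_add_distrib]
      refine Finset.sum_congr rfl fun i _ => ?_
      rw [h]
      ext v
      simp [dyad]
      module

end Tensor

/-! ### Connections on a bundle -/

section Ehresmann

variable {EP : Type*} [NormedAddCommGroup EP] [NormedSpace ℝ EP]
  {HP : Type*} [TopologicalSpace HP] (IP : ModelWithCorners ℝ EP HP)
  {P : Type*} [TopologicalSpace P] [ChartedSpace HP P] [IsManifold IP ∞ P]
  {EN : Type*} [NormedAddCommGroup EN] [NormedSpace ℝ EN]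
  {HN : Type*} [TopologicalSpace HN] (IN : ModelWithCorners ℝ EN HN)
  {N : Type*} [TopologicalSpace N] [ChartedSpace HN N]

/-- A (non-linear) connection on a bundle `ρ : P → N`, given by its vertical valued form
`υ : P → T*P ⊗ VP`, a smooth projection of `TP` onto the vertical bundle `VP = ker Tρ`. -/
structure BundleConnection (ρ : P → N) where
  vert : Π y : P, TangentSpace IP y →L[ℝ] TangentSpace IP y
  vert_isVertical : ∀ y v, mfderiv IP IN ρ y (vert y v) = 0
  vert_of_isVertical : ∀ y v, mfderiv IP IN ρ y v = 0 → vert y v = v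
  contMDiff_vert : ContMDiff IP (IP.prod 𝓘(ℝ, EP →L[ℝ] EP)) ∞
    (fun y => TotalSpace.mk' (EP →L[ℝ] EP)
      (E := fun y => TangentSpace IP y →L[ℝ] TangentSpace IP y) y (vert y))

end Ehresmann

namespace Jet

variable {n m : ℕ} {E : Type*} [TopologicalSpace E] [ChartedSpace (Coord n m) E]
  [IsManifold 𝓘(ℝ, Coord n m) ∞ E]

/-- Linear connections on the tangent bundle of `E`. -/
abbrev TangentConnection (n m : ℕ) (E : Type*) [TopologicalSpace E]
    [ChartedSpace (Coord n m) E] [IsManifold 𝓘(ℝ, Coord n m) ∞ E] :=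
  CovariantDerivative 𝓘(ℝ, Coord n m) (Coord n m)
    (TangentSpace 𝓘(ℝ, Coord n m) : E → Type _)

/-- Linear connections on the dual `H^{1,0*}` of the pseudo-horizontal bundle. -/
abbrev HorDualConnection (n m : ℕ) (E : Type*) [TopologicalSpace E]
    [ChartedSpace (Coord n m) E] [IsManifold 𝓘(ℝ, Coord n m) ∞ E] :=
  CovariantDerivative 𝓘(ℝ, JetCoord n m) ((Fin n → ℝ) →L[ℝ] ℝ) (DualFib (Hor n m E))

/-- Connections on the bundle `π₁₀ : J¹(E, n) → E`. -/
abbrev JetConnection (n m : ℕ) (E : Type*) [TopologicalSpace E]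
    [ChartedSpace (Coord n m) E] [IsManifold 𝓘(ℝ, Coord n m) ∞ E] :=
  BundleConnection 𝓘(ℝ, JetCoord n m) 𝓘(ℝ, Coord n m) (pt : Jet n m E → E)

/-- The fibre at `θ` of the bundle `T^{1,0} = π₁₀^*(TE)`. -/
abbrev Tan (θ : Jet n m E) : Type _ :=
  ((proj : Jet n m E → E) *ᵖ (TangentSpace 𝓘(ℝ, Coord n m) : E → Type _)) θ

/-- The inclusion `D¹` of `H^{1,0}` in `T^{1,0}`, as a section of `H^{1,0*} ⊗ T^{1,0}`. -/
def D1 (θ : Jet n m E) : Hor n m E θ →L[ℝ] Tan θ := θ.plane.subtypeL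

/-- The fibre at `θ` of the bundle `V^{1,0} = T^{1,0} / H^{1,0}`. -/
abbrev Ver (θ : Jet n m E) : Type _ := TangentSpace 𝓘(ℝ, Coord n m) θ.pt ⧸ θ.plane

/-- The quotient projection `ω¹ : T^{1,0} → V^{1,0}`. -/
def omega1 (θ : Jet n m E) : Tan θ →L[ℝ] Ver θ := θ.plane.mkQL

/-- The isomorphism `ker Tπ₁₀ ≃ H^{1,0*} ⊗ V^{1,0}`, `v ↦ d/dt D¹(γ(t))` at `t = 0`, where `γ` is a
curve in the fibre with velocity `v`. The derivative is taken in the preferred trivialisation of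
`H^{1,0*} ⊗ T^{1,0}`; for vertical `v`, its class modulo `H^{1,0}` does not depend on the
trivialisation. -/
def verticalIso (θ : Jet n m E) (v : TangentSpace 𝓘(ℝ, JetCoord n m) θ) :
    Hor n m E θ →L[ℝ] Ver θ :=
  (omega1 θ).comp (flatDeriv 𝓘(ℝ, JetCoord n m) ((Fin n → ℝ) →L[ℝ] Coord n m)
    (V := fun θ => Hor n m E θ →L[ℝ] Tan θ) D1 θ v)

/-- The composition `(id ⊗ ω¹) ∘ υ_Ω ∘ TD¹ : TJ¹(E, n) → H^{1,0*} ⊗ V^{1,0}`, where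
`Ω = Ξ ⊗ π₁₀^*(Γ)`; note that `υ_Ω ∘ TD¹ ∘ X = ∇[Ω]_X D¹`. -/
def inducedForm (Γ : TangentConnection n m E) (Ξ : HorDualConnection n m E) (θ : Jet n m E)
    (X : TangentSpace 𝓘(ℝ, JetCoord n m) θ) : Hor n m E θ →L[ℝ] Ver θ :=
  (omega1 θ).comp ((Ξ.tensor (Γ.pullback proj)) D1 θ X)

/-- `υ_Δ`, read in `H^{1,0*} ⊗ V^{1,0}`, is the form obtained from `Γ` and `Ξ`. -/
def IsInduced (Γ : TangentConnection n m E) (Ξ : HorDualConnection n m E)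
    (Δ : JetConnection n m E) : Prop :=
  ∀ θ X, verticalIso θ (Δ.vert θ X) = inducedForm Γ Ξ θ X

/-- The vector `∂/∂u^A` of `ℝⁿ × ℝᵐ`; Greek indices are in `Fin n`, Latin ones in `Fin m`. -/
def basisVec (A : Fin n ⊕ Fin m) : Coord n m :=
  Sum.elim (fun ξ => (Pi.single ξ 1, 0)) (fun i => (0, Pi.single i 1)) A

/-- The component `u^A` of a vector of `ℝⁿ × ℝᵐ`. -/
def component (A : Fin n ⊕ Fin m) (x : Coord n m) : ℝ := Sum.elim x.1 x.2 A

/-- The coordinate vector field `∂/∂u^A` on `E`, in the domain of a chart. -/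
def coordField (φ : OpenPartialHomeomorph E (Coord n m)) (A : Fin n ⊕ Fin m) (p : E) :
    TangentSpace 𝓘(ℝ, Coord n m) p :=
  (dChart φ p).inverse (basisVec A)

/-- The Christoffel symbols of a linear connection on `TE`: `Γ_A^C_B = du^C(∇_{∂_A} ∂_B)`. -/
def christoffel (Γ : TangentConnection n m E) (φ : OpenPartialHomeomorph E (Coord n m))
    (A C B : Fin n ⊕ Fin m) (p : E) : ℝ :=
  component C (dChart φ p (Γ (coordField φ B) p (coordField φ A p)))

/-- The coordinate `u^i_ξ` on `J¹(E, n)`. -/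
def uCoord (φ : OpenPartialHomeomorph E (Coord n m)) (i : Fin m) (ξ : Fin n) (θ : Jet n m E) : ℝ :=
  slope φ θ (Pi.single ξ 1) i

/-- The Christoffel symbols of a connection on `π₁₀`: `Γ_A^k_ξ = du^k_ξ(υ(∂/∂u^A))`, that is
`υ = (du^k_ξ + Γ_A^k_ξ du^A) ⊗ ∂/∂u^k_ξ`. -/
def jetChristoffel (Δ : JetConnection n m E) (φ : OpenPartialHomeomorph E (Coord n m))
    (hφ : φ ∈ IsManifold.maximalAtlas 𝓘(ℝ, Coord n m) ∞ E)
    (A : Fin n ⊕ Fin m) (k : Fin m) (ξ : Fin n) (θ : Jet n m E) : ℝ :=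
  letI d : TangentSpace 𝓘(ℝ, JetCoord n m) θ →L[ℝ] JetCoord n m :=
    mfderiv 𝓘(ℝ, JetCoord n m) 𝓘(ℝ, JetCoord n m) (jetChart φ hφ) θ
  (d (Δ.vert θ (d.inverse (basisVec A, 0)))).2 (Pi.single ξ 1) k

variable {E' : Type*} [TopologicalSpace E'] [ChartedSpace (Coord n m) E']

/-- The prolongation `J¹f` of a local diffeomorphism `f`. -/
def map {f : E → E'} (hf : IsLocalDiffeomorph 𝓘(ℝ, Coord n m) 𝓘(ℝ, Coord n m) ∞ f)
    (θ : Jet n m E) : Jet n m E' where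
  pt := f θ.pt
  plane := θ.plane.map (mfderiv 𝓘(ℝ, Coord n m) 𝓘(ℝ, Coord n m) f θ.pt).toLinearMap
  finrank_plane := (Submodule.equivMapOfInjective
    (mfderiv 𝓘(ℝ, Coord n m) 𝓘(ℝ, Coord n m) f θ.pt).toLinearMap
    ((hf θ.pt).mfderivToContinuousLinearEquiv (by simp)).injective
    θ.plane).finrank_eq.symm.trans θ.finrank_plane

/-- The local diffeomorphism `f` carries `Γ` to `Γ'`. -/
def Carries [IsManifold 𝓘(ℝ, Coord n m) ∞ E'] (f : E → E') (Γ : TangentConnection n m E)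
    (Γ' : TangentConnection n m E') : Prop :=
  ∀ (Y : Π q : E', TangentSpace 𝓘(ℝ, Coord n m) q) (p : E) (X : TangentSpace 𝓘(ℝ, Coord n m) p),
    MDifferentiableAt 𝓘(ℝ, Coord n m) (𝓘(ℝ, Coord n m).prod 𝓘(ℝ, Coord n m))
      (fun q => TotalSpace.mk' (Coord n m) q (Y q)) (f p) →
    mfderiv 𝓘(ℝ, Coord n m) 𝓘(ℝ, Coord n m) f p
        (Γ (VectorField.mpullback 𝓘(ℝ, Coord n m) 𝓘(ℝ, Coord n m) f Y) p X) =
      Γ' Y (f p) (mfderiv 𝓘(ℝ, Coord n m) 𝓘(ℝ, Coord n m) f p X)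

end Jet

end

noncomputable section
set_option linter.unusedSectionVars false

/-! ### Local formulas for linear connections -/

section LocalFormulas

variable {EB : Type*} [NormedAddCommGroup EB] [NormedSpace ℝ EB]
  {HB : Type*} [TopologicalSpace HB] {I : ModelWithCorners ℝ EB HB}
  {B : Type*} [TopologicalSpace B] [ChartedSpace HB B]
  {F : Type*} [NormedAddCommGroup F] [NormedSpace ℝ F]
  {V : B → Type*} [TopologicalSpace (TotalSpace F V)]
  [∀ x, AddCommGroup (V x)] [∀ x, Module ℝ (V x)] [∀ x, TopologicalSpace (V x)]
  [∀ x, IsTopologicalAddGroup (V x)] [∀ x, ContinuousSMul ℝ (V x)]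
  [FiberBundle F V] [VectorBundle ℝ F V]

/-! The mechanism is that `ω¹ ∘ D¹ = 0`. Expand `∇[Ω] D¹` in a frame of `H^{1,0}`: the connection
`Ξ` contributes only `D¹` applied to some vector of the plane, and the quotient map kills it
(`inducedForm_apply`). What remains, on a vector `h` of the plane, is the class of `∇_X (D¹ s)` for
the pull-back of `Γ`, where `s` is any section of `H^{1,0}` that extends `h`. For vertical `X` the
pull-back connection does not see `Γ`, so this same class is the image of `X` under the
identification of `ker Tπ₁₀` with `H^{1,0*} ⊗ V^{1,0}` (`verticalIso_apply`).

In a divided chart write `w` for `(u^i_λ)` and `a` for the horizontal coordinates of `s`, so that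
`D¹ s` has components `(a, w a)`. The form `du^i - u^i_λ du^λ` has the plane as its kernel, and
applied to the derivative it cancels the terms in `da`. This leaves `dw(a)` plus a term built from
the Christoffel symbols of `Γ` (`contact_pullback_apply`). The equation for `υ` is therefore
equivalent, in jet coordinates, to `υ(du, dw) = (0, dw + L du)` with an explicit `L`
(`forall_verticalIso_eq_iff`). Existence, uniqueness and independence of `Ξ` are read off from this
(`isInduced_iff`). Since the equation itself mentions no chart, the local forms agree on overlaps
(`vertForm_eq`), and expanding `L` in components gives the stated symbols.

For naturality, a chart `ψ` of the target gives the chart `ψ ∘ f` of the source. In these charts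
`J¹f` is the identity and the Christoffel symbols coincide.

A smooth `Ξ` is obtained by averaging flat connections with a partition of unity. This needs `J¹(E,
n)` to be Hausdorff and `σ`-compact, which follows from the fact that a generic linear change of
coordinates makes a given plane a graph. -/

lemma mvfderiv_clm_comp {G : Type*} [NormedAddCommGroup G] [NormedSpace ℝ G] (L : F →L[ℝ] G)
    {g : B → F} {x : B} (hg : MDifferentiableAt I 𝓘(ℝ, F) g x) :
    mvfderiv I (fun y => L (g y)) x = L.comp (mvfderiv I g x) :=
  ((L.hasFDerivAt (x := g x)).hasMFDerivAt.comp x hg.hasMFDerivAt).mfderiv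

lemma flatDeriv_apply_eq_iff {s : Π x, V x} {x : B} {X : TangentSpace I x} {w : V x} :
    flatDeriv I F s x X = w ↔
      mvfderiv I (fun y => (trivializationAt F V x ⟨y, s y⟩).2) x X =
        (trivializationAt F V x ⟨x, w⟩).2 := by
  have hx := FiberBundle.mem_baseSet_trivializationAt' (F := F) (E := V) x
  rw [flatDeriv, ContinuousLinearMap.comp_apply, Trivialization.symmL_apply _ hx]
  constructor
  · rintro rfl
    rw [Trivialization.apply_mk_symm _ hx]
  · intro h
    rw [h]
    exact (trivializationAt F V x).symm_apply_apply_mk hx w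

lemma flatDeriv_extend {x : B} (v : V x) : flatDeriv I F (FiberBundle.extend F v) x = 0 := by
  have hx := FiberBundle.mem_baseSet_trivializationAt' (F := F) (E := V) x
  have h : (fun y => (trivializationAt F V x ⟨y, FiberBundle.extend F v y⟩).2) =ᶠ[𝓝 x]
      fun _ => (trivializationAt F V x ⟨x, v⟩).2 := by
    filter_upwards [(trivializationAt F V x).open_baseSet.mem_nhds hx] with y hy
    simp [FiberBundle.extend, hy]
  rw [flatDeriv, mvfderiv_congr h, mvfderiv_const, ContinuousLinearMap.comp_zero]

/-- A linear connection differs from the flat connection of the preferred trivialisation by a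
tensor. -/
lemma CovariantDerivative.eq_flatDeriv_add [FiniteDimensional ℝ F] [ContMDiffVectorBundle 1 F V I]
    (cov : CovariantDerivative I F V) {s : Π x, V x} {x : B}
    (hs : MDifferentiableAt I (I.prod 𝓘(ℝ, F)) (fun y => TotalSpace.mk' F y (s y)) x) :
    cov s x = flatDeriv I F s x + cov (FiberBundle.extend F (s x)) x := by
  -- Both operators obey the same Leibniz rule, so their difference is linear over functions and
  -- depends only on `s x`. It can then be computed on the extension of `s x`, whose flat derivative
  -- vanishes.
  have ht : TensorialAt I F (fun s : Π x, V x => cov s x - flatDeriv I F s x) x := by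
    constructor
    · intro g s hg hs
      simp only [cov.isCovariantDerivativeOnUniv.leibniz hs hg, flatDeriv_smul hs hg, smul_sub]
      abel
    · intro s t hs ht
      simp only [cov.isCovariantDerivativeOnUniv.add hs ht, flatDeriv_add hs ht]
      abel
  have := ht.pointwise hs (FiberBundle.mdifferentiableAt_extend I F (s x))
    (FiberBundle.extend_apply_self F (s x)).symm
  simp only [flatDeriv_extend, sub_zero] at this
  rw [← this]
  abel

lemma CovariantDerivative.apply_sum [ContMDiffVectorBundle 1 F V I] {ι : Type*} (t : Finset ι)
    (cov : CovariantDerivative I F V) {s : ι → Π x, V x} {x : B}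
    (hs : ∀ i ∈ t, MDifferentiableAt I (I.prod 𝓘(ℝ, F))
      (fun y => TotalSpace.mk' F y (s i y)) x) :
    cov (fun y => ∑ i ∈ t, s i y) x = ∑ i ∈ t, cov (s i) x := by
  classical
  induction t using Finset.induction_on with
  | empty =>
    have := congrFun cov.zero x
    simp only [Finset.sum_empty]
    exact this
  | insert a t ha h =>
    simp only [Finset.mem_insert, forall_eq_or_imp] at hs
    simp only [Finset.sum_insert ha, ← h hs.2]
    exact cov.isCovariantDerivativeOnUniv.add hs.1 (.sum_section hs.2)

variable {EP : Type*} [NormedAddCommGroup EP] [NormedSpace ℝ EP]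
  {HP : Type*} [TopologicalSpace HP] {IP : ModelWithCorners ℝ EP HP}
  {P : Type*} [TopologicalSpace P] [ChartedSpace HP P]

/-- The pull-back `s ∘ f` of a section, as a section of the pull-back bundle. -/
def pullbackSection (f : P → B) (s : Π x, V x) (y : P) : (f *ᵖ V) y := s (f y)

lemma mdifferentiableAt_pullbackSection {k : ℕ∞ω} (hk : k ≠ 0) (f : ContMDiffMap IP I P B k)
    {s : Π x, V x} {y : P}
    (hs : MDifferentiableAt I (I.prod 𝓘(ℝ, F)) (fun y => TotalSpace.mk' F y (s y)) (f y)) :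
    MDifferentiableAt IP (IP.prod 𝓘(ℝ, F)) (fun y => TotalSpace.mk' F
      (E := (f : P → B) *ᵖ V) y (pullbackSection f s y)) y := by
  rw [mdifferentiableAt_section] at hs
  rw [mdifferentiableAt_section]
  exact hs.comp y (f.contMDiff.mdifferentiableAt hk)

/-- The preferred trivialisation of the pull-back bundle at `y` is that of `V` at `f y`, so `s ∘ f`
is read there as a composite and the chain rule applies. -/
lemma flatDeriv_pullbackSection {k : ℕ∞ω} (hk : k ≠ 0) (f : ContMDiffMap IP I P B k)
    {s : Π x, V x} {y : P}
    (hs : MDifferentiableAt I (I.prod 𝓘(ℝ, F)) (fun y => TotalSpace.mk' F y (s y)) (f y)) :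
    flatDeriv IP F (pullbackSection f s) y =
      (flatDeriv I F s (f y)).comp (mfderiv IP I f y) := by
  rw [mdifferentiableAt_section] at hs
  ext X
  rw [flatDeriv_apply_eq_iff]
  have h1 := (flatDeriv_apply_eq_iff (I := I) (F := F) (s := s) (X := mfderiv IP I f y X)).1 rfl
  refine Eq.trans ?_ h1
  exact congrArg (fun A => A X) (mfderiv_comp y hs (f.contMDiff.mdifferentiableAt hk))

/-- The defining property of the pull-back of a linear connection. -/
lemma CovariantDerivative.pullback_apply [FiniteDimensional ℝ F] [ContMDiffVectorBundle 1 F V I]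
    (cov : CovariantDerivative I F V) {k : ℕ∞ω} (hk : k ≠ 0) (f : ContMDiffMap IP I P B k)
    {s : Π x, V x} {y : P}
    (hs : MDifferentiableAt I (I.prod 𝓘(ℝ, F)) (fun y => TotalSpace.mk' F y (s y)) (f y)) :
    cov.pullback f (pullbackSection f s) y = (cov s (f y)).comp (mfderiv IP I f y) := by
  -- The flat part is handled by the chain rule, and the remaining part is `pullbackTerm` by
  -- definition.
  rw [cov.eq_flatDeriv_add hs, ContinuousLinearMap.add_comp, ← flatDeriv_pullbackSection hk f hs]
  rfl

end LocalFormulas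

/-! ### Flat derivatives of bundle homomorphisms. -/

section Hom

variable {EB : Type*} [NormedAddCommGroup EB] [NormedSpace ℝ EB]
  {HB : Type*} [TopologicalSpace HB] {I : ModelWithCorners ℝ EB HB}
  {B : Type*} [TopologicalSpace B] [ChartedSpace HB B]
  {F₁ : Type*} [NormedAddCommGroup F₁] [NormedSpace ℝ F₁]
  {V : B → Type*} [TopologicalSpace (TotalSpace F₁ V)]
  [∀ x, AddCommGroup (V x)] [∀ x, Module ℝ (V x)] [∀ x, TopologicalSpace (V x)]
  [∀ x, IsTopologicalAddGroup (V x)] [∀ x, ContinuousSMul ℝ (V x)]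
  [FiberBundle F₁ V] [VectorBundle ℝ F₁ V]
  {F : Type*} [NormedAddCommGroup F] [NormedSpace ℝ F]
  {W : B → Type*} [TopologicalSpace (TotalSpace F W)]
  [∀ x, AddCommGroup (W x)] [∀ x, Module ℝ (W x)] [∀ x, TopologicalSpace (W x)]
  [∀ x, IsTopologicalAddGroup (W x)] [∀ x, ContinuousSMul ℝ (W x)]
  [FiberBundle F W] [VectorBundle ℝ F W]

/-- The flat derivative of a section `Φ` of `Hom(V, W)` is that of the sections `Φ(s)`, where `s` is
constant in the preferred trivialisation of `V`. -/
lemma flatDeriv_hom_apply {Φ : Π x, V x →L[ℝ] W x} {x : B}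
    (hΦ : MDifferentiableAt I (I.prod 𝓘(ℝ, F₁ →L[ℝ] F)) (fun y => TotalSpace.mk' (F₁ →L[ℝ] F)
          (E := fun x => V x →L[ℝ] W x) y (Φ y)) x) (X : TangentSpace I x) (h : V x) :
    flatDeriv I (F₁ →L[ℝ] F) (V := fun x => V x →L[ℝ] W x) Φ x X h =
      flatDeriv I F (fun y => Φ y (FiberBundle.extend F₁ h y)) x X := by
  have hx := FiberBundle.mem_baseSet_trivializationAt' (F := F₁) (E := V) x
  have hx' := FiberBundle.mem_baseSet_trivializationAt' (F := F) (E := W) x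
  rw [mdifferentiableAt_section] at hΦ
  symm
  rw [flatDeriv_apply_eq_iff]
  set v : F₁ := (trivializationAt F₁ V x ⟨x, h⟩).2 with hv
  have h1 := (flatDeriv_apply_eq_iff (I := I) (F := F₁ →L[ℝ] F)
    (V := fun x => V x →L[ℝ] W x) (s := Φ) (X := X)).1 rfl
  -- In coordinates `Φ` is conjugated by the two trivialisations, and the extension of `h` is the
  -- constant `v`. The section `Φ(s)` therefore reads as a matrix applied to a constant vector, and
  -- evaluation at `v` commutes with the derivative.
  have h2 : (fun y => (trivializationAt F W x ⟨y, Φ y (FiberBundle.extend F₁ h y)⟩).2) =ᶠ[𝓝 x]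
      fun y => (trivializationAt (F₁ →L[ℝ] F) (fun x => V x →L[ℝ] W x) x ⟨y, Φ y⟩).2 v := by
    filter_upwards [(trivializationAt F₁ V x).open_baseSet.mem_nhds hx,
      (trivializationAt F W x).open_baseSet.mem_nhds hx'] with y hy hy'
    rw [hom_trivializationAt_apply, inCoordinates_eq hy hy']
    simp [FiberBundle.extend, ← hv, Trivialization.symm_apply, hy]
  have h3 := congrArg (fun A => A X)
    (mvfderiv_clm_comp (ContinuousLinearMap.apply ℝ F v) hΦ)
  rw [mvfderiv_congr h2]
  refine h3.trans ?_
  refine (congrArg (fun A : F₁ →L[ℝ] F => A v) h1).trans ?_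
  rw [hom_trivializationAt_apply, inCoordinates_eq hx hx']
  simp only [ContinuousLinearMap.comp_apply, ContinuousLinearEquiv.coe_coe,
    Trivialization.symm_continuousLinearEquivAt_eq, Trivialization.continuousLinearEquivAt_apply, hv,
    Trivialization.symmL_apply _ hx, Trivialization.symm_apply_apply_mk _ hx]

end Hom

/-! ### Tensor product connections evaluated on vectors. -/

section TensorFormula

variable {EB : Type*} [NormedAddCommGroup EB] [NormedSpace ℝ EB] [FiniteDimensional ℝ EB]
  {HB : Type*} [TopologicalSpace HB] {I : ModelWithCorners ℝ EB HB}
  {B : Type*} [TopologicalSpace B] [ChartedSpace HB B]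
  {n : ℕ} {V : B → Type*} [TopologicalSpace (TotalSpace (Fin n → ℝ) V)]
  [∀ x, AddCommGroup (V x)] [∀ x, Module ℝ (V x)] [∀ x, TopologicalSpace (V x)]
  [∀ x, IsTopologicalAddGroup (V x)] [∀ x, ContinuousSMul ℝ (V x)]
  [FiberBundle (Fin n → ℝ) V] [VectorBundle ℝ (Fin n → ℝ) V]
  {F : Type*} [NormedAddCommGroup F] [NormedSpace ℝ F]
  {W : B → Type*} [TopologicalSpace (TotalSpace F W)]
  [∀ x, AddCommGroup (W x)] [∀ x, Module ℝ (W x)] [∀ x, TopologicalSpace (W x)]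
  [∀ x, IsTopologicalAddGroup (W x)] [∀ x, ContinuousSMul ℝ (W x)]
  [FiberBundle F W] [VectorBundle ℝ F W]

lemma extend_eq_sum_frame {x : B} (h : V x) : ∀ᶠ y in 𝓝 x,
    FiberBundle.extend (Fin n → ℝ) h y = ∑ i : Fin n, coframe V x i x h • frame V x i y := by
  have hx := FiberBundle.mem_baseSet_trivializationAt' (F := Fin n → ℝ) (E := V) x
  filter_upwards [(trivializationAt (Fin n → ℝ) V x).open_baseSet.mem_nhds hx] with y hy
  simp only [frame, ← map_smul, ← map_sum]
  rw [FiberBundle.extend, ← Trivialization.symmL_apply (R := ℝ) _ hy]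
  congr 1
  rw [pi_eq_sum_univ' (trivializationAt (Fin n → ℝ) V x ⟨x, h⟩).2]
  simp only [coframe, ContinuousLinearMap.comp_apply, ContinuousLinearMap.proj_apply]
  rw [Trivialization.continuousLinearMapAt_apply_of_mem (R := ℝ) _ hx]

/-- A tensor product connection on `Hom(V, W)`, evaluated on a vector `h` of `V`. -/
lemma CovariantDerivative.tensor_apply_apply [ContMDiffVectorBundle 1 (Fin n → ℝ) V I]
    [ContMDiffVectorBundle 1 F W I]
    (cov₁ : CovariantDerivative I ((Fin n → ℝ) →L[ℝ] ℝ) (DualFib V))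
    (cov₂ : CovariantDerivative I F W) {Φ : Π x, V x →L[ℝ] W x} {x : B}
    (hΦ : MDifferentiableAt I (I.prod 𝓘(ℝ, (Fin n → ℝ) →L[ℝ] F))
      (fun y => TotalSpace.mk' ((Fin n → ℝ) →L[ℝ] F) (E := fun x => V x →L[ℝ] W x) y (Φ y)) x)
    (X : TangentSpace I x) (h : V x) :
    cov₁.tensor cov₂ Φ x X h =
      Φ x (∑ i : Fin n, (cov₁ (coframe V x i) x X h : ℝ) • frame V x i x) +
        cov₂ (fun y => Φ y (FiberBundle.extend (Fin n → ℝ) h y)) x X := by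
  have hm : ∀ i : Fin n, MDifferentiableAt I (I.prod 𝓘(ℝ, F))
      (fun y => TotalSpace.mk' F y (Φ y (frame V x i y))) x :=
    fun i => MDifferentiableAt.clm_bundle_apply hΦ (frame_mdiff _ i)
  -- The coefficients of the extension in the frame are constants, so no derivative of them appears.
  have h2 : cov₂ (fun y => Φ y (FiberBundle.extend (Fin n → ℝ) h y)) x =
      ∑ i : Fin n, coframe V x i x h • cov₂ (fun y => Φ y (frame V x i y)) x := by
    have e : ∀ᶠ y in 𝓝 x, Φ y (FiberBundle.extend (Fin n → ℝ) h y) =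
        ∑ i : Fin n, ((coframe V x i x h : ℝ) • fun y => Φ y (frame V x i y)) y := by
      filter_upwards [extend_eq_sum_frame (n := n) h] with y hy
      rw [hy, map_sum]
      simp only [map_smul, Pi.smul_apply]
    have hm' : ∀ i : Fin n, MDifferentiableAt I (I.prod 𝓘(ℝ, F)) (fun y => TotalSpace.mk' F y
        (((coframe V x i x h : ℝ) • fun y => Φ y (frame V x i y)) y)) x :=
      fun i => mdifferentiableAt_const.smul_section (hm i)
    rw [cov₂.isCovariantDerivativeOnUniv.congr_of_eventuallyEq
      (MDifferentiableAt.clm_bundle_apply hΦ (FiberBundle.mdifferentiableAt_extend ..))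
      (.sum_section fun i _ => hm' i) Filter.univ_mem e, cov₂.apply_sum _ fun i _ => hm' i]
    exact Finset.sum_congr rfl fun i _ =>
      cov₂.isCovariantDerivativeOnUniv.smul_const _ (hm i)
  -- The contribution of `cov₁` leaves the sum as `Φ x` of a single vector. This shape is what later
  -- makes it vanish modulo the image of `Φ`.
  rw [h2, map_sum]
  simp only [CovariantDerivative.tensor, LinearMap.coe_toContinuousLinearMap', LinearMap.coe_mk,
    AddHom.coe_mk, _root_.sum_apply, _root_.add_apply, Finset.sum_add_distrib, dyad,
    ContinuousLinearMap.smulRight_apply, map_smul, _root_.smul_apply]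

end TensorFormula

/-! ### The tangent bundle read in charts. -/

section Tangent

variable {F : Type*} [NormedAddCommGroup F] [NormedSpace ℝ F]
  {M : Type*} [TopologicalSpace M] [ChartedSpace F M] [IsManifold 𝓘(ℝ, F) 1 M]

lemma trivializationAt_tangentSpace_apply {x y : M} (hy : y ∈ (chartAt F x).source)
    (v : TangentSpace 𝓘(ℝ, F) y) :
    (trivializationAt F (TangentSpace 𝓘(ℝ, F) : M → Type _) x ⟨y, v⟩).2 =
      mfderiv 𝓘(ℝ, F) 𝓘(ℝ, F) (chartAt F x) y v := by
  have h := congrArg (fun A => A v)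
    (TangentBundle.continuousLinearMapAt_trivializationAt (I := 𝓘(ℝ, F)) hy)
  refine Eq.trans ?_ h
  exact (Trivialization.continuousLinearMapAt_apply_of_mem (R := ℝ)
    (trivializationAt F (TangentSpace 𝓘(ℝ, F) : M → Type _) x) hy v).symm

end Tangent

namespace Jet

variable {n m : ℕ} {E : Type*} [TopologicalSpace E] [ChartedSpace (Coord n m) E]
  [IsManifold 𝓘(ℝ, Coord n m) ∞ E]

/-! ### Coordinates on the tangent spaces -/

/-- The differential of a jet chart. -/
abbrev dJet (φ : OpenPartialHomeomorph E (Coord n m))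
    (hφ : φ ∈ IsManifold.maximalAtlas 𝓘(ℝ, Coord n m) ∞ E) (θ : Jet n m E) :
    TangentSpace 𝓘(ℝ, JetCoord n m) θ →L[ℝ] JetCoord n m :=
  mfderiv 𝓘(ℝ, JetCoord n m) 𝓘(ℝ, JetCoord n m) (jetChart φ hφ) θ

lemma jetChart_mem_maximalAtlas {φ : OpenPartialHomeomorph E (Coord n m)}
    (hφ : φ ∈ IsManifold.maximalAtlas 𝓘(ℝ, Coord n m) ∞ E) :
    jetChart φ hφ ∈ IsManifold.maximalAtlas 𝓘(ℝ, JetCoord n m) ∞ (Jet n m E) :=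
  IsManifold.subset_maximalAtlas (jetChart_mem_atlas hφ)

lemma mdifferentiableAt_jetChart {φ : OpenPartialHomeomorph E (Coord n m)}
    (hφ : φ ∈ IsManifold.maximalAtlas 𝓘(ℝ, Coord n m) ∞ E) {θ : Jet n m E} (hθ : θ ∈ domain φ) :
    MDifferentiableAt 𝓘(ℝ, JetCoord n m) 𝓘(ℝ, JetCoord n m) (jetChart φ hφ) θ :=
  (contMDiffAt_of_mem_maximalAtlas (jetChart_mem_maximalAtlas hφ) hθ).mdifferentiableAt (by simp)

lemma isInvertible_dJet {φ : OpenPartialHomeomorph E (Coord n m)}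
    (hφ : φ ∈ IsManifold.maximalAtlas 𝓘(ℝ, Coord n m) ∞ E) {θ : Jet n m E} (hθ : θ ∈ domain φ) :
    (dJet φ hφ θ).IsInvertible := by
  have h : (jetChart φ hφ).MDifferentiable 𝓘(ℝ, JetCoord n m) 𝓘(ℝ, JetCoord n m) :=
    ⟨(contMDiffOn_of_mem_maximalAtlas (jetChart_mem_maximalAtlas hφ)).mdifferentiableOn (by simp),
      (contMDiffOn_symm_of_mem_maximalAtlas
        (jetChart_mem_maximalAtlas hφ)).mdifferentiableOn (by simp)⟩
  exact ⟨h.mfderiv hθ, rfl⟩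

lemma mdifferentiableAt_pt (θ : Jet n m E) :
    MDifferentiableAt 𝓘(ℝ, JetCoord n m) 𝓘(ℝ, Coord n m) (pt : Jet n m E → E) θ :=
  contMDiff_pt.mdifferentiableAt (by simp)

/-- In jet coordinates, the differential of `π₁₀` is `(du, dw) ↦ du`. -/
lemma dChart_mfderiv_pt {φ : OpenPartialHomeomorph E (Coord n m)}
    (hφ : φ ∈ IsManifold.maximalAtlas 𝓘(ℝ, Coord n m) ∞ E) {θ : Jet n m E} (hθ : θ ∈ domain φ)
    (X : TangentSpace 𝓘(ℝ, JetCoord n m) θ) :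
    dChart φ θ.pt (mfderiv 𝓘(ℝ, JetCoord n m) 𝓘(ℝ, Coord n m) (pt : Jet n m E → E) θ X) =
      (dJet φ hφ θ X).1 := by
  have h1 : MDifferentiableAt 𝓘(ℝ, Coord n m) 𝓘(ℝ, Coord n m) φ θ.pt :=
    (contMDiffAt_of_mem_maximalAtlas hφ hθ.1).mdifferentiableAt (by simp)
  have h2 := mfderiv_comp θ h1 (mdifferentiableAt_pt θ)
  have h3 := ((ContinuousLinearMap.fst ℝ (Coord n m)
    ((Fin n → ℝ) →L[ℝ] (Fin m → ℝ))).hasFDerivAt (x := jetChart φ hφ θ)).hasMFDerivAt.comp θ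
      (mdifferentiableAt_jetChart hφ hθ).hasMFDerivAt
  have h4 : (φ ∘ (pt : Jet n m E → E)) =
    ContinuousLinearMap.fst ℝ (Coord n m) ((Fin n → ℝ) →L[ℝ] (Fin m → ℝ)) ∘ jetChart φ hφ := rfl
  rw [← h4] at h3
  exact congrArg (fun A => A X) (h2.symm.trans h3.mfderiv)

lemma mfderiv_pt_eq_zero_iff {φ : OpenPartialHomeomorph E (Coord n m)}
    (hφ : φ ∈ IsManifold.maximalAtlas 𝓘(ℝ, Coord n m) ∞ E) {θ : Jet n m E} (hθ : θ ∈ domain φ)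
    (X : TangentSpace 𝓘(ℝ, JetCoord n m) θ) :
    mfderiv 𝓘(ℝ, JetCoord n m) 𝓘(ℝ, Coord n m) (pt : Jet n m E → E) θ X = 0 ↔
      (dJet φ hφ θ X).1 = 0 := by
  rw [← dChart_mfderiv_pt hφ hθ]
  exact ((isInvertible_dChart hφ hθ.1).injective.eq_iff' (map_zero _)).symm

/-- The linear map `T_pE → ℝᵐ` with kernel the plane `θ` given by `du^i - u^i_λ du^λ`. -/
def contact (φ : OpenPartialHomeomorph E (Coord n m)) (θ : Jet n m E) :
    TangentSpace 𝓘(ℝ, Coord n m) θ.pt →L[ℝ] (Fin m → ℝ) :=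
  (ContinuousLinearMap.snd ℝ (Fin n → ℝ) (Fin m → ℝ) -
    (slope φ θ).comp (ContinuousLinearMap.fst ℝ (Fin n → ℝ) (Fin m → ℝ))).comp (dChart φ θ.pt)

/-- In the chart the plane is the graph of `slope φ θ`, and membership in a graph is the vanishing
of `z.2 - slope z.1`. -/
lemma contact_eq_zero_iff {φ : OpenPartialHomeomorph E (Coord n m)}
    (hφ : φ ∈ IsManifold.maximalAtlas 𝓘(ℝ, Coord n m) ∞ E) {θ : Jet n m E} (hθ : θ ∈ domain φ)
    (z : TangentSpace 𝓘(ℝ, Coord n m) θ.pt) : contact φ θ z = 0 ↔ z ∈ θ.plane := by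
  have hinv := isInvertible_dChart hφ hθ.1
  constructor
  · intro h
    have h1 : (dChart φ θ.pt z).2 = slope φ θ (dChart φ θ.pt z).1 := sub_eq_zero.1 h
    rw [range_inverse_graphMap hφ hθ]
    refine ⟨(dChart φ θ.pt z).1, ?_⟩
    simp only [ContinuousLinearMap.coe_coe, ContinuousLinearMap.comp_apply, graphMap_apply, ← h1]
    exact hinv.inverse_apply_self z
  · intro h
    have h1 := dChart_eq_graphMap hθ ⟨z, h⟩
    rw [graphMap_apply] at h1
    refine sub_eq_zero.2 ?_
    change (dChart φ θ.pt z).2 = slope φ θ (dChart φ θ.pt z).1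
    have h2 : dChart φ θ.pt z = _ := h1
    rw [h2]

/-- This replaces equalities in the quotient `V^{1,0}` by equalities in `ℝᵐ`, so the quotient never
needs a trivialisation of its own. -/
lemma omega1_eq_iff {φ : OpenPartialHomeomorph E (Coord n m)}
    (hφ : φ ∈ IsManifold.maximalAtlas 𝓘(ℝ, Coord n m) ∞ E) {θ : Jet n m E} (hθ : θ ∈ domain φ)
    (z z' : Tan θ) : omega1 θ z = omega1 θ z' ↔ contact φ θ z = contact φ θ z' := by
  have h1 : contact φ θ (z - z') = contact φ θ z - contact φ θ z' := map_sub (contact φ θ) z z'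
  rw [← sub_eq_zero (a := contact φ θ z), ← h1]
  exact (Submodule.Quotient.eq θ.plane).trans (contact_eq_zero_iff hφ hθ _).symm

/-! ### The inclusion of the pseudo-horizontal bundle -/

/-- Names the divided chart that was chosen to define the preferred trivialisation, so that later
arguments need not unfold the choice. -/
lemma trivializationAt_hor_apply (θ : Jet n m E) :
    ∃ (φ : _) (_ : φ ∈ IsManifold.maximalAtlas 𝓘(ℝ, Coord n m) ∞ E), θ ∈ domain φ ∧
      (trivializationAt (Fin n → ℝ) (Hor n m E) θ).baseSet = domain φ ∧
      ∀ (η : Jet n m E) (h : Hor n m E η),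
        (trivializationAt (Fin n → ℝ) (Hor n m E) θ ⟨η, h⟩).2 = horMap φ η h :=
  ⟨_, (exists_mem_domain θ).choose_spec.1, (exists_mem_domain θ).choose_spec.2, rfl,
    fun _ _ => rfl⟩

/-- Differentiability of a section is tested in the preferred trivialisation, while computations use
an arbitrary divided chart. The trivialisation of that chart belongs to the atlas of the bundle,
which allows the transfer. -/
lemma mdifferentiableAt_horMap {φ : OpenPartialHomeomorph E (Coord n m)}
    (hφ : φ ∈ IsManifold.maximalAtlas 𝓘(ℝ, Coord n m) ∞ E) {θ : Jet n m E} (hθ : θ ∈ domain φ)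
    {s : Π η, Hor n m E η} (hs : MDifferentiableAt 𝓘(ℝ, JetCoord n m)
      (𝓘(ℝ, JetCoord n m).prod 𝓘(ℝ, Fin n → ℝ)) (fun η => TotalSpace.mk' (Fin n → ℝ) η (s η)) θ) :
    MDifferentiableAt 𝓘(ℝ, JetCoord n m) 𝓘(ℝ, Fin n → ℝ) (fun η => horMap φ η (s η)) θ := by
  let e := (horPrebundle n m E).trivializationOfMemPretrivializationAtlas ⟨φ, hφ, rfl⟩
  have : MemTrivializationAtlas e := ⟨_, ⟨φ, hφ, rfl⟩, rfl⟩
  exact (e.mdifferentiableAt_section_iff 𝓘(ℝ, JetCoord n m) s hθ).1 hs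

/-- If `H^{1,0}` is trivialised by `φ` and `TE` by `c`, the inclusion becomes `transFrame φ c`: the
differential of the change of charts applied to the graph of the slope. This is smooth in the jet
coordinates. -/
lemma mdifferentiableAt_D1 (θ : Jet n m E) : MDifferentiableAt 𝓘(ℝ, JetCoord n m)
    (𝓘(ℝ, JetCoord n m).prod 𝓘(ℝ, (Fin n → ℝ) →L[ℝ] Coord n m))
    (fun η => TotalSpace.mk' ((Fin n → ℝ) →L[ℝ] Coord n m)
      (E := fun η => Hor n m E η →L[ℝ] Tan η) η (D1 η)) θ := by
  obtain ⟨φ, hφ, hθ, hbase, htriv⟩ := trivializationAt_hor_apply θ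
  set c := chartAt (Coord n m) θ.pt
  have hc : c ∈ IsManifold.maximalAtlas 𝓘(ℝ, Coord n m) ∞ E :=
    IsManifold.chart_mem_maximalAtlas θ.pt
  have hcp : θ.pt ∈ c.source := mem_chart_source _ _
  rw [mdifferentiableAt_section]
  have hev : (fun η => (trivializationAt ((Fin n → ℝ) →L[ℝ] Coord n m)
      (fun η => Hor n m E η →L[ℝ] Tan η) θ ⟨η, D1 η⟩).2) =ᶠ[𝓝 θ]
      fun η => transFrame φ c (jetChart φ hφ η) := by
    filter_upwards [(isOpen_domain hφ).mem_nhds hθ, (c.open_source.preimage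
      (contMDiff_pt (n := n) (m := m) (E := E)).continuous).mem_nhds hcp] with η hη hηc
    have hη1 : η ∈ (trivializationAt (Fin n → ℝ) (Hor n m E) θ).baseSet := hbase ▸ hη
    have hη2 : η ∈ (trivializationAt (Coord n m) (Tan (n := n) (m := m) (E := E)) θ).baseSet := hηc
    rw [hom_trivializationAt_apply]
    refine (inCoordinates_eq hη1 hη2).trans ?_
    -- Writing `v` as the image of a vector `h` of the plane cancels the inverse trivialisation.
    ext1 v
    obtain ⟨h, rfl⟩ := ((trivializationAt (Fin n → ℝ) (Hor n m E) θ).continuousLinearEquivAt ℝ η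
      hη1).surjective v
    simp only [ContinuousLinearMap.comp_apply, ContinuousLinearEquiv.coe_coe,
      ContinuousLinearEquiv.symm_apply_apply]
    have h1 := dChart_trans_apply hφ hc hη hηc h
    refine (trivializationAt_tangentSpace_apply (M := E) hηc _).trans (h1.trans ?_)
    exact congrArg (transFrame φ c (jetChart φ hφ η)) (htriv η h).symm
  refine MDifferentiableAt.congr_of_eventuallyEq ?_ hev
  have hmem : jetChart φ hφ θ ∈ (φ.symm.trans c).source ×ˢ (univ : Set _) := by
    refine ⟨⟨φ.map_source hθ.1, ?_⟩, mem_univ _⟩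
    change φ.symm (φ θ.pt) ∈ c.source
    rwa [φ.left_inv hθ.1]
  have h1 := (contDiffOn_transFrame hφ hc).contDiffAt
    (((φ.symm.trans c).open_source.prod isOpen_univ).mem_nhds hmem)
  exact (h1.differentiableAt (by simp)).mdifferentiableAt.comp θ (mdifferentiableAt_jetChart hφ hθ)

/-! ### Coordinate fields as a smooth frame of `TE`. -/

/-- The component `u^A`, as a linear form. -/
def componentL (A : Fin n ⊕ Fin m) : Coord n m →L[ℝ] ℝ :=
  Sum.elim
    (fun ξ => (ContinuousLinearMap.proj ξ).comp (ContinuousLinearMap.fst ℝ (Fin n → ℝ) (Fin m → ℝ)))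
    (fun i => (ContinuousLinearMap.proj i).comp (ContinuousLinearMap.snd ℝ (Fin n → ℝ) (Fin m → ℝ)))
    A

lemma componentL_apply (A : Fin n ⊕ Fin m) (x : Coord n m) : componentL A x = component A x := by
  cases A <;> rfl

lemma sum_component_smul_basisVec (x : Coord n m) : ∑ A, component A x • basisVec A = x := by
  rw [Fintype.sum_sum_type]
  ext j
  · simp [component, basisVec, Prod.fst_sum, Finset.sum_apply, Pi.single_apply]
  · simp [component, basisVec, Prod.snd_sum, Finset.sum_apply, Pi.single_apply]

/-- The coordinate fields form a frame. -/
lemma sum_component_smul_coordField {φ : OpenPartialHomeomorph E (Coord n m)}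
    (hφ : φ ∈ IsManifold.maximalAtlas 𝓘(ℝ, Coord n m) ∞ E) {p : E} (hp : p ∈ φ.source)
    (z : TangentSpace 𝓘(ℝ, Coord n m) p) :
    ∑ A, component A (dChart φ p z) • coordField φ A p = z := by
  simp only [coordField, ← map_smul, ← map_sum]
  rw [sum_component_smul_basisVec, (isInvertible_dChart hφ hp).inverse_apply_self]

/-- Read in the preferred chart `c`, the field is the derivative of `c ∘ φ.symm` applied to a
constant basis vector. -/
lemma contMDiffOn_coordField {φ : OpenPartialHomeomorph E (Coord n m)}
    (hφ : φ ∈ IsManifold.maximalAtlas 𝓘(ℝ, Coord n m) ∞ E) (A : Fin n ⊕ Fin m) :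
    ContMDiffOn 𝓘(ℝ, Coord n m) (𝓘(ℝ, Coord n m).prod 𝓘(ℝ, Coord n m)) ∞
      (fun q => TotalSpace.mk' (Coord n m) q (coordField φ A q)) φ.source := by
  intro p hp
  refine ContMDiffAt.contMDiffWithinAt ?_
  rw [contMDiffAt_section]
  set c := chartAt (Coord n m) p
  have hc : c ∈ IsManifold.maximalAtlas 𝓘(ℝ, Coord n m) ∞ E :=
    IsManifold.chart_mem_maximalAtlas p
  have hcp : p ∈ c.source := mem_chart_source _ _
  have hev : (fun q => (trivializationAt (Coord n m) (TangentSpace 𝓘(ℝ, Coord n m) : E → Type _) p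
      ⟨q, coordField φ A q⟩).2) =ᶠ[𝓝 p] fun q => fderiv ℝ (c ∘ φ.symm) (φ q) (basisVec A) := by
    filter_upwards [φ.open_source.mem_nhds hp, c.open_source.mem_nhds hcp] with q hq hqc
    rw [trivializationAt_tangentSpace_apply hqc]
    have h1 := congrArg (fun L => L ((dChart φ q).inverse (basisVec A)))
      (dChart_trans hφ hc hq hqc)
    refine h1.trans ?_
    simp only [ContinuousLinearMap.comp_apply]
    rw [(isInvertible_dChart hφ hq).self_apply_inverse]
  refine ContMDiffAt.congr_of_eventuallyEq ?_ hev
  have h1 : ContDiffOn ℝ ∞ (c ∘ φ.symm) (φ.symm.trans c).source := by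
    rw [← contMDiffOn_iff_contDiffOn]
    refine (contMDiffOn_of_mem_maximalAtlas hc).comp
      ((contMDiffOn_symm_of_mem_maximalAtlas hφ).mono ?_) ?_
    · intro x hx; exact hx.1
    · intro x hx; exact hx.2
  have h2 := h1.fderiv_of_isOpen (m := ∞) (φ.symm.trans c).open_source (by simp)
  have hmem : φ p ∈ (φ.symm.trans c).source := by
    refine ⟨φ.map_source hp, ?_⟩
    change φ.symm (φ p) ∈ c.source
    rwa [φ.left_inv hp]
  have h3 := (h2.contDiffAt ((φ.symm.trans c).open_source.mem_nhds hmem)).clm_apply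
    (contDiffAt_const (c := (basisVec A : Coord n m)))
  exact h3.contMDiffAt.comp p (contMDiffAt_of_mem_maximalAtlas hφ hp)

lemma mdifferentiableAt_coordField {φ : OpenPartialHomeomorph E (Coord n m)}
    (hφ : φ ∈ IsManifold.maximalAtlas 𝓘(ℝ, Coord n m) ∞ E) (A : Fin n ⊕ Fin m) {p : E}
    (hp : p ∈ φ.source) :
    MDifferentiableAt 𝓘(ℝ, Coord n m) (𝓘(ℝ, Coord n m).prod 𝓘(ℝ, Coord n m))
      (fun q => TotalSpace.mk' (Coord n m) q (coordField φ A q)) p :=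
  ((contMDiffOn_coordField hφ A).contMDiffAt (φ.open_source.mem_nhds hp)).mdifferentiableAt (by simp)

/-! ### Covariant derivatives of sections with values in the planes. -/

lemma contact_inverse_dChart {φ : OpenPartialHomeomorph E (Coord n m)}
    (hφ : φ ∈ IsManifold.maximalAtlas 𝓘(ℝ, Coord n m) ∞ E) {θ : Jet n m E} (hθ : θ ∈ domain φ)
    (x : Coord n m) : contact φ θ ((dChart φ θ.pt).inverse x) = x.2 - slope φ θ x.1 := by
  rw [contact, ContinuousLinearMap.comp_apply, (isInvertible_dChart hφ hθ.1).self_apply_inverse]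
  rfl

/-- The derivative of a section of `T^{1,0}` which takes values in the planes, modulo `H^{1,0}`. -/
lemma contact_pullback_apply (Γ : TangentConnection n m E) {φ : OpenPartialHomeomorph E (Coord n m)}
    (hφ : φ ∈ IsManifold.maximalAtlas 𝓘(ℝ, Coord n m) ∞ E) {θ : Jet n m E} (hθ : θ ∈ domain φ)
    {s : Π η, Hor n m E η} (hs : MDifferentiableAt 𝓘(ℝ, JetCoord n m)
      (𝓘(ℝ, JetCoord n m).prod 𝓘(ℝ, Fin n → ℝ)) (fun η => TotalSpace.mk' (Fin n → ℝ) η (s η)) θ)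
    (X : TangentSpace 𝓘(ℝ, JetCoord n m) θ) :
    contact φ θ (Γ.pullback proj (fun η => D1 η (s η)) θ X) =
      (dJet φ hφ θ X).2 (horMap φ θ (s θ)) +
      contact φ θ (∑ B, component B (graphMap (slope φ θ) (horMap φ θ (s θ))) •
        Γ (coordField φ B) θ.pt
          (mfderiv 𝓘(ℝ, JetCoord n m) 𝓘(ℝ, Coord n m) (pt : Jet n m E → E) θ X)) := by
  set a : Jet n m E → (Fin n → ℝ) := fun η => horMap φ η (s η)
  set Y := mfderiv 𝓘(ℝ, JetCoord n m) 𝓘(ℝ, Coord n m) (pt : Jet n m E → E) θ X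
  have ha := (mdifferentiableAt_horMap hφ hθ hs).hasMFDerivAt
  have hw : HasMFDerivAt 𝓘(ℝ, JetCoord n m) 𝓘(ℝ, (Fin n → ℝ) →L[ℝ] (Fin m → ℝ))
      (fun η : Jet n m E => slope φ η) θ
      ((ContinuousLinearMap.snd ℝ (Coord n m) ((Fin n → ℝ) →L[ℝ] (Fin m → ℝ))).comp
        (dJet φ hφ θ)) :=
    (ContinuousLinearMap.snd ℝ (Coord n m)
      ((Fin n → ℝ) →L[ℝ] (Fin m → ℝ))).hasFDerivAt.hasMFDerivAt.comp θ
      (mdifferentiableAt_jetChart hφ hθ).hasMFDerivAt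
  set da : TangentSpace 𝓘(ℝ, JetCoord n m) θ →L[ℝ] (Fin n → ℝ) :=
    mfderiv 𝓘(ℝ, JetCoord n m) 𝓘(ℝ, Fin n → ℝ) a θ
  -- The components `(a, w a)` of `D¹ s` in the coordinate frame.
  set u : Jet n m E → Coord n m := fun η => graphMap (slope φ η) (a η)
  -- The product rule for `w a` gives the two summands of the second component. The first of them
  -- has the form `w (da)`, which is what the contact form cancels at the end.
  obtain ⟨du, hu, hdu⟩ : ∃ du : TangentSpace 𝓘(ℝ, JetCoord n m) θ →L[ℝ] Coord n m,
      HasMFDerivAt 𝓘(ℝ, JetCoord n m) 𝓘(ℝ, Coord n m) u θ du ∧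
        du X = (da X, slope φ θ (da X) + (dJet φ hφ θ X).2 (a θ)) := by
    have h1 : HasFDerivAt (fun p : ((Fin n → ℝ) →L[ℝ] (Fin m → ℝ)) × (Fin n → ℝ) =>
        (p.2, p.1 p.2)) _ (slope φ θ, a θ) :=
      hasFDerivAt_snd.prodMk (hasFDerivAt_fst.clm_apply hasFDerivAt_snd)
    exact ⟨_, h1.hasMFDerivAt.comp (f := fun η => (slope φ η, a η)) θ
      ⟨hw.1.prodMk ha.1, hw.2.prodMk ha.2⟩, rfl⟩
  have hg : ∀ B, HasMFDerivAt 𝓘(ℝ, JetCoord n m) 𝓘(ℝ, ℝ) (fun η => componentL B (u η)) θ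
      ((componentL B).comp du) := fun B => (componentL B).hasFDerivAt.hasMFDerivAt.comp θ hu
  let t : (Fin n ⊕ Fin m) → Π η : Jet n m E, Tan η := fun B =>
    pullbackSection (proj : Jet n m E → E) (coordField φ B)
  have ht : ∀ B, MDifferentiableAt 𝓘(ℝ, JetCoord n m)
      (𝓘(ℝ, JetCoord n m).prod 𝓘(ℝ, Coord n m))
      (fun η => TotalSpace.mk' (Coord n m) (E := Tan (n := n) (m := m) (E := E)) η (t B η)) θ :=
    fun B => mdifferentiableAt_pullbackSection (by simp) proj
      (mdifferentiableAt_coordField hφ B hθ.1)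
  have hgt : ∀ B, MDifferentiableAt 𝓘(ℝ, JetCoord n m)
      (𝓘(ℝ, JetCoord n m).prod 𝓘(ℝ, Coord n m))
      (fun η => TotalSpace.mk' (Coord n m) (E := Tan (n := n) (m := m) (E := E)) η
        (((fun η => componentL B (u η)) • t B) η)) θ :=
    fun B => (hg B).mdifferentiableAt.smul_section (ht B)
  -- Near `θ` the section is a combination of the pulled-back fields `∂_B ∘ π₁₀`. Its derivative is
  -- then determined by the Leibniz rule and by the defining property of the pull-back connection.
  have hev : ∀ᶠ η in 𝓝 θ, D1 η (s η) = ∑ B, ((fun η => componentL B (u η)) • t B) η := by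
    filter_upwards [(isOpen_domain hφ).mem_nhds hθ] with η hη
    have h1 := sum_component_smul_coordField hφ hη.1 (s η : η.plane).1
    have h2 : dChart φ η.pt (s η : η.plane).1 = u η := dChart_eq_graphMap hη (s η)
    rw [h2] at h1
    simp only [← componentL_apply] at h1
    exact h1.symm
  have hcov : ∀ B, Γ.pullback proj ((fun η => componentL B (u η)) • t B) θ X =
      componentL B (u θ) • (Γ (coordField φ B) θ.pt Y) +
        componentL B (du X) • coordField φ B θ.pt := by
    intro B
    rw [(Γ.pullback proj).isCovariantDerivativeOnUniv.leibniz (ht B) (hg B).mdifferentiableAt]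
    have h1 : Γ.pullback proj (t B) θ X = Γ (coordField φ B) θ.pt Y := congrArg (fun L => L X)
      (Γ.pullback_apply (by simp) (proj : ContMDiffMap 𝓘(ℝ, JetCoord n m) 𝓘(ℝ, Coord n m)
        (Jet n m E) E ∞) (mdifferentiableAt_coordField hφ B hθ.1))
    have h2 : mvfderiv 𝓘(ℝ, JetCoord n m) (fun η => componentL B (u η)) θ X =
      componentL B (du X) := congrArg (fun L => L X) (hg B).mfderiv
    rw [_root_.add_apply, _root_.smul_apply, h1, ContinuousLinearMap.smulRight_apply, h2]
    rfl
  have hs' : MDifferentiableAt 𝓘(ℝ, JetCoord n m) (𝓘(ℝ, JetCoord n m).prod 𝓘(ℝ, Coord n m))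
      (fun η => TotalSpace.mk' (Coord n m) (E := Tan (n := n) (m := m) (E := E)) η (D1 η (s η))) θ :=
    MDifferentiableAt.clm_bundle_apply (mdifferentiableAt_D1 θ) hs
  rw [(Γ.pullback proj).isCovariantDerivativeOnUniv.congr_of_eventuallyEq hs'
    (.sum_section fun B _ => hgt B) Filter.univ_mem hev,
    (Γ.pullback proj).apply_sum _ fun B _ => hgt B]
  have h3 : ∑ B, componentL B (du X) • coordField φ B θ.pt = (dChart φ θ.pt).inverse (du X) := by
    have h4 := sum_component_smul_coordField hφ hθ.1 ((dChart φ θ.pt).inverse (du X))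
    rw [(isInvertible_dChart hφ hθ.1).self_apply_inverse] at h4
    simpa only [← componentL_apply] using h4
  have h5 : (∑ B, Γ.pullback proj ((fun η => componentL B (u η)) • t B) θ) X =
      ((∑ B, componentL B (u θ) • (Γ (coordField φ B) θ.pt Y) +
        (dChart φ θ.pt).inverse (du X) : TangentSpace 𝓘(ℝ, Coord n m) θ.pt)) := by
    rw [_root_.sum_apply, Finset.sum_congr rfl fun B _ => hcov B, ← h3]
    exact Finset.sum_add_distrib
  refine (congrArg (contact φ θ) h5).trans ?_
  -- The derivative of the components contributes `(w da + dw a) - w da = dw a`, so the derivative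
  -- of the chosen extension `s` drops out.
  rw [map_add, contact_inverse_dChart hφ hθ, hdu, add_comm]
  simp only [componentL_apply, u, a, add_sub_cancel_left]

end Jet

namespace Jet

variable {n m : ℕ} {E : Type*} [TopologicalSpace E] [ChartedSpace (Coord n m) E]
  [IsManifold 𝓘(ℝ, Coord n m) ∞ E]

/-! ### The induced form and the vertical isomorphism in coordinates -/

/-- The connection `Ξ` disappears here: its whole contribution is `D¹` of a vector of the plane,
hence zero in the quotient. -/
lemma inducedForm_apply (Γ : TangentConnection n m E) (Ξ : HorDualConnection n m E) (θ : Jet n m E)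
    (X : TangentSpace 𝓘(ℝ, JetCoord n m) θ) (h : Hor n m E θ) :
    inducedForm Γ Ξ θ X h = omega1 θ (Γ.pullback proj
      (fun η => D1 η (FiberBundle.extend (Fin n → ℝ) h η)) θ X) := by
  have h1 := Ξ.tensor_apply_apply (Γ.pullback proj) (mdifferentiableAt_D1 θ) X h
  refine (congrArg (omega1 θ) h1).trans ?_
  rw [map_add]
  refine (congrArg (· + _) ?_).trans (zero_add _)
  exact (Submodule.Quotient.mk_eq_zero θ.plane).2 (Subtype.property _)

/-- The flat and the pull-back derivative differ by a term that factors through `Tπ₁₀ v`, which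
vanishes for vertical `v`. The identification of vertical vectors is thus expressed by the same
operator as the induced form, whatever `Γ` is. -/
lemma verticalIso_apply (Γ : TangentConnection n m E) (θ : Jet n m E)
    {v : TangentSpace 𝓘(ℝ, JetCoord n m) θ}
    (hv : mfderiv 𝓘(ℝ, JetCoord n m) 𝓘(ℝ, Coord n m) (pt : Jet n m E → E) θ v = 0)
    (h : Hor n m E θ) :
    verticalIso θ v h = omega1 θ (Γ.pullback proj
      (fun η => D1 η (FiberBundle.extend (Fin n → ℝ) h η)) θ v) := by
  refine congrArg (omega1 θ) ((flatDeriv_hom_apply (mdifferentiableAt_D1 θ) v h).trans ?_)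
  refine (add_zero _).symm.trans (congrArg (_ + ·) ?_)
  refine Eq.symm (Eq.trans ?_ (map_zero (Γ (FiberBundle.extend (Coord n m)
    (E := (TangentSpace 𝓘(ℝ, Coord n m) : E → Type _)) (x := θ.pt)
    (D1 θ (FiberBundle.extend (Fin n → ℝ) h θ))) θ.pt)))
  exact congrArg _ hv

/-- The Christoffel symbols of a linear connection on `TE`, as a bilinear map on `ℝⁿ × ℝᵐ`. -/
def christoffelMap (Γ : TangentConnection n m E) (φ : OpenPartialHomeomorph E (Coord n m)) (p : E) :
    Coord n m →L[ℝ] Coord n m →L[ℝ] Coord n m :=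
  ∑ A, ∑ B, (componentL A).smulRight ((componentL B).smulRight
    (dChart φ p (Γ (coordField φ B) p (coordField φ A p))))

lemma christoffelMap_apply (Γ : TangentConnection n m E)
    (φ : OpenPartialHomeomorph E (Coord n m)) (p : E) (x y : Coord n m) :
    christoffelMap Γ φ p x y = ∑ A, ∑ B, component A x • component B y •
      dChart φ p (Γ (coordField φ B) p (coordField φ A p)) := by
  simp only [christoffelMap, _root_.sum_apply, ContinuousLinearMap.smulRight_apply,
    _root_.smul_apply, componentL_apply]

lemma component_christoffelMap_basisVec (Γ : TangentConnection n m E)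
    (φ : OpenPartialHomeomorph E (Coord n m)) (p : E) (A B C : Fin n ⊕ Fin m) :
    component C (christoffelMap Γ φ p (basisVec A) (basisVec B)) = christoffel Γ φ A C B p := by
  have h : ∀ A B : Fin n ⊕ Fin m, component A (basisVec B : Coord n m) = if A = B then 1 else 0 := by
    rintro (a | a) (b | b) <;> simp [component, basisVec, Pi.single_apply]
  have h' : ∀ G : Fin n ⊕ Fin m → Fin n ⊕ Fin m → Coord n m, ∑ A', ∑ B',
      component A' (basisVec A : Coord n m) • component B' (basisVec B : Coord n m) • G A' B' =
        G A B := by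
    intro G
    simp only [← Finset.smul_sum]
    simp only [h, ite_smul, one_smul, zero_smul, Finset.sum_ite_eq',
      Finset.mem_univ, if_true]
  rw [christoffelMap_apply]
  exact congrArg (component C) (h' _)

/-- Only the direction `Y` has to be expanded in the coordinate frame: the coefficients `component B
y` are constants outside the connection. -/
lemma dChart_sum_apply (Γ : TangentConnection n m E) {φ : OpenPartialHomeomorph E (Coord n m)}
    (hφ : φ ∈ IsManifold.maximalAtlas 𝓘(ℝ, Coord n m) ∞ E) {p : E} (hp : p ∈ φ.source)
    (Y : TangentSpace 𝓘(ℝ, Coord n m) p) (y : Coord n m) :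
    dChart φ p (∑ B, component B y • Γ (coordField φ B) p Y) =
      christoffelMap Γ φ p (dChart φ p Y) y := by
  rw [christoffelMap_apply, Finset.sum_comm, map_sum]
  refine Finset.sum_congr rfl fun B _ => ?_
  conv_lhs => rw [← sum_component_smul_coordField hφ hp Y]
  simp only [map_sum, map_smul, Finset.smul_sum]
  exact Finset.sum_congr rfl fun A _ => smul_comm _ _ _

/-- The linear map `(u^λ, u^i) ↦ u^i - w^i_λ u^λ`. -/
def contactCoord (w : (Fin n → ℝ) →L[ℝ] (Fin m → ℝ)) : Coord n m →L[ℝ] (Fin m → ℝ) :=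
  ContinuousLinearMap.snd ℝ (Fin n → ℝ) (Fin m → ℝ) -
    w.comp (ContinuousLinearMap.fst ℝ (Fin n → ℝ) (Fin m → ℝ))

lemma contactCoord_apply (w : (Fin n → ℝ) →L[ℝ] (Fin m → ℝ)) (x : Coord n m) :
    contactCoord w x = x.2 - w x.1 := rfl

/-- The coefficients of the connection on `J¹(E, n)`, as a linear map in `du^A`. -/
def jetCoeff (Γ : TangentConnection n m E) (φ : OpenPartialHomeomorph E (Coord n m))
    (θ : Jet n m E) : Coord n m →L[ℝ] (Fin n → ℝ) →L[ℝ] (Fin m → ℝ) :=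
  (ContinuousLinearMap.compL ℝ (Fin n → ℝ) (Coord n m) (Fin m → ℝ)
    (contactCoord (slope φ θ))).comp
    (((ContinuousLinearMap.compL ℝ (Fin n → ℝ) (Coord n m) (Coord n m)).flip
      (graphMap (slope φ θ))).comp (christoffelMap Γ φ θ.pt))

lemma jetCoeff_apply (Γ : TangentConnection n m E) (φ : OpenPartialHomeomorph E (Coord n m))
    (θ : Jet n m E) (x : Coord n m) (a : Fin n → ℝ) : jetCoeff Γ φ θ x a =
      contactCoord (slope φ θ) (christoffelMap Γ φ θ.pt x (graphMap (slope φ θ) a)) := rfl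

lemma contact_pullback_extend (Γ : TangentConnection n m E)
    {φ : OpenPartialHomeomorph E (Coord n m)}
    (hφ : φ ∈ IsManifold.maximalAtlas 𝓘(ℝ, Coord n m) ∞ E) {θ : Jet n m E} (hθ : θ ∈ domain φ)
    (X : TangentSpace 𝓘(ℝ, JetCoord n m) θ) (h : Hor n m E θ) :
    contact φ θ (Γ.pullback proj (fun η => D1 η (FiberBundle.extend (Fin n → ℝ) h η)) θ X) =
      ((dJet φ hφ θ X).2 + jetCoeff Γ φ θ (dJet φ hφ θ X).1) (horMap φ θ h) := by
  rw [contact_pullback_apply Γ hφ hθ (FiberBundle.mdifferentiableAt_extend ..) X,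
    FiberBundle.extend_apply_self, _root_.add_apply, jetCoeff_apply, ← dChart_mfderiv_pt hφ hθ,
    ← dChart_sum_apply Γ hφ hθ.1]
  rfl

/-- The vertical part of a vector tangent to `J¹(E, n)`, in jet coordinates. -/
def vertCoord (L : Coord n m →L[ℝ] (Fin n → ℝ) →L[ℝ] (Fin m → ℝ)) :
    JetCoord n m →L[ℝ] JetCoord n m :=
  (ContinuousLinearMap.inr ℝ (Coord n m) ((Fin n → ℝ) →L[ℝ] (Fin m → ℝ))).comp
    (ContinuousLinearMap.snd ℝ (Coord n m) ((Fin n → ℝ) →L[ℝ] (Fin m → ℝ)) +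
      L.comp (ContinuousLinearMap.fst ℝ (Coord n m) ((Fin n → ℝ) →L[ℝ] (Fin m → ℝ))))

lemma vertCoord_apply (L : Coord n m →L[ℝ] (Fin n → ℝ) →L[ℝ] (Fin m → ℝ)) (x : JetCoord n m) :
    vertCoord L x = (0, x.2 + L x.1) := rfl

/-- A vertical vector corresponds to `∇_X D¹` modulo `H^{1,0}` if and only if it is given in
coordinates by `vertCoord`. -/
lemma forall_verticalIso_eq_iff (Γ : TangentConnection n m E)
    {φ : OpenPartialHomeomorph E (Coord n m)}
    (hφ : φ ∈ IsManifold.maximalAtlas 𝓘(ℝ, Coord n m) ∞ E) {θ : Jet n m E} (hθ : θ ∈ domain φ)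
    {v : TangentSpace 𝓘(ℝ, JetCoord n m) θ}
    (hv : mfderiv 𝓘(ℝ, JetCoord n m) 𝓘(ℝ, Coord n m) (pt : Jet n m E → E) θ v = 0)
    (X : TangentSpace 𝓘(ℝ, JetCoord n m) θ) :
    (∀ h : Hor n m E θ, verticalIso θ v h = omega1 θ (Γ.pullback proj
      (fun η => D1 η (FiberBundle.extend (Fin n → ℝ) h η)) θ X)) ↔
      dJet φ hφ θ v = vertCoord (jetCoeff Γ φ θ) (dJet φ hφ θ X) := by
  have hv1 := (mfderiv_pt_eq_zero_iff hφ hθ v).1 hv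
  simp only [verticalIso_apply Γ θ hv, omega1_eq_iff hφ hθ, contact_pullback_extend Γ hφ hθ]
  -- Verticality removes the Christoffel term on the side of `v`, leaving an equation between two
  -- linear maps evaluated on `horMap φ θ h`.
  rw [hv1, map_zero, add_zero, vertCoord_apply]
  constructor
  · intro h
    refine Prod.ext hv1 ?_
    ext1 a
    -- On the domain of the jet chart the horizontal coordinates of vectors of the plane fill `ℝⁿ`,
    -- so the two linear maps agree.
    obtain ⟨h', rfl⟩ := hθ.2.surjective a
    exact h h'
  · intro h h'
    rw [h]

end Jet

/-! ### Smoothness of fields of tangent endomorphisms. -/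

section TangentEndomorphism

variable {F : Type*} [NormedAddCommGroup F] [NormedSpace ℝ F]
  {M : Type*} [TopologicalSpace M] [ChartedSpace F M] [IsManifold 𝓘(ℝ, F) 1 M]

/-- A field of endomorphisms of the tangent spaces is smooth if it is so in the preferred chart. -/
lemma contMDiffAt_tangentSpace_endomorphism {x : M} {k : ℕ∞ω}
    {A : Π y : M, TangentSpace 𝓘(ℝ, F) y →L[ℝ] TangentSpace 𝓘(ℝ, F) y} {C : M → F →L[ℝ] F}
    (hC : ContMDiffAt 𝓘(ℝ, F) 𝓘(ℝ, F →L[ℝ] F) k C x)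
    (h : ∀ᶠ y in 𝓝 x, ∀ Z : TangentSpace 𝓘(ℝ, F) y,
      mfderiv 𝓘(ℝ, F) 𝓘(ℝ, F) (chartAt F x) y (A y Z) =
        C y (mfderiv 𝓘(ℝ, F) 𝓘(ℝ, F) (chartAt F x) y Z)) :
    ContMDiffAt 𝓘(ℝ, F) (𝓘(ℝ, F).prod 𝓘(ℝ, F →L[ℝ] F)) k
      (fun y => TotalSpace.mk' (F →L[ℝ] F)
        (E := fun y => TangentSpace 𝓘(ℝ, F) y →L[ℝ] TangentSpace 𝓘(ℝ, F) y) y (A y)) x := by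
  rw [contMDiffAt_section]
  refine hC.congr_of_eventuallyEq ?_
  filter_upwards [h, (chartAt F x).open_source.mem_nhds (mem_chart_source F x)] with y hy hyx
  have hy1 : y ∈ (trivializationAt F (TangentSpace 𝓘(ℝ, F) : M → Type _) x).baseSet := hyx
  rw [hom_trivializationAt_apply]
  refine (inCoordinates_eq hy1 hy1).trans ?_
  refine ContinuousLinearMap.ext fun v => ?_
  obtain ⟨X, rfl⟩ := ((trivializationAt F
    (TangentSpace 𝓘(ℝ, F) : M → Type _) x).continuousLinearEquivAt ℝ y hy1).surjective v
  simp only [ContinuousLinearMap.comp_apply, ContinuousLinearEquiv.coe_coe,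
    ContinuousLinearEquiv.symm_apply_apply]
  have key : ∀ Z : TangentSpace 𝓘(ℝ, F) y, (trivializationAt F
      (TangentSpace 𝓘(ℝ, F) : M → Type _) x).continuousLinearEquivAt ℝ y hy1 Z =
        mfderiv 𝓘(ℝ, F) 𝓘(ℝ, F) (chartAt F x) y Z :=
    fun Z => trivializationAt_tangentSpace_apply hyx Z
  rw [key, key]
  exact hy X

end TangentEndomorphism

namespace Jet

variable {n m : ℕ} {E : Type*} [TopologicalSpace E] [ChartedSpace (Coord n m) E]
  [IsManifold 𝓘(ℝ, Coord n m) ∞ E]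

/-! ### Smoothness of the Christoffel symbols -/

/-- Smoothness of a section refers to the preferred chart at `p`. Passing to `φ` multiplies by the
derivative of the change of charts, which is smooth. -/
lemma contMDiffAt_dChart_section {φ : OpenPartialHomeomorph E (Coord n m)}
    (hφ : φ ∈ IsManifold.maximalAtlas 𝓘(ℝ, Coord n m) ∞ E) {p : E} (hp : p ∈ φ.source)
    {s : Π q : E, TangentSpace 𝓘(ℝ, Coord n m) q}
    (hs : ContMDiffAt 𝓘(ℝ, Coord n m) (𝓘(ℝ, Coord n m).prod 𝓘(ℝ, Coord n m)) ∞
      (fun q => TotalSpace.mk' (Coord n m) q (s q)) p) :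
    ContMDiffAt 𝓘(ℝ, Coord n m) 𝓘(ℝ, Coord n m) ∞ (fun q => dChart φ q (s q)) p := by
  rw [contMDiffAt_section] at hs
  set c := chartAt (Coord n m) p
  have hc : c ∈ IsManifold.maximalAtlas 𝓘(ℝ, Coord n m) ∞ E :=
    IsManifold.chart_mem_maximalAtlas p
  have hcp : p ∈ c.source := mem_chart_source _ _
  have hev : (fun q => dChart φ q (s q)) =ᶠ[𝓝 p] fun q => fderiv ℝ (φ ∘ c.symm) (c q)
      (trivializationAt (Coord n m) (TangentSpace 𝓘(ℝ, Coord n m) : E → Type _) p ⟨q, s q⟩).2 := by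
    filter_upwards [φ.open_source.mem_nhds hp, c.open_source.mem_nhds hcp] with q hq hqc
    rw [trivializationAt_tangentSpace_apply hqc]
    exact congrArg (fun L => L (s q)) (dChart_trans hc hφ hqc hq)
  refine ContMDiffAt.congr_of_eventuallyEq ?_ hev
  have h1 : ContDiffOn ℝ ∞ (φ ∘ c.symm) (c.symm.trans φ).source := by
    rw [← contMDiffOn_iff_contDiffOn]
    refine (contMDiffOn_of_mem_maximalAtlas hφ).comp
      ((contMDiffOn_symm_of_mem_maximalAtlas hc).mono ?_) ?_
    · intro x hx; exact hx.1
    · intro x hx; exact hx.2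
  have h2 := h1.fderiv_of_isOpen (m := ∞) (c.symm.trans φ).open_source (by simp)
  have hmem : c p ∈ (c.symm.trans φ).source := by
    refine ⟨c.map_source hcp, ?_⟩
    change c.symm (c p) ∈ φ.source
    rwa [c.left_inv hcp]
  have h3 : ContMDiffAt 𝓘(ℝ, Coord n m) 𝓘(ℝ, Coord n m →L[ℝ] Coord n m) ∞
      (fun q => fderiv ℝ (φ ∘ c.symm) (c q)) p :=
    ((h2.contDiffAt ((c.symm.trans φ).open_source.mem_nhds hmem)).contMDiffAt).comp p
      (contMDiffAt_of_mem_maximalAtlas hc hcp)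
  exact h3.clm_apply hs

/-- Smoothness of `Γ` is a statement about globally smooth sections, whereas a coordinate field is
smooth only over its chart. A bump function equal to one near `p` makes it global, and a covariant
derivative depends only on the germ of the section. -/
lemma contMDiffAt_cov_coordField [T2Space E] (Γ : TangentConnection n m E)
    [Γ.ContMDiffCovariantDerivative ∞] {φ : OpenPartialHomeomorph E (Coord n m)}
    (hφ : φ ∈ IsManifold.maximalAtlas 𝓘(ℝ, Coord n m) ∞ E) {p : E} (hp : p ∈ φ.source)
    (B : Fin n ⊕ Fin m) :
    ContMDiffAt 𝓘(ℝ, Coord n m) (𝓘(ℝ, Coord n m).prod 𝓘(ℝ, Coord n m →L[ℝ] Coord n m)) ∞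
      (fun q => TotalSpace.mk' (Coord n m →L[ℝ] Coord n m) (E := fun q =>
        TangentSpace 𝓘(ℝ, Coord n m) q →L[ℝ] TangentSpace 𝓘(ℝ, Coord n m) q)
        q (Γ (coordField φ B) q)) p := by
  obtain ⟨ρ, -, hρ⟩ := (SmoothBumpFunction.nhds_basis_tsupport (I := 𝓘(ℝ, Coord n m)) p).mem_iff.1
    (φ.open_source.mem_nhds hp)
  have h1 : ContMDiff 𝓘(ℝ, Coord n m) (𝓘(ℝ, Coord n m).prod 𝓘(ℝ, Coord n m)) ∞
      (fun q => TotalSpace.mk' (Coord n m) q (((ρ : E → ℝ) • coordField φ B) q)) :=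
    ContMDiffOn.smul_section_of_tsupport ρ.contMDiff.contMDiffOn φ.open_source hρ
      (contMDiffOn_coordField hφ B)
  have h2 := (CovariantDerivative.ContMDiffCovariantDerivative.contMDiff (cov := Γ) (k := ∞)).contMDiff
    (σ := (ρ : E → ℝ) • coordField φ B) (by simpa using! h1.contMDiffOn)
  refine (h2.contMDiffAt Filter.univ_mem).congr_of_eventuallyEq ?_
  -- Germs must agree at every `q` near `p`, hence `ρ = 1` is needed on a neighbourhood of each such
  -- `q`.
  filter_upwards [ρ.eventuallyEq_one.eventually_nhds, φ.open_source.mem_nhds hp] with q hq hqφ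
  congr 1
  refine Γ.isCovariantDerivativeOnUniv.congr_of_eventuallyEq
    (mdifferentiableAt_coordField hφ B hqφ) (h1.mdifferentiableAt (by simp)) Filter.univ_mem ?_
  filter_upwards [hq] with q' hq'
  simp [hq']

lemma contMDiffAt_christoffelMap [T2Space E] (Γ : TangentConnection n m E)
    [Γ.ContMDiffCovariantDerivative ∞] {φ : OpenPartialHomeomorph E (Coord n m)}
    (hφ : φ ∈ IsManifold.maximalAtlas 𝓘(ℝ, Coord n m) ∞ E) {p : E} (hp : p ∈ φ.source) :
    ContMDiffAt 𝓘(ℝ, Coord n m) 𝓘(ℝ, Coord n m →L[ℝ] Coord n m →L[ℝ] Coord n m) ∞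
      (christoffelMap Γ φ) p := by
  have h1 : ∀ A B, ContMDiffAt 𝓘(ℝ, Coord n m) 𝓘(ℝ, Coord n m) ∞
      (fun q => dChart φ q (Γ (coordField φ B) q (coordField φ A q))) p := fun A B =>
    contMDiffAt_dChart_section hφ hp ((contMDiffAt_cov_coordField Γ hφ hp B).clm_bundle_apply
      ((contMDiffOn_coordField hφ A).contMDiffAt (φ.open_source.mem_nhds hp)))
  -- Each summand is a fixed continuous linear map applied to a smooth vector-valued function.
  have h2 : christoffelMap Γ φ = fun q => ∑ A, ∑ B,
      ((ContinuousLinearMap.smulRightL ℝ (Coord n m) (Coord n m →L[ℝ] Coord n m) (componentL A)).comp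
        (ContinuousLinearMap.smulRightL ℝ (Coord n m) (Coord n m) (componentL B)))
        (dChart φ q (Γ (coordField φ B) q (coordField φ A q))) := rfl
  rw [h2]
  exact contMDiffAt_finsetSum fun A _ => contMDiffAt_finsetSum fun B _ =>
    (ContinuousLinearMap.contMDiff _).contMDiffAt.comp p (h1 A B)

lemma contMDiffAt_jetCoeff [T2Space E] (Γ : TangentConnection n m E)
    [Γ.ContMDiffCovariantDerivative ∞] {φ : OpenPartialHomeomorph E (Coord n m)}
    (hφ : φ ∈ IsManifold.maximalAtlas 𝓘(ℝ, Coord n m) ∞ E) {θ : Jet n m E} (hθ : θ ∈ domain φ) :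
    ContMDiffAt 𝓘(ℝ, JetCoord n m)
      𝓘(ℝ, Coord n m →L[ℝ] (Fin n → ℝ) →L[ℝ] (Fin m → ℝ)) ∞ (jetCoeff Γ φ) θ := by
  have hw : ContMDiffAt 𝓘(ℝ, JetCoord n m) 𝓘(ℝ, (Fin n → ℝ) →L[ℝ] (Fin m → ℝ)) ∞
      (fun η : Jet n m E => slope φ η) θ :=
    contDiff_snd.contMDiff.contMDiffAt.comp θ
      (contMDiffAt_of_mem_maximalAtlas (jetChart_mem_maximalAtlas hφ) hθ)
  have hK : ContMDiffAt 𝓘(ℝ, JetCoord n m) 𝓘(ℝ, Coord n m →L[ℝ] (Fin m → ℝ)) ∞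
      (fun η : Jet n m E => contactCoord (slope φ η)) θ :=
    contMDiffAt_const.sub (hw.clm_comp contMDiffAt_const)
  have hg : ContMDiffAt 𝓘(ℝ, JetCoord n m) 𝓘(ℝ, (Fin n → ℝ) →L[ℝ] Coord n m) ∞
      (fun η : Jet n m E => graphMap (slope φ η)) θ := by
    have : (fun η : Jet n m E => graphMap (slope φ η)) = fun η =>
        ContinuousLinearMap.inl ℝ (Fin n → ℝ) (Fin m → ℝ) +
        (ContinuousLinearMap.inr ℝ (Fin n → ℝ) (Fin m → ℝ)).comp (slope φ η) := by
      funext η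
      ext v : 1
      simp [graphMap_apply]
    rw [this]
    exact contMDiffAt_const.add (contMDiffAt_const.clm_comp hw)
  have hC : ContMDiffAt 𝓘(ℝ, JetCoord n m) 𝓘(ℝ, Coord n m →L[ℝ] Coord n m →L[ℝ] Coord n m) ∞
      (fun η : Jet n m E => christoffelMap Γ φ η.pt) θ :=
    (contMDiffAt_christoffelMap Γ hφ hθ.1).comp θ contMDiff_pt.contMDiffAt
  exact ((ContinuousLinearMap.contMDiff _).contMDiffAt.comp θ hK).clm_comp
    (((ContinuousLinearMap.contMDiff _).contMDiffAt.comp θ hg).clm_comp hC)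

/-! ### The associated connection -/

/-- The vertical valued form of the connection associated with `Γ`, read in a jet chart. -/
def vertForm (Γ : TangentConnection n m E) (φ : OpenPartialHomeomorph E (Coord n m))
    (hφ : φ ∈ IsManifold.maximalAtlas 𝓘(ℝ, Coord n m) ∞ E) (θ : Jet n m E) :
    TangentSpace 𝓘(ℝ, JetCoord n m) θ →L[ℝ] TangentSpace 𝓘(ℝ, JetCoord n m) θ :=
  (dJet φ hφ θ).inverse.comp ((vertCoord (jetCoeff Γ φ θ)).comp (dJet φ hφ θ))

lemma dJet_vertForm (Γ : TangentConnection n m E) {φ : OpenPartialHomeomorph E (Coord n m)}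
    (hφ : φ ∈ IsManifold.maximalAtlas 𝓘(ℝ, Coord n m) ∞ E) {θ : Jet n m E} (hθ : θ ∈ domain φ)
    (X : TangentSpace 𝓘(ℝ, JetCoord n m) θ) :
    dJet φ hφ θ (vertForm Γ φ hφ θ X) = vertCoord (jetCoeff Γ φ θ) (dJet φ hφ θ X) :=
  (isInvertible_dJet hφ hθ).self_apply_inverse _

lemma vertForm_isVertical (Γ : TangentConnection n m E) {φ : OpenPartialHomeomorph E (Coord n m)}
    (hφ : φ ∈ IsManifold.maximalAtlas 𝓘(ℝ, Coord n m) ∞ E) {θ : Jet n m E} (hθ : θ ∈ domain φ)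
    (X : TangentSpace 𝓘(ℝ, JetCoord n m) θ) :
    mfderiv 𝓘(ℝ, JetCoord n m) 𝓘(ℝ, Coord n m) (pt : Jet n m E → E) θ
      (vertForm Γ φ hφ θ X) = 0 := by
  rw [mfderiv_pt_eq_zero_iff hφ hθ, dJet_vertForm Γ hφ hθ]
  rfl

/-- The form `vertForm` does not depend on the chart. -/
lemma vertForm_eq (Γ : TangentConnection n m E) {φ ψ : OpenPartialHomeomorph E (Coord n m)}
    (hφ : φ ∈ IsManifold.maximalAtlas 𝓘(ℝ, Coord n m) ∞ E)
    (hψ : ψ ∈ IsManifold.maximalAtlas 𝓘(ℝ, Coord n m) ∞ E) {θ : Jet n m E}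
    (hθ : θ ∈ domain φ) (hθ' : θ ∈ domain ψ) : vertForm Γ φ hφ θ = vertForm Γ ψ hψ θ := by
  ext1 X
  apply (isInvertible_dJet hφ hθ).injective
  have hv := vertForm_isVertical Γ hψ hθ' X
  rw [dJet_vertForm Γ hφ hθ]
  -- The form built with `ψ` satisfies the equation between classes modulo `H^{1,0}`, which mentions
  -- no chart. Read in `φ`, that equation determines its `φ`-coordinates.
  exact ((forall_verticalIso_eq_iff Γ hφ hθ hv X).1
    ((forall_verticalIso_eq_iff Γ hψ hθ' hv X).2 (dJet_vertForm Γ hψ hθ' X))).symm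

/-- The connection on `π₁₀ : J¹(E, n) → E` associated with a linear connection on `TE`. -/
def associated [T2Space E] (Γ : TangentConnection n m E) [Γ.ContMDiffCovariantDerivative ∞] :
    JetConnection n m E where
  vert θ := vertForm Γ _ (exists_mem_domain θ).choose_spec.1 θ
  vert_isVertical θ X := vertForm_isVertical Γ _ (exists_mem_domain θ).choose_spec.2 X
  vert_of_isVertical θ X hX := by
    have hθ := (exists_mem_domain θ).choose_spec.2
    have hφ := (exists_mem_domain θ).choose_spec.1
    rw [mfderiv_pt_eq_zero_iff hφ hθ] at hX
    apply (isInvertible_dJet hφ hθ).injective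
    rw [dJet_vertForm Γ hφ hθ, vertCoord_apply, hX, map_zero, add_zero]
    exact Prod.ext hX.symm rfl
  contMDiff_vert := by
    intro θ
    -- The preferred chart of `J¹(E, n)` at `θ` is itself a jet chart. The chart used to define
    -- `vert` is chosen separately at each point, so independence of the chart is needed to replace
    -- it by the fixed `φ` near `θ`.
    obtain ⟨φ, hφ, hc⟩ := exists_of_mem_atlas (chart_mem_atlas (JetCoord n m) θ)
    have hθ : θ ∈ domain φ := by
      have := mem_chart_source (JetCoord n m) θ
      rwa [hc] at this
    refine contMDiffAt_tangentSpace_endomorphism (C := fun η => vertCoord (jetCoeff Γ φ η))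
      (contMDiffAt_const.clm_comp
        (contMDiffAt_const.add ((contMDiffAt_jetCoeff Γ hφ hθ).clm_comp contMDiffAt_const))) ?_
    filter_upwards [(isOpen_domain hφ).mem_nhds hθ] with η hη Z
    rw [hc, vertForm_eq Γ _ hφ (exists_mem_domain η).choose_spec.2 hη]
    exact dJet_vertForm Γ hφ hη Z

lemma dJet_associated_vert [T2Space E] (Γ : TangentConnection n m E)
    [Γ.ContMDiffCovariantDerivative ∞] {φ : OpenPartialHomeomorph E (Coord n m)}
    (hφ : φ ∈ IsManifold.maximalAtlas 𝓘(ℝ, Coord n m) ∞ E) {θ : Jet n m E} (hθ : θ ∈ domain φ)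
    (X : TangentSpace 𝓘(ℝ, JetCoord n m) θ) :
    dJet φ hφ θ ((associated Γ).vert θ X) =
      vertCoord (jetCoeff Γ φ θ) (dJet φ hφ θ X) := by
  rw [← dJet_vertForm Γ hφ hθ]
  exact congrArg (fun L => dJet φ hφ θ (L X))
    (vertForm_eq Γ _ hφ (exists_mem_domain θ).choose_spec.2 hθ)

/-- In a jet chart the equation at each `θ` and `X` prescribes the coordinates of `Δ.vert θ X`, and
no trace of `Ξ` remains in them. Existence, uniqueness and independence of `Ξ` come together. -/
lemma isInduced_iff [T2Space E] (Γ : TangentConnection n m E) [Γ.ContMDiffCovariantDerivative ∞]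
    (Ξ : HorDualConnection n m E) (Δ : JetConnection n m E) :
    IsInduced Γ Ξ Δ ↔ Δ = associated Γ := by
  have h1 : IsInduced Γ Ξ Δ ↔ ∀ θ X, Δ.vert θ X = (associated Γ).vert θ X := by
    refine forall_congr' fun θ => forall_congr' fun X => ?_
    obtain ⟨φ, hφ, hθ⟩ := exists_mem_domain θ
    rw [← (isInvertible_dJet hφ hθ).injective.eq_iff, dJet_associated_vert Γ hφ hθ,
      ← forall_verticalIso_eq_iff Γ hφ hθ (Δ.vert_isVertical θ X) X]
    simp only [← inducedForm_apply Γ Ξ]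
    exact ContinuousLinearMap.ext_iff
  rw [h1]
  constructor
  · intro h
    have hv : Δ.vert = (associated Γ).vert := funext fun θ => ContinuousLinearMap.ext (h θ)
    -- All fields other than `vert` are propositions, so equality of the vertical forms suffices.
    cases Δ
    cases hA : associated Γ
    simp only [hA] at hv
    cases hv
    rfl
  · rintro rfl θ X
    rfl

/-- The Christoffel symbols of the associated connection. -/
lemma jetChristoffel_associated [T2Space E] (Γ : TangentConnection n m E)
    [Γ.ContMDiffCovariantDerivative ∞] (φ : OpenPartialHomeomorph E (Coord n m))
    (hφ : φ ∈ IsManifold.maximalAtlas 𝓘(ℝ, Coord n m) ∞ E) (θ : Jet n m E) (hθ : θ ∈ domain φ)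
    (A : Fin n ⊕ Fin m) (k : Fin m) (ξ : Fin n) :
    jetChristoffel (associated Γ) φ hφ A k ξ θ =
      christoffel Γ φ A (.inr k) (.inl ξ) θ.pt
      + ∑ i : Fin m, christoffel Γ φ A (.inr k) (.inr i) θ.pt * uCoord φ i ξ θ
      - ∑ β : Fin n, uCoord φ k β θ *
          (christoffel Γ φ A (.inl β) (.inl ξ) θ.pt
            + ∑ i : Fin m, christoffel Γ φ A (.inl β) (.inr i) θ.pt * uCoord φ i ξ θ) := by
  have h1 : jetChristoffel (associated Γ) φ hφ A k ξ θ =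
      jetCoeff Γ φ θ (basisVec A) (Pi.single ξ 1) k := by
    refine (congrArg (fun x : JetCoord n m => x.2 (Pi.single ξ 1) k)
      (dJet_associated_vert Γ hφ hθ _)).trans ?_
    rw [(isInvertible_dJet hφ hθ).self_apply_inverse, vertCoord_apply]
    simp
  -- The spanning vector `∂_ξ + u^i_ξ ∂_i` of the plane.
  have h2 : graphMap (slope φ θ) (Pi.single ξ 1) = (basisVec (.inl ξ) : Coord n m) +
      ∑ i : Fin m, uCoord φ i ξ θ • basisVec (.inr i) := by
    have := sum_component_smul_basisVec (graphMap (slope φ θ) (Pi.single ξ 1))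
    rw [Fintype.sum_sum_type] at this
    rw [← this]
    congr 1
    · simp [component, graphMap_apply, Pi.single_apply]
  have h3 : ∀ C, component C (christoffelMap Γ φ θ.pt (basisVec A)
      (graphMap (slope φ θ) (Pi.single ξ 1))) = christoffel Γ φ A C (.inl ξ) θ.pt +
        ∑ i : Fin m, christoffel Γ φ A C (.inr i) θ.pt * uCoord φ i ξ θ := by
    intro C
    rw [h2]
    simp only [map_add, map_sum, map_smul, ← componentL_apply, smul_eq_mul]
    simp only [componentL_apply, component_christoffelMap_basisVec, mul_comm]
  rw [h1, jetCoeff_apply, contactCoord_apply, ← h3, Pi.sub_apply]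
  congr 1
  -- The subtracted term is the slope applied to the horizontal components of the Christoffel
  -- vector; its matrix entries are the `u^k_β`.
  have h4 : ∀ x : Fin n → ℝ, slope φ θ x k = ∑ β, uCoord φ k β θ * x β := by
    intro x
    conv_lhs => rw [pi_eq_sum_univ' x]
    simp [uCoord, mul_comm]
  rw [h4]
  exact Finset.sum_congr rfl fun β _ => by rw [← h3]; rfl

end Jet

namespace Jet

variable {n m : ℕ} {E : Type*} [TopologicalSpace E] [ChartedSpace (Coord n m) E]
  [IsManifold 𝓘(ℝ, Coord n m) ∞ E]
  {E' : Type*} [TopologicalSpace E'] [ChartedSpace (Coord n m) E']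
  [IsManifold 𝓘(ℝ, Coord n m) ∞ E']

/-! ### Naturality -/

/-- A chart of the target of a local diffeomorphism induces a chart of the source. -/
lemma exists_chart_comp {f : E → E'}
    (hf : IsLocalDiffeomorph 𝓘(ℝ, Coord n m) 𝓘(ℝ, Coord n m) ∞ f) {p : E}
    {ψ : OpenPartialHomeomorph E' (Coord n m)}
    (hψ : ψ ∈ IsManifold.maximalAtlas 𝓘(ℝ, Coord n m) ∞ E') (hp : f p ∈ ψ.source) :
    ∃ φ ∈ IsManifold.maximalAtlas 𝓘(ℝ, Coord n m) ∞ E, p ∈ φ.source ∧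
      ∀ q ∈ φ.source, f q ∈ ψ.source ∧ φ q = ψ (f q) := by
  -- `Φ` is a diffeomorphism between open sets that agrees with `f` near `p`. The required chart is
  -- `ψ ∘ Φ`.
  obtain ⟨Φ, hΦp, hΦ⟩ := hf p
  refine ⟨Φ.toOpenPartialHomeomorph.trans ψ, ?_, ⟨hΦp, ?_⟩, ?_⟩
  · apply OpenPartialHomeomorph.mem_maximalAtlas_of_contMDiffOn
    · exact (contMDiffOn_of_mem_maximalAtlas hψ).comp (Φ.contMDiffOn_toFun.mono fun x hx => hx.1)
        fun x hx => hx.2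
    · exact Φ.contMDiffOn_invFun.comp ((contMDiffOn_symm_of_mem_maximalAtlas hψ).mono
        fun x hx => hx.1) fun x hx => hx.2
  · change Φ p ∈ ψ.source
    rwa [← hΦ hΦp]
  · rintro q ⟨hq, hq'⟩
    have h1 : f q = Φ q := hΦ hq
    exact ⟨by rw [h1]; exact hq', by rw [h1]; rfl⟩

variable {f : E → E'} {φ : OpenPartialHomeomorph E (Coord n m)}
  {ψ : OpenPartialHomeomorph E' (Coord n m)}

lemma dChart_comp (hf : IsLocalDiffeomorph 𝓘(ℝ, Coord n m) 𝓘(ℝ, Coord n m) ∞ f)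
    (hψ : ψ ∈ IsManifold.maximalAtlas 𝓘(ℝ, Coord n m) ∞ E')
    (h : ∀ q ∈ φ.source, f q ∈ ψ.source ∧ φ q = ψ (f q)) {q : E} (hq : q ∈ φ.source) :
    dChart φ q = (dChart ψ (f q)).comp (mfderiv 𝓘(ℝ, Coord n m) 𝓘(ℝ, Coord n m) f q) := by
  have h1 : φ =ᶠ[𝓝 q] ψ ∘ f := by
    filter_upwards [φ.open_source.mem_nhds hq] with q' hq' using (h q' hq').2
  have h2 : MDifferentiableAt 𝓘(ℝ, Coord n m) 𝓘(ℝ, Coord n m) ψ (f q) :=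
    (contMDiffAt_of_mem_maximalAtlas hψ (h q hq).1).mdifferentiableAt (by simp)
  exact h1.mfderiv_eq.trans (mfderiv_comp q h2 ((hf q).mdifferentiableAt (by simp)))

lemma isInvertible_mfderiv (hf : IsLocalDiffeomorph 𝓘(ℝ, Coord n m) 𝓘(ℝ, Coord n m) ∞ f) (q : E) :
    (mfderiv 𝓘(ℝ, Coord n m) 𝓘(ℝ, Coord n m) f q).IsInvertible :=
  ⟨(hf q).mfderivToContinuousLinearEquiv (by simp), rfl⟩

lemma mfderiv_coordField (hf : IsLocalDiffeomorph 𝓘(ℝ, Coord n m) 𝓘(ℝ, Coord n m) ∞ f)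
    (hφ : φ ∈ IsManifold.maximalAtlas 𝓘(ℝ, Coord n m) ∞ E)
    (hψ : ψ ∈ IsManifold.maximalAtlas 𝓘(ℝ, Coord n m) ∞ E')
    (h : ∀ q ∈ φ.source, f q ∈ ψ.source ∧ φ q = ψ (f q)) {q : E} (hq : q ∈ φ.source)
    (A : Fin n ⊕ Fin m) :
    mfderiv 𝓘(ℝ, Coord n m) 𝓘(ℝ, Coord n m) f q (coordField φ A q) = coordField ψ A (f q) := by
  apply (isInvertible_dChart hψ (h q hq).1).injective
  have h1 := congrArg (fun L => L (coordField φ A q)) (dChart_comp hf hψ h hq)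
  refine h1.symm.trans ?_
  rw [coordField, coordField, (isInvertible_dChart hφ hq).self_apply_inverse,
    (isInvertible_dChart hψ (h q hq).1).self_apply_inverse]

/-- On the source of `φ` the coordinate field of `φ` is the pull-back of that of `ψ`. Locality of
`Γ` allows this pull-back to be put in its place, and then the hypothesis on `f` applies to the
field of `ψ`. -/
lemma christoffelMap_comp (hf : IsLocalDiffeomorph 𝓘(ℝ, Coord n m) 𝓘(ℝ, Coord n m) ∞ f)
    {Γ : TangentConnection n m E} {Γ' : TangentConnection n m E'} (hΓ : Carries f Γ Γ')
    (hφ : φ ∈ IsManifold.maximalAtlas 𝓘(ℝ, Coord n m) ∞ E)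
    (hψ : ψ ∈ IsManifold.maximalAtlas 𝓘(ℝ, Coord n m) ∞ E')
    (h : ∀ q ∈ φ.source, f q ∈ ψ.source ∧ φ q = ψ (f q)) {q : E} (hq : q ∈ φ.source) :
    christoffelMap Γ φ q = christoffelMap Γ' ψ (f q) := by
  unfold christoffelMap
  refine Finset.sum_congr rfl fun A _ => Finset.sum_congr rfl fun B _ => ?_
  congr 2
  have hev : ∀ᶠ q' in 𝓝 q, coordField φ B q' = VectorField.mpullback 𝓘(ℝ, Coord n m)
      𝓘(ℝ, Coord n m) f (coordField ψ B) q' := by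
    filter_upwards [φ.open_source.mem_nhds hq] with q' hq'
    rw [VectorField.mpullback_apply, ← mfderiv_coordField hf hφ hψ h hq',
      (isInvertible_mfderiv hf q').inverse_apply_self]
  have hd := mdifferentiableAt_coordField hφ B hq
  have hcov : Γ (coordField φ B) q = Γ (VectorField.mpullback 𝓘(ℝ, Coord n m)
      𝓘(ℝ, Coord n m) f (coordField ψ B)) q :=
    Γ.isCovariantDerivativeOnUniv.congr_of_eventuallyEq hd
      (hd.congr_of_eventuallyEq (hev.mono fun q' hq' =>
        congrArg (TotalSpace.mk' (Coord n m) q') hq'.symm)) Filter.univ_mem hev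
  have h1 := hΓ (coordField ψ B) q (coordField φ A q)
    (mdifferentiableAt_coordField hψ B (h q hq).1)
  rw [mfderiv_coordField hf hφ hψ h hq] at h1
  rw [← h1, hcov]
  exact congrArg (fun L => L (Γ (VectorField.mpullback 𝓘(ℝ, Coord n m) 𝓘(ℝ, Coord n m) f
    (coordField ψ B)) q (coordField φ A q))) (dChart_comp hf hψ h hq)

/-- `Tf` carries the frame of the plane given by `φ` to a frame with the same coordinates in `ψ`, so
both planes are the graph of one linear map. -/
lemma map_mem_domain (hf : IsLocalDiffeomorph 𝓘(ℝ, Coord n m) 𝓘(ℝ, Coord n m) ∞ f)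
    (hφ : φ ∈ IsManifold.maximalAtlas 𝓘(ℝ, Coord n m) ∞ E)
    (hψ : ψ ∈ IsManifold.maximalAtlas 𝓘(ℝ, Coord n m) ∞ E')
    (h : ∀ q ∈ φ.source, f q ∈ ψ.source ∧ φ q = ψ (f q)) {η : Jet n m E} (hη : η ∈ domain φ) :
    map hf η ∈ domain ψ ∧ slope ψ (map hf η) = slope φ η := by
  have h1 := mem_domain_of_frame (φ := ψ) (θ := map hf η) (h _ hη.1).1
    ((mfderiv 𝓘(ℝ, Coord n m) 𝓘(ℝ, Coord n m) f η.pt).comp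
      ((dChart φ η.pt).inverse.comp (graphMap (slope φ η)))) ?_ (a := .id ℝ _) (b := slope φ η)
    ⟨.refl ℝ _, rfl⟩ ?_
  · refine ⟨h1.1, h1.2.trans ?_⟩
    ext
    simp
  · change η.plane.map _ = _
    conv_lhs => rw [range_inverse_graphMap hφ hη]
    exact (LinearMap.range_comp _ _).symm
  · intro v
    have h2 := congrArg (fun L => L ((dChart φ η.pt).inverse (graphMap (slope φ η) v)))
      (dChart_comp hf hψ h hη.1)
    refine h2.symm.trans ?_
    exact (isInvertible_dChart hφ hη.1).self_apply_inverse _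

lemma mem_domain_of_map (hf : IsLocalDiffeomorph 𝓘(ℝ, Coord n m) 𝓘(ℝ, Coord n m) ∞ f)
    (hψ : ψ ∈ IsManifold.maximalAtlas 𝓘(ℝ, Coord n m) ∞ E')
    (h : ∀ q ∈ φ.source, f q ∈ ψ.source ∧ φ q = ψ (f q)) {η : Jet n m E} (hη : η.pt ∈ φ.source)
    (hη' : map hf η ∈ domain ψ) : η ∈ domain φ := by
  refine ⟨hη, (horMap_isInvertible_iff φ η).2 ?_⟩
  have key : ∀ x : η.plane, horMap φ η x = horMap ψ (map hf η)
      ⟨mfderiv 𝓘(ℝ, Coord n m) 𝓘(ℝ, Coord n m) f η.pt x, x, x.2, rfl⟩ := fun x =>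
    congrArg (fun L => (L (x : TangentSpace 𝓘(ℝ, Coord n m) η.pt)).1) (dChart_comp hf hψ h hη)
  intro x y hxy
  rw [key, key] at hxy
  exact Subtype.ext ((isInvertible_mfderiv hf η.pt).injective
    (congrArg Subtype.val (hη'.2.injective hxy)))

/-- In matching jet charts `J¹f` is the identity. This also gives its differentiability, by writing
it locally as one chart followed by the inverse of the other. -/
lemma dJet_mfderiv_map (hf : IsLocalDiffeomorph 𝓘(ℝ, Coord n m) 𝓘(ℝ, Coord n m) ∞ f)
    (hφ : φ ∈ IsManifold.maximalAtlas 𝓘(ℝ, Coord n m) ∞ E)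
    (hψ : ψ ∈ IsManifold.maximalAtlas 𝓘(ℝ, Coord n m) ∞ E')
    (h : ∀ q ∈ φ.source, f q ∈ ψ.source ∧ φ q = ψ (f q)) {θ : Jet n m E} (hθ : θ ∈ domain φ)
    (X : TangentSpace 𝓘(ℝ, JetCoord n m) θ) :
    dJet ψ hψ (map hf θ)
      (mfderiv 𝓘(ℝ, JetCoord n m) 𝓘(ℝ, JetCoord n m) (map hf) θ X) = dJet φ hφ θ X := by
  have h1 : ∀ η ∈ domain φ, jetChart ψ hψ (map hf η) = jetChart φ hφ η := fun η hη =>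
    Prod.ext (h _ hη.1).2.symm (map_mem_domain hf hφ hψ h hη).2
  have h2 : map hf =ᶠ[𝓝 θ] (jetChart ψ hψ).symm ∘ jetChart φ hφ := by
    filter_upwards [(isOpen_domain hφ).mem_nhds hθ] with η hη
    rw [comp_apply, ← h1 η hη]
    exact ((jetChart ψ hψ).left_inv (map_mem_domain hf hφ hψ h hη).1).symm
  have hm := (map_mem_domain hf hφ hψ h hθ).1
  have h3 : MDifferentiableAt 𝓘(ℝ, JetCoord n m) 𝓘(ℝ, JetCoord n m) (jetChart ψ hψ).symm
      (jetChart φ hφ θ) := by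
    rw [← h1 θ hθ]
    exact (contMDiffAt_symm_of_mem_maximalAtlas (jetChart_mem_maximalAtlas hψ)
      ((jetChart ψ hψ).map_source hm)).mdifferentiableAt (by simp)
  have h4 : MDifferentiableAt 𝓘(ℝ, JetCoord n m) 𝓘(ℝ, JetCoord n m) (map hf) θ :=
    (h3.comp θ (mdifferentiableAt_jetChart hφ hθ)).congr_of_eventuallyEq h2
  have h5 := mfderiv_comp θ (mdifferentiableAt_jetChart hψ hm) h4
  have h6 : jetChart ψ hψ ∘ map hf =ᶠ[𝓝 θ] jetChart φ hφ := by
    filter_upwards [(isOpen_domain hφ).mem_nhds hθ] with η hη using h1 η hη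
  exact congrArg (fun L => L X) (h5.symm.trans h6.mfderiv_eq)

/-- The connection associated with `Γ` is natural with respect to local diffeomorphisms. -/
lemma mfderiv_map_associated_vert [T2Space E] [T2Space E']
    (hf : IsLocalDiffeomorph 𝓘(ℝ, Coord n m) 𝓘(ℝ, Coord n m) ∞ f)
    (Γ : TangentConnection n m E) [Γ.ContMDiffCovariantDerivative ∞]
    (Γ' : TangentConnection n m E') [Γ'.ContMDiffCovariantDerivative ∞] (hΓ : Carries f Γ Γ')
    (θ : Jet n m E) (X : TangentSpace 𝓘(ℝ, JetCoord n m) θ) :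
    mfderiv 𝓘(ℝ, JetCoord n m) 𝓘(ℝ, JetCoord n m) (map hf) θ ((associated Γ).vert θ X) =
      (associated Γ').vert (map hf θ)
        (mfderiv 𝓘(ℝ, JetCoord n m) 𝓘(ℝ, JetCoord n m) (map hf) θ X) := by
  -- The chart is chosen around the image and pulled back along `f`. Both sides then have the same
  -- coordinate expression, with equal slopes and equal Christoffel maps.
  obtain ⟨ψ, hψ, hθ'⟩ := exists_mem_domain (map hf θ)
  obtain ⟨φ, hφ, hp, h⟩ := exists_chart_comp hf hψ (p := θ.pt) hθ'.1
  have hθ := mem_domain_of_map hf hψ h hp hθ'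
  apply (isInvertible_dJet hψ hθ').injective
  rw [dJet_mfderiv_map hf hφ hψ h hθ, dJet_associated_vert Γ hφ hθ, dJet_associated_vert Γ' hψ hθ',
    dJet_mfderiv_map hf hφ hψ h hθ]
  have hC : christoffelMap Γ φ θ.pt = christoffelMap Γ' ψ (map hf θ).pt :=
    christoffelMap_comp hf hΓ hφ hψ h hp
  rw [jetCoeff, jetCoeff, (map_mem_domain hf hφ hψ h hθ).2, hC]

end Jet

/-! ### Existence of smooth linear connections -/

section Existence

variable {EB : Type*} [NormedAddCommGroup EB] [NormedSpace ℝ EB]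
  {HB : Type*} [TopologicalSpace HB] {I : ModelWithCorners ℝ EB HB}
  {B : Type*} [TopologicalSpace B] [ChartedSpace HB B]
  {F : Type*} [NormedAddCommGroup F] [NormedSpace ℝ F]
  {V : B → Type*} [TopologicalSpace (TotalSpace F V)]
  [∀ x, AddCommGroup (V x)] [∀ x, Module ℝ (V x)] [∀ x, TopologicalSpace (V x)]
  [∀ x, IsTopologicalAddGroup (V x)] [∀ x, ContinuousSMul ℝ (V x)]
  [FiberBundle F V] [VectorBundle ℝ F V]

variable (I) in
/-- The flat connection of a trivialisation. -/
def Bundle.Trivialization.flatDeriv (e : Trivialization F (TotalSpace.proj : TotalSpace F V → B))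
    [e.IsLinear ℝ] (s : Π x, V x) (x : B) : TangentSpace I x →L[ℝ] V x :=
  (e.symmL ℝ x).comp (mvfderiv I (fun y => (e ⟨y, s y⟩).2) x)

section Algebra

variable [ContMDiffVectorBundle 1 F V I]
  (e : Trivialization F (TotalSpace.proj : TotalSpace F V → B)) [MemTrivializationAtlas e]
  {x : B} (hx : x ∈ e.baseSet) {s t : Π x, V x}

include hx

lemma Bundle.Trivialization.flatDeriv_add
    (hs : MDifferentiableAt I (I.prod 𝓘(ℝ, F)) (fun y => TotalSpace.mk' F y (s y)) x)
    (ht : MDifferentiableAt I (I.prod 𝓘(ℝ, F)) (fun y => TotalSpace.mk' F y (t y)) x) :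
    e.flatDeriv I (s + t) x = e.flatDeriv I s x + e.flatDeriv I t x := by
  rw [e.mdifferentiableAt_section_iff _ _ hx] at hs ht
  have h : (fun y => (e ⟨y, (s + t) y⟩).2) =ᶠ[𝓝 x]
      (fun y => (e ⟨y, s y⟩).2) + fun y => (e ⟨y, t y⟩).2 := by
    filter_upwards [e.open_baseSet.mem_nhds hx] with y hy using (e.linear ℝ hy).map_add _ _
  simp only [flatDeriv, mvfderiv_congr h, mvfderiv_add hs ht, ContinuousLinearMap.comp_add]

lemma Bundle.Trivialization.flatDeriv_smul {g : B → ℝ}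
    (hs : MDifferentiableAt I (I.prod 𝓘(ℝ, F)) (fun y => TotalSpace.mk' F y (s y)) x)
    (hg : MDifferentiableAt I 𝓘(ℝ, ℝ) g x) :
    e.flatDeriv I (g • s) x = g x • e.flatDeriv I s x + (mvfderiv I g x).smulRight (s x) := by
  rw [e.mdifferentiableAt_section_iff _ _ hx] at hs
  have h : (fun y => (e ⟨y, (g • s) y⟩).2) =ᶠ[𝓝 x] g • (fun y => (e ⟨y, s y⟩).2) := by
    filter_upwards [e.open_baseSet.mem_nhds hx] with y hy using (e.linear ℝ hy).map_smul _ _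
  have h3 : e.symmL ℝ x (e ⟨x, s x⟩).2 = s x := by
    rw [Trivialization.symmL_apply _ hx]
    exact e.symm_apply_apply_mk hx _
  ext v
  simp only [flatDeriv, mvfderiv_congr h, mvfderiv_smul hg hs, ContinuousLinearMap.comp_apply,
    _root_.add_apply, _root_.smul_apply, map_add, map_smul,
    ContinuousLinearMap.smulRight_apply, h3]

end Algebra

variable [IsManifold I ∞ B] [ContMDiffVectorBundle ∞ F V I]

/-- In the preferred trivialisation at `x` the form becomes the derivative of the coordinates of `s`
in `e`, multiplied by the coordinate change between the two trivialisations. Both factors are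
smooth. -/
lemma Bundle.Trivialization.contMDiffOn_flatDeriv
    (e : Trivialization F (TotalSpace.proj : TotalSpace F V → B)) [MemTrivializationAtlas e]
    {s : Π x, V x}
    (hs : ContMDiff I (I.prod 𝓘(ℝ, F)) ∞ (fun y => TotalSpace.mk' F y (s y))) :
    ContMDiffOn I (I.prod 𝓘(ℝ, EB →L[ℝ] F)) ∞ (fun y => TotalSpace.mk' (EB →L[ℝ] F)
      (E := fun y => TangentSpace I y →L[ℝ] V y) y (e.flatDeriv I s y)) e.baseSet := by
  intro x hx
  apply ContMDiffAt.contMDiffWithinAt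
  have hs' := (e.contMDiffAt_section_iff hx).1 (hs x)
  have h1 := ContMDiffAt.mfderiv_const (m := ∞) hs' (by simp)
  have hx' := FiberBundle.mem_baseSet_trivializationAt' (F := F) (E := V) x
  have h2 : ContMDiffAt I 𝓘(ℝ, F →L[ℝ] F) ∞
      (fun y => (e.coordChangeL ℝ (trivializationAt F V x) y : F →L[ℝ] F)) x :=
    contMDiffAt_coordChangeL hx hx'
  rw [contMDiffAt_hom_bundle]
  refine ⟨contMDiffAt_id, (h2.clm_comp h1).congr_of_eventuallyEq ?_⟩
  filter_upwards [e.open_baseSet.mem_nhds hx,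
    (trivializationAt F V x).open_baseSet.mem_nhds hx'] with y hy hy'
  refine ContinuousLinearMap.ext fun v => ?_
  simp only [inTangentCoordinates, inCoordinates, ContinuousLinearMap.comp_apply,
    ContinuousLinearEquiv.coe_coe, TangentBundle.continuousLinearMapAt_model_space]
  rw [Trivialization.coordChangeL_apply _ _ ⟨hy, hy'⟩,
    Trivialization.continuousLinearMapAt_apply, Trivialization.coe_linearMapAt_of_mem _ hy',
    ← Trivialization.symmL_apply (R := ℝ) _ hy]
  rfl

variable (I F V) in
/-- A smooth vector bundle over a `σ`-compact Hausdorff manifold admits a smooth linear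
connection. -/
theorem CovariantDerivative.exists_contMDiff [FiniteDimensional ℝ EB] [T2Space B]
    [SigmaCompactSpace B] :
    ∃ cov : CovariantDerivative I F V, cov.ContMDiffCovariantDerivative ∞ := by
  have : ContMDiffVectorBundle 1 F V I := ContMDiffVectorBundle.of_le (n := ∞) (by simp)
  obtain ⟨ρ, hρ⟩ := SmoothPartitionOfUnity.exists_isSubordinate I isClosed_univ
    (fun x : B => (trivializationAt F V x).baseSet) (fun x => (trivializationAt F V x).open_baseSet)
    fun x _ => mem_iUnion_of_mem x (FiberBundle.mem_baseSet_trivializationAt' x)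
  have hmem : ∀ {i x}, ρ i x ≠ 0 → x ∈ (trivializationAt F V i).baseSet := fun {i x} h =>
    hρ i (subset_tsupport _ h)
  let D (i : B) (s : Π x, V x) (x : B) := ρ i x • (trivializationAt F V i).flatDeriv I s x
  have hfin : ∀ {x : B} {W : Type _} [AddCommGroup W] [Module ℝ W] (w : B → W),
      HasFiniteSupport fun i => ρ i x • w i := fun {x W} _ _ w =>
    (ρ.locallyFinite.point_finite x).subset fun i hi => left_ne_zero_of_smul hi
  refine ⟨⟨fun s x => ∑ᶠ i, D i s x, ⟨?_, ?_⟩⟩, ⟨⟨?_⟩⟩⟩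
  · intro s t x hs ht _
    rw [← finsum_add_distrib (hfin _) (hfin _)]
    refine finsum_congr fun i => ?_
    by_cases hi : ρ i x = 0
    · simp [D, hi]
    · simp only [D, (trivializationAt F V i).flatDeriv_add (hmem hi) hs ht, smul_add]
  · intro s g x hs hg _
    -- The Leibniz term is shared among the summands, which is possible because the weights add up
    -- to one.
    have h1 : (mvfderiv I g x).smulRight (s x) =
        ∑ᶠ i, ρ i x • (mvfderiv I g x).smulRight (s x) := by
      rw [← finsum_smul, ρ.sum_eq_one (mem_univ x), one_smul]
    have h2 : HasFiniteSupport fun i => D i s x := hfin _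
    have h3 : HasFiniteSupport fun i => g x • D i s x :=
      Set.Finite.subset h2 (support_const_smul_subset (g x) fun i => D i s x)
    rw [h1, smul_finsum, ← finsum_add_distrib h3 (hfin _)]
    refine finsum_congr fun i => ?_
    by_cases hi : ρ i x = 0
    · simp [D, hi]
    · simp only [D, (trivializationAt F V i).flatDeriv_smul (hmem hi) hs hg, smul_add]
      rw [smul_comm]
  · intro s hs
    rw [contMDiffOn_univ] at hs
    rw [contMDiffOn_univ]
    refine ContMDiff.finsum_section_of_locallyFinite (t := fun i x => D i s x) ?_ fun i => ?_
    · exact ρ.locallyFinite.subset fun i x hx => left_ne_zero_of_smul hx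
    · exact ContMDiffOn.smul_section_of_tsupport (ρ i).contMDiff.contMDiffOn
        (trivializationAt F V i).open_baseSet (hρ i)
        ((trivializationAt F V i).contMDiffOn_flatDeriv (by simpa using! hs))

end Existence

/-! ### The topology of the Grassmann bundle -/

section Projections

variable {U W : Type*} [NormedAddCommGroup U] [NormedSpace ℝ U] [FiniteDimensional ℝ U]
  [NormedAddCommGroup W] [NormedSpace ℝ W] [FiniteDimensional ℝ W]

/-- Invertibility fails only when `-t` is an eigenvalue of `M`, which excludes finitely many `t`. -/
lemma dense_setOf_isInvertible_add_smul (M : U →L[ℝ] U) :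
    Dense {t : ℝ | (M + t • ContinuousLinearMap.id ℝ U).IsInvertible} := by
  have hfin : {t : ℝ | Module.End.HasEigenvalue (M : Module.End ℝ U) (-t)}.Finite :=
    (Module.End.finite_hasEigenvalue (M : Module.End ℝ U)).preimage neg_injective.injOn
  refine (hfin.countable.dense_compl ℝ).mono fun t ht => ?_
  have hinj : Injective (M + t • ContinuousLinearMap.id ℝ U) := by
    rw [injective_iff_map_eq_zero]
    intro v hv
    by_contra hv0
    refine ht (Module.End.hasEigenvalue_of_hasEigenvector (x := v) ⟨?_, hv0⟩)
    rw [Module.End.mem_eigenspace_iff]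
    simpa [add_eq_zero_iff_eq_neg] using hv
  exact ⟨(LinearEquiv.ofInjectiveEndo (M + t • ContinuousLinearMap.id ℝ U).toLinearMap
    hinj).toContinuousLinearEquiv, by ext; rfl⟩

lemma isOpen_setOf_isInvertible_fst_comp (g : U →L[ℝ] U × W) :
    IsOpen {L : U × W →L[ℝ] U × W | ((ContinuousLinearMap.fst ℝ U W).comp
      (L.comp g)).IsInvertible} :=
  ContinuousLinearEquiv.isOpen.preimage
    (continuous_const.clm_comp (continuous_id.clm_comp continuous_const))

lemma dense_setOf_isInvertible_fst_comp {g : U →L[ℝ] U × W} (hg : Injective g) :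
    Dense {L : U × W →L[ℝ] U × W | ((ContinuousLinearMap.fst ℝ U W).comp
      (L.comp g)).IsInvertible} := by
  intro L
  obtain ⟨r, hr⟩ := g.toLinearMap.exists_leftInverse_of_injective (LinearMap.ker_eq_bot.2 hg)
  -- With `r` a left inverse of `g`, the direction `L₀` satisfies `fst ∘ L₀ ∘ g = id`. Moving `L`
  -- along `L₀` therefore adds a multiple of the identity to `fst ∘ L ∘ g`, and arbitrarily small
  -- multiples make it invertible.
  let L₀ : U × W →L[ℝ] U × W := (ContinuousLinearMap.inl ℝ U W).comp (LinearMap.toContinuousLinearMap r)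
  have hc : Continuous fun t : ℝ => L + t • L₀ := by fun_prop
  have h := map_mem_closure hc (dense_setOf_isInvertible_add_smul
    ((ContinuousLinearMap.fst ℝ U W).comp (L.comp g)) 0) (t := {L : U × W →L[ℝ] U × W |
      ((ContinuousLinearMap.fst ℝ U W).comp (L.comp g)).IsInvertible}) fun t ht => ?_
  · simpa using h
  · have : (ContinuousLinearMap.fst ℝ U W).comp ((L + t • L₀).comp g) =
        (ContinuousLinearMap.fst ℝ U W).comp (L.comp g) + t • ContinuousLinearMap.id ℝ U := by
      ext v
      have := congrArg (fun f => f v) hr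
      simp at this
      simp [L₀, this]
    change ((ContinuousLinearMap.fst ℝ U W).comp ((L + t • L₀).comp g)).IsInvertible
    rw [this]
    exact ht

end Projections

/-! ### Generic charts, separation and countability for `J¹(E, n)`. -/

namespace Jet

variable {n m : ℕ} {E : Type*} [TopologicalSpace E] [ChartedSpace (Coord n m) E]

/-- A linear change of the coordinates of a divided chart. -/
def linearChange (φ : OpenPartialHomeomorph E (Coord n m)) (L : Coord n m ≃L[ℝ] Coord n m) :
    OpenPartialHomeomorph E (Coord n m) :=
  φ.transHomeomorph L.toHomeomorph

lemma exists_frame (φ : OpenPartialHomeomorph E (Coord n m)) (θ : Jet n m E)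
    (hinj : Injective (dChart φ θ.pt)) :
    ∃ e : (Fin n → ℝ) ≃L[ℝ] θ.plane, Injective ((dChart φ θ.pt).comp (θ.plane.subtypeL.comp
      (e : (Fin n → ℝ) →L[ℝ] θ.plane))) := by
  have : FiniteDimensional ℝ (TangentSpace 𝓘(ℝ, Coord n m) θ.pt) :=
    inferInstanceAs (FiniteDimensional ℝ (Coord n m))
  have : T2Space (TangentSpace 𝓘(ℝ, Coord n m) θ.pt) := inferInstanceAs (T2Space (Coord n m))
  have hd : Module.finrank ℝ (Fin n → ℝ) = Module.finrank ℝ θ.plane := by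
    rw [θ.finrank_plane]; simp
  refine ⟨(LinearEquiv.ofFinrankEq _ _ hd).toContinuousLinearEquiv, ?_⟩
  exact hinj.comp (Subtype.val_injective.comp (ContinuousLinearEquiv.injective _))

section LinearChange

variable [IsManifold 𝓘(ℝ, Coord n m) ∞ E] {φ : OpenPartialHomeomorph E (Coord n m)}
  (hφ : φ ∈ IsManifold.maximalAtlas 𝓘(ℝ, Coord n m) ∞ E)
include hφ

lemma linearChange_mem_maximalAtlas (L : Coord n m ≃L[ℝ] Coord n m) :
    linearChange φ L ∈ IsManifold.maximalAtlas 𝓘(ℝ, Coord n m) ∞ E := by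
  apply OpenPartialHomeomorph.mem_maximalAtlas_of_contMDiffOn
  · exact L.contDiff.contMDiff.comp_contMDiffOn (contMDiffOn_of_mem_maximalAtlas hφ)
  · exact (contMDiffOn_symm_of_mem_maximalAtlas hφ).comp
      L.symm.contDiff.contMDiff.contMDiffOn (fun x hx => hx)

lemma dChart_linearChange (L : Coord n m ≃L[ℝ] Coord n m) {p : E} (hp : p ∈ φ.source) :
    dChart (linearChange φ L) p = (L : Coord n m →L[ℝ] Coord n m).comp (dChart φ p) := by
  have h1 : MDifferentiableAt 𝓘(ℝ, Coord n m) 𝓘(ℝ, Coord n m) φ p :=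
    (contMDiffAt_of_mem_maximalAtlas hφ hp).mdifferentiableAt (by simp)
  have h2 : HasMFDerivAt 𝓘(ℝ, Coord n m) 𝓘(ℝ, Coord n m) L (φ p)
      (L : Coord n m →L[ℝ] Coord n m) := L.hasFDerivAt.hasMFDerivAt
  exact (h2.comp p h1.hasMFDerivAt).mfderiv

/-- The linear changes of coordinates after which a jet lies in the domain of the chart are generic:
they contain the invertible elements of a dense open set. -/
lemma exists_dense_forall_mem_domain_linearChange {θ : Jet n m E} (hθ : θ.pt ∈ φ.source) :
    ∃ S : Set (Coord n m →L[ℝ] Coord n m), IsOpen S ∧ Dense S ∧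
      ∀ L : Coord n m ≃L[ℝ] Coord n m, (L : Coord n m →L[ℝ] Coord n m) ∈ S →
        θ ∈ domain (linearChange φ L) := by
  obtain ⟨e, he⟩ := exists_frame φ θ (isInvertible_dChart hφ hθ).injective
  -- The set consists of the `L` for which the image of a frame of the plane still projects
  -- isomorphically to `ℝⁿ`.
  refine ⟨_, isOpen_setOf_isInvertible_fst_comp _, dense_setOf_isInvertible_fst_comp he,
    fun L hL => ⟨hθ, ?_⟩⟩
  have h : horMap (linearChange φ L) θ = ((ContinuousLinearMap.fst ℝ (Fin n → ℝ) (Fin m → ℝ)).comp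
      ((L : Coord n m →L[ℝ] Coord n m).comp ((dChart φ θ.pt).comp (θ.plane.subtypeL.comp
        (e : (Fin n → ℝ) →L[ℝ] θ.plane))))).comp (e.symm : θ.plane →L[ℝ] (Fin n → ℝ)) := by
    rw [horMap, dChart_linearChange hφ L hθ]
    ext v : 1
    simp
  rw [h]
  exact IsInvertible.comp hL ⟨e.symm, rfl⟩

end LinearChange

variable [IsManifold 𝓘(ℝ, Coord n m) ∞ E]

/-- Jets over different points are separated in `E`. Two jets over the same point lie in a common
jet chart, since a generic linear change of coordinates makes both planes graphs; the chart then
separates them. -/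
instance [T2Space E] : T2Space (Jet n m E) := by
  refine ⟨fun θ η hne => ?_⟩
  by_cases hp : θ.pt = η.pt
  · have hc : chartAt (Coord n m) θ.pt ∈ IsManifold.maximalAtlas 𝓘(ℝ, Coord n m) ∞ E :=
      IsManifold.chart_mem_maximalAtlas θ.pt
    have hθ := mem_chart_source (Coord n m) θ.pt
    have hη : η.pt ∈ (chartAt (Coord n m) θ.pt).source := by rwa [← hp]
    obtain ⟨S, hSo, hSd, hS⟩ := exists_dense_forall_mem_domain_linearChange hc hθ
    obtain ⟨T, -, hTd, hT⟩ := exists_dense_forall_mem_domain_linearChange hc hη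
    -- An open dense set meets a dense set in a dense set, which meets the nonempty open set of
    -- invertible maps.
    obtain ⟨_, ⟨hLS, hLT⟩, ⟨L, rfl⟩⟩ := (hSd.inter_of_isOpen_left hTd hSo).exists_mem_open
      (ContinuousLinearEquiv.isOpen (𝕜 := ℝ) (E := Coord n m) (F := Coord n m))
      ⟨_, ContinuousLinearEquiv.refl ℝ _, rfl⟩
    set e := jetChart _ (linearChange_mem_maximalAtlas hc L)
    have hθe : θ ∈ e.source := hS L hLS
    have hηe : η ∈ e.source := hT L hLT
    obtain ⟨u, v, hu, hv, hθu, hηv, huv⟩ :=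
      t2_separation fun h => hne (e.injOn hθe hηe h)
    exact ⟨_, _, e.isOpen_inter_preimage hu, e.isOpen_inter_preimage hv, ⟨hθe, hθu⟩, ⟨hηe, hηv⟩,
      (huv.preimage e).mono inter_subset_right inter_subset_right⟩
  · obtain ⟨u, v, hu, hv, hθ, hη, huv⟩ := t2_separation hp
    exact ⟨_, _, hu.preimage contMDiff_pt.continuous, hv.preimage contMDiff_pt.continuous,
      hθ, hη, huv.preimage _⟩

/-- Countably many charts cover `E`. Composing them with the invertible elements of a countable
dense set of linear maps gives countably many jet charts, and by genericity these cover `J¹(E, n)`.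
-/
instance [SigmaCompactSpace E] : SecondCountableTopology (Jet n m E) := by
  obtain ⟨s, hs, hcover⟩ := countable_cover_nhds_of_sigmaCompact
    fun x : E => chart_source_mem_nhds (Coord n m) x
  obtain ⟨D, hDc, hDd⟩ := TopologicalSpace.exists_countable_dense (Coord n m →L[ℝ] Coord n m)
  have : Countable s := hs
  have : Countable D := hDc
  let toD : {L : Coord n m ≃L[ℝ] Coord n m // (L : Coord n m →L[ℝ] Coord n m) ∈ D} → D :=
    fun L => ⟨L.1, L.2⟩
  have : Countable {L : Coord n m ≃L[ℝ] Coord n m // (L : Coord n m →L[ℝ] Coord n m) ∈ D} :=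
    Injective.countable (f := toD) fun L L' h => Subtype.ext
      (ContinuousLinearEquiv.coe_injective (congrArg Subtype.val h))
  have hc : ∀ x : E, chartAt (Coord n m) x ∈ IsManifold.maximalAtlas 𝓘(ℝ, Coord n m) ∞ E :=
    fun x => IsManifold.chart_mem_maximalAtlas x
  let e (i : s × {L : Coord n m ≃L[ℝ] Coord n m // (L : Coord n m →L[ℝ] Coord n m) ∈ D}) :=
    jetChart _ (linearChange_mem_maximalAtlas (hc i.1) i.2.1)
  have : ∀ i, SecondCountableTopology (e i).source := fun i => (e i).secondCountableTopology_source
  refine TopologicalSpace.secondCountableTopology_of_countable_cover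
    (fun i => (e i).open_source) (eq_univ_of_forall fun θ => ?_)
  obtain ⟨x, hx, hθ⟩ := mem_iUnion₂.1 (hcover ▸ mem_univ θ.pt)
  obtain ⟨S, hSo, hSd, hS⟩ := exists_dense_forall_mem_domain_linearChange (hc x) hθ
  -- The good invertible maps form an open set, nonempty because `S` is dense and invertible maps
  -- are open, so the countable set `D` meets it.
  obtain ⟨_, hLD, hLS, ⟨L, rfl⟩⟩ := hDd.exists_mem_open
    (hSo.inter (ContinuousLinearEquiv.isOpen (𝕜 := ℝ) (E := Coord n m) (F := Coord n m)))
    (by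
      obtain ⟨L, h1, h2⟩ := hSd.exists_mem_open (ContinuousLinearEquiv.isOpen (𝕜 := ℝ)
        (E := Coord n m) (F := Coord n m)) ⟨_, ContinuousLinearEquiv.refl ℝ _, rfl⟩
      exact ⟨L, h1, h2⟩)
  exact mem_iUnion_of_mem ⟨⟨x, hx⟩, L, hLD⟩ (hS L hLS)

instance [SigmaCompactSpace E] : SigmaCompactSpace (Jet n m E) :=
  have := ChartedSpace.locallyCompactSpace (JetCoord n m) (Jet n m E)
  inferInstance

/-- Smooth linear connections on the dual of the pseudo-horizontal bundle exist. -/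
lemma exists_contMDiff_horDualConnection (n m : ℕ) (E : Type*) [TopologicalSpace E] [T2Space E]
    [SigmaCompactSpace E] [ChartedSpace (Coord n m) E] [IsManifold 𝓘(ℝ, Coord n m) ∞ E] :
    ∃ Ξ : HorDualConnection n m E, Ξ.ContMDiffCovariantDerivative ∞ :=
  CovariantDerivative.exists_contMDiff 𝓘(ℝ, JetCoord n m) ((Fin n → ℝ) →L[ℝ] ℝ)
    (DualFib (Hor n m E))

end Jet

end

/-! ### Assembly of the theorem. -/

theorem mainTheorem1 {n m : ℕ} {E : Type*} [TopologicalSpace E] [T2Space E] [SigmaCompactSpace E]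
    [ChartedSpace (Coord n m) E] [IsManifold 𝓘(ℝ, Coord n m) ∞ E]
    (Γ : Jet.TangentConnection n m E) [Γ.ContMDiffCovariantDerivative ∞] (hΓ : Γ.torsion = 0) :
    (∃ Ξ : Jet.HorDualConnection n m E, Ξ.ContMDiffCovariantDerivative ∞) ∧
    ∃ Γdot : Jet.JetConnection n m E,
      (∀ Ξ : Jet.HorDualConnection n m E, Ξ.ContMDiffCovariantDerivative ∞ →
        ∀ Δ : Jet.JetConnection n m E, Jet.IsInduced Γ Ξ Δ ↔ Δ = Γdot) ∧
      (∀ (φ : OpenPartialHomeomorph E (Coord n m))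
        (hφ : φ ∈ IsManifold.maximalAtlas 𝓘(ℝ, Coord n m) ∞ E) (θ : Jet n m E),
        θ ∈ (Jet.jetChart φ hφ).source → ∀ (A : Fin n ⊕ Fin m) (k : Fin m) (ξ : Fin n),
        Jet.jetChristoffel Γdot φ hφ A k ξ θ =
          Jet.christoffel Γ φ A (.inr k) (.inl ξ) θ.pt
          + ∑ i : Fin m, Jet.christoffel Γ φ A (.inr k) (.inr i) θ.pt * Jet.uCoord φ i ξ θ
          - ∑ β : Fin n, Jet.uCoord φ k β θ *
              (Jet.christoffel Γ φ A (.inl β) (.inl ξ) θ.pt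
                + ∑ i : Fin m, Jet.christoffel Γ φ A (.inl β) (.inr i) θ.pt *
                    Jet.uCoord φ i ξ θ)) ∧
      (∀ {E' : Type*} [TopologicalSpace E'] [T2Space E'] [SigmaCompactSpace E']
        [ChartedSpace (Coord n m) E'] [IsManifold 𝓘(ℝ, Coord n m) ∞ E']
        (Γ' : Jet.TangentConnection n m E') [Γ'.ContMDiffCovariantDerivative ∞]
        (_ : Γ'.torsion = 0) (Γdot' : Jet.JetConnection n m E')
        (_ : ∀ Ξ' : Jet.HorDualConnection n m E', Ξ'.ContMDiffCovariantDerivative ∞ →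
          Jet.IsInduced Γ' Ξ' Γdot')
        (f : E → E') (hf : IsLocalDiffeomorph 𝓘(ℝ, Coord n m) 𝓘(ℝ, Coord n m) ∞ f)
        (_ : Jet.Carries f Γ Γ') (θ : Jet n m E) (X : TangentSpace 𝓘(ℝ, JetCoord n m) θ),
        mfderiv 𝓘(ℝ, JetCoord n m) 𝓘(ℝ, JetCoord n m) (Jet.map hf) θ (Γdot.vert θ X) =
          Γdot'.vert (Jet.map hf θ)
            (mfderiv 𝓘(ℝ, JetCoord n m) 𝓘(ℝ, JetCoord n m) (Jet.map hf) θ X)) := by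
  refine ⟨Jet.exists_contMDiff_horDualConnection n m E, Jet.associated Γ,
    fun Ξ _ Δ => Jet.isInduced_iff Γ Ξ Δ,
    fun φ hφ θ hθ A k ξ => Jet.jetChristoffel_associated Γ φ hφ θ hθ A k ξ, ?_⟩
  intro E' _ _ _ _ _ Γ' _ _ Γdot' h f hf hΓ' θ X
  -- `Γdot'` is known only through an equation for each smooth `Ξ'`. Existence of one such `Ξ'`
  -- keeps this from being vacuous and identifies `Γdot'` with the associated connection of `Γ'`.
  obtain ⟨Ξ', hΞ'⟩ := Jet.exists_contMDiff_horDualConnection n m E'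
  rw [(Jet.isInduced_iff Γ' Ξ' Γdot').1 (h Ξ' hΞ')]
  exact Jet.mfderiv_map_associated_vert hf Γ Γ' hΓ' θ X
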